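/- Let $N\ge 2$, $1<p<\infty$, $0<s<1$, $sp<N$, $a>0$, $b\ge 0$, $0<\gamma<1$, and let $\Omega\subset\mathbb{R}^N$ be a bounded domain (a nonempty, open, connected, bounded set). Let $K:\mathbb{R}^N\setminus\{0\}\to(0,\infty)$ be measurable with $K(-x)=K(x)$, $\min\{|x|^p,1\}\,K\in L^1(\mathbb{R}^N)$, and $K(x)\ge\delta|x|^{-N-ps}$ for all $x\neq 0$ and some $\delta>0$. Let $h:\Omega\to[0,\infty)$ be bounded, measurable and not a.e. equal to $0$. Put $Q=\mathbb{R}^{2N}\setminus(\Omega^c\times\Omega^c)$. Let $X_0$ be the space of Lebesgue measurable $u:\mathbb{R}^N\to\mathbb{R}$ (modulo equality a.e.) with $u|_\Omega\in L^p(\Omega)$, $u=0$ a.e. in $\mathbb{R}^N\setminus\Omega$ and $\|u\|^p:=\int_Q|u(x)-u(y)|^pK(x-y)\,dx\,dy<\infty$, and for $u,\varphi\in X_0$ write $$\langle u,\varphi\rangle=\int_Q|u(x)-u(y)|^{p-2}(u(x)-u(y))(\varphi(x)-\varphi(y))K(x-y)\,dx\,dy .$$ For a function $u$, "$u>0$ in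 $\Omega$" means $\operatorname{ess\,inf}_V u>0$ for every compact $V\subset\Omega$. For $\mu>0$, a weak solution of $$(a+b\|u\|^p)\,\mathfrak{L}_p^s u=\mu\,h\,u^{-\gamma}\ \text{in }\Omega,\qquad u>0\ \text{in }\Omega,\qquad u=0\ \text{in }\mathbb{R}^N\setminus\Omega \tag{1}$$ is a function $u\in X_0$ with $u>0$ in $\Omega$ such that, for all $\varphi\in X_0$, $h\,u^{-\gamma}\varphi\in L^1(\Omega)$ and $$(a+b\|u\|^p)\langle u,\varphi\rangle=\mu\int_\Omega h\,u^{-\gamma}\varphi\,dx .$$ A positive first eigenfunction is a $v_0\in X_0$ with $v_0>0$ in $\Omega$ and $\langle v_0,\varphi\rangle=\lambda_1\int_\Omega|v_0|^{p-2}v_0\varphi\,dx$ for all $\varphi\in X_0$, where $\lambda_1=\inf_{w\in X_0\setminus\{0\}}\|w\|^p/\int_\Omega|w|^p\,dx$. Then a positive first eigenfunction exists, and for every $\mu>0$ problem (1) has a unique weak solution $\underline{u}_\mu\in X_0$. Moreover, for every positive first eigenfunction $v_0$ there is a constant $\varepsilon_\mu>0$ such that $\underline{u}_\mu\ge\varepsilon_\mu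 v_0$ a.e. in $\Omega$. -/

import Mathlib

open MeasureTheory

namespace FracKirchhoff

/-- Admissible kernels on `ℝ^N \ {0}`: measurable, positive, even,
`min {|x|^p, 1} K ∈ L¹(ℝ^N)` and `K(x) ≥ δ |x|^{-N-ps}`. The value `K 0` plays no role. -/
structure IsAdmissibleKernel {N : ℕ} (p s : ℝ) (K : EuclideanSpace ℝ (Fin N) → ℝ) : Prop where
  measurable : Measurable K
  pos : ∀ x, x ≠ 0 → 0 < K x
  integrable : Integrable (fun x => min (‖x‖ ^ p) 1 * K x) volume
  lower_bound : ∃ δ : ℝ, 0 < δ ∧ ∀ x, x ≠ 0 → δ * ‖x‖ ^ (-(N : ℝ) - p * s) ≤ K x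
  even : ∀ x, x ≠ 0 → K (-x) = K x

/-- `Q = ℝ^{2N} \ (Ωᶜ × Ωᶜ)`. -/
def regionQ {N : ℕ} (Ω : Set (EuclideanSpace ℝ (Fin N))) :
    Set (EuclideanSpace ℝ (Fin N) × EuclideanSpace ℝ (Fin N)) :=
  (Ωᶜ ×ˢ Ωᶜ)ᶜ

/-- Membership in `X₀`: `u` is Lebesgue measurable on `ℝ^N`, its restriction to `Ω` is in `L^p(Ω)`,
`∫_Q |u(x) - u(y)|^p K(x - y) dx dy < ∞`, and `u = 0` a.e. outside `Ω`. Functions are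
identified when they agree almost everywhere. -/
structure MemX0 {N : ℕ} (p : ℝ) (K : EuclideanSpace ℝ (Fin N) → ℝ)
    (Ω : Set (EuclideanSpace ℝ (Fin N))) (u : EuclideanSpace ℝ (Fin N) → ℝ) : Prop where
  aestronglyMeasurable : AEStronglyMeasurable u volume
  memLp : MemLp u (ENNReal.ofReal p) (volume.restrict Ω)
  integrableOn : IntegrableOn
    (fun z : EuclideanSpace ℝ (Fin N) × EuclideanSpace ℝ (Fin N) =>
      |u z.1 - u z.2| ^ p * K (z.1 - z.2)) (regionQ Ω) (volume.prod volume)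
  eq_zero : ∀ᵐ x ∂(volume.restrict Ωᶜ), u x = 0

/-- `‖u‖^p = ∫_Q |u(x) - u(y)|^p K(x - y) dx dy`, the `p`-th power of the norm of `X₀`. -/
noncomputable def normPow {N : ℕ} (p : ℝ) (K : EuclideanSpace ℝ (Fin N) → ℝ)
    (Ω : Set (EuclideanSpace ℝ (Fin N))) (u : EuclideanSpace ℝ (Fin N) → ℝ) : ℝ :=
  ∫ z in regionQ Ω, |u z.1 - u z.2| ^ p * K (z.1 - z.2) ∂(volume.prod volume)

/-- The weak form of the nonlocal operator:
`⟨u, φ⟩ = ∫_Q |u(x) - u(y)|^{p-2} (u(x) - u(y)) (φ(x) - φ(y)) K(x - y) dx dy`. -/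
noncomputable def pairing {N : ℕ} (p : ℝ) (K : EuclideanSpace ℝ (Fin N) → ℝ)
    (Ω : Set (EuclideanSpace ℝ (Fin N))) (u φ : EuclideanSpace ℝ (Fin N) → ℝ) : ℝ :=
  ∫ z in regionQ Ω, |u z.1 - u z.2| ^ (p - 2) * (u z.1 - u z.2) * (φ z.1 - φ z.2) * K (z.1 - z.2)
    ∂(volume.prod volume)

/-- `u > 0` in `Ω`, meaning `ess inf_V u > 0` for every compact `V ⊆ Ω`. -/
def PositiveIn {N : ℕ} (Ω : Set (EuclideanSpace ℝ (Fin N)))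
    (u : EuclideanSpace ℝ (Fin N) → ℝ) : Prop :=
  ∀ V : Set (EuclideanSpace ℝ (Fin N)), IsCompact V → V ⊆ Ω →
    ∃ c : ℝ, 0 < c ∧ ∀ᵐ x ∂(volume.restrict V), c ≤ u x

/-- `u` is a weak solution of `(a + b ‖u‖^p) 𝔏 u = μ h u^{-γ}` in `Ω`, `u > 0` in `Ω`,
`u = 0` outside `Ω`. -/
structure IsPositiveWeakSolution {N : ℕ} (p a b γ μ : ℝ) (K : EuclideanSpace ℝ (Fin N) → ℝ)
    (Ω : Set (EuclideanSpace ℝ (Fin N))) (h u : EuclideanSpace ℝ (Fin N) → ℝ) : Prop where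
  memX0 : MemX0 p K Ω u
  positive : PositiveIn Ω u
  integrableOn : ∀ φ : EuclideanSpace ℝ (Fin N) → ℝ, MemX0 p K Ω φ →
    IntegrableOn (fun x => h x * u x ^ (-γ) * φ x) Ω volume
  weak_eq : ∀ φ : EuclideanSpace ℝ (Fin N) → ℝ, MemX0 p K Ω φ →
    (a + b * normPow p K Ω u) * pairing p K Ω u φ = μ * ∫ x in Ω, h x * u x ^ (-γ) * φ x

/-- The first eigenvalue of the nonlocal operator on `X₀`: the infimum of the Rayleigh quotient
`∫_Q |w(x) - w(y)|^p K(x - y) dx dy / ∫_Ω |w|^p dx` over `w ∈ X₀ \ {0}`. -/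
noncomputable def firstEigenvalue {N : ℕ} (p : ℝ) (K : EuclideanSpace ℝ (Fin N) → ℝ)
    (Ω : Set (EuclideanSpace ℝ (Fin N))) : ℝ :=
  sInf {r : ℝ | ∃ w : EuclideanSpace ℝ (Fin N) → ℝ, MemX0 p K Ω w ∧ ¬ (w =ᵐ[volume] 0) ∧
    r = normPow p K Ω w / ∫ x in Ω, |w x| ^ p}

/-- `v` is a positive first eigenfunction: `v ∈ X₀`, `v > 0` in `Ω`, and `v` is a weak solution of
`𝔏 v = λ₁ |v|^{p-2} v` in `Ω`, with `λ₁` the first eigenvalue. -/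
structure IsPositiveFirstEigenfunction {N : ℕ} (p : ℝ) (K : EuclideanSpace ℝ (Fin N) → ℝ)
    (Ω : Set (EuclideanSpace ℝ (Fin N))) (v : EuclideanSpace ℝ (Fin N) → ℝ) : Prop where
  memX0 : MemX0 p K Ω v
  positive : PositiveIn Ω v
  weak_eq : ∀ φ : EuclideanSpace ℝ (Fin N) → ℝ, MemX0 p K Ω φ →
    pairing p K Ω v φ = firstEigenvalue p K Ω * ∫ x in Ω, |v x| ^ (p - 2) * v x * φ x

end FracKirchhoff

/-! Existence is variational. Put q = 1 - γ, which lies in (0,1), and E(u) = ‖u‖^p. The energy J(u)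
= (a/p) E(u) + (b/2p) E(u)² - (μ/q) ∫_Ω h|u|^q is coercive because q < p. Compactness of X₀ in L^p
(`exists_subseq_tendsto`) and Fatou's lemma give a minimizer u on the cone of nonnegative functions.
It is not 0, since J(td) < 0 for small t > 0, where d is the distance to Ωᶜ. The potential is not
differentiable where u vanishes, so positivity has to come before the equation. Moving from u in a
direction φ ≥ 0 can only increase the potential, hence ⟨u,φ⟩ ≥ 0, and the strong minimum principle
`positiveIn_of_supersolution` yields u > 0 in Ω. Fatou's lemma on difference quotients then makes h
u^{-γ} φ integrable and gives one inequality for φ ≥ 0. Testing with (u + tφ)⁺ and letting t → 0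
extends it to every φ (`le_of_isEnergyMinimizer`), and replacing φ by -φ gives the equation. The
minimum principle is a De Giorgi iteration on the truncations (ε(d - τ) - u)⁺. A Caccioppoli
estimate and a Faber–Krahn inequality give a superlinear recursion for the measures of their
supports. The first measure is small because of the long-range interaction with a set on which u is
bounded below. A positive first eigenfunction is a nonnegative minimizer of the Rayleigh quotient,
made positive by the same principle. Every positive first eigenfunction v is bounded, again by De
Giorgi iteration. To compare it with u (`exists_mul_le_supersolution`), a bump cη supported well
inside Ω is added to εv: away from the bump, the nonlocal interaction with it outweighs the
right-hand side ε^{p-1} λ₁ v^{p-1}, so that εv + cη can be compared with u up to the boundary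
without any boundary regularity. For uniqueness, subtract the equations of two solutions. Since
t^{-γ} is decreasing and Young's inequality holds, their Kirchhoff coefficients coincide; strict
monotonicity of the operator does the rest. -/

namespace FracKirchhoff

/-! ### Scalar inequalities and numerical lemmas. -/

open Filter Topology

/-- The odd power `t ↦ |t|^{p-2} t`. -/
noncomputable def signedPow (p t : ℝ) : ℝ := |t| ^ (p - 2) * t

lemma signedPow_of_nonneg {p t : ℝ} (hp : 1 < p) (ht : 0 ≤ t) : signedPow p t = t ^ (p - 1) := by
  rcases ht.eq_or_lt with rfl | ht
  -- For p < 2 the convention for `0 ^ (p - 2)` is harmless, since the other factor is 0.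
  · simp [signedPow, Real.zero_rpow (by linarith : p - 1 ≠ 0)]
  · rw [signedPow, abs_of_pos ht, ← Real.rpow_add_one ht.ne']; ring_nf

lemma signedPow_neg (p t : ℝ) : signedPow p (-t) = -signedPow p t := by
  simp [signedPow]

lemma abs_signedPow {p : ℝ} (hp : 1 < p) (t : ℝ) : |signedPow p t| = |t| ^ (p - 1) := by
  rw [← signedPow_of_nonneg hp (abs_nonneg t), signedPow, signedPow, abs_mul, abs_abs,
    abs_of_nonneg (Real.rpow_nonneg (abs_nonneg t) _)]

lemma signedPow_mul_self {p : ℝ} (hp : 1 < p) (t : ℝ) : signedPow p t * t = |t| ^ p := by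
  have h : signedPow p t * t = |t| ^ (p - 2) * |t| * |t| := by
    rw [signedPow, mul_assoc, mul_assoc, abs_mul_abs_self]
  rw [h]
  have h2 := signedPow_of_nonneg hp (abs_nonneg t)
  rw [signedPow, abs_abs] at h2
  rw [h2]
  rcases (abs_nonneg t).eq_or_lt with h0 | h0
  · rw [← h0, mul_zero, Real.zero_rpow (by linarith : p ≠ 0)]
  · rw [← Real.rpow_add_one h0.ne']; ring_nf

lemma strictMono_signedPow {p : ℝ} (hp : 1 < p) : StrictMono (signedPow p) := by
  refine strictMono_of_odd_strictMonoOn_nonneg (fun t => signedPow_neg p t) ?_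
  intro s hs t ht hst
  rw [Set.mem_Ici] at hs ht
  rw [signedPow_of_nonneg hp hs, signedPow_of_nonneg hp ht]
  exact Real.rpow_lt_rpow hs hst (by linarith)

lemma signedPow_smul {p c : ℝ} (hp : 1 < p) (hc : 0 ≤ c) (t : ℝ) :
    signedPow p (c * t) = c ^ (p - 1) * signedPow p t := by
  have h := signedPow_of_nonneg hp hc
  rw [signedPow] at h
  rw [signedPow, signedPow, abs_mul, Real.mul_rpow (abs_nonneg _) (abs_nonneg _), ← h]
  ring

lemma measurable_signedPow (p : ℝ) : Measurable (signedPow p) := by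
  unfold signedPow; fun_prop

lemma abs_add_rpow_le {p : ℝ} (hp : 0 ≤ p) (s t : ℝ) :
    |s + t| ^ p ≤ 2 ^ p * (|s| ^ p + |t| ^ p) := by
  have h1 : |s + t| ≤ 2 * max |s| |t| := by
    have := abs_add_le s t
    have := le_max_left |s| |t|
    have := le_max_right |s| |t|
    linarith
  calc |s + t| ^ p ≤ (2 * max |s| |t|) ^ p := Real.rpow_le_rpow (abs_nonneg _) h1 hp
    _ = 2 ^ p * (max |s| |t|) ^ p := Real.mul_rpow (by norm_num) (by positivity)
    _ ≤ 2 ^ p * (|s| ^ p + |t| ^ p) := by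
      gcongr
      rcases max_cases |s| |t| with ⟨h, _⟩ | ⟨h, _⟩ <;> rw [h] <;>
        linarith [Real.rpow_nonneg (abs_nonneg s) p, Real.rpow_nonneg (abs_nonneg t) p]

lemma abs_signedPow_mul_le {p : ℝ} (hp : 1 < p) (s t : ℝ) :
    |signedPow p s * t| ≤ (1 - 1 / p) * |s| ^ p + 1 / p * |t| ^ p := by
  have hp0 : 0 < p := by linarith
  have hq : Real.HolderConjugate (p / (p - 1)) p := by
    rw [Real.holderConjugate_iff]
    constructor
    · rw [lt_div_iff₀ (by linarith)]; linarith
    · field_simp; ring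
  have h := Real.young_inequality_of_nonneg (abs_nonneg (signedPow p s)) (abs_nonneg t) hq
  rw [abs_mul]
  refine h.trans (le_of_eq ?_)
  rw [abs_signedPow hp, ← Real.rpow_mul (abs_nonneg _)]
  have : (p - 1) * (p / (p - 1)) = p := by
    have : p - 1 ≠ 0 := by linarith
    field_simp
  rw [this]
  have : p - 1 ≠ 0 := by linarith
  field_simp

/-- By oddness w ≥ 0 may be assumed. If |g| ≤ w/2, then g - w ≤ -w/2 and the left side is at most
-(1/2)^{p-1} w^p. Otherwise w < 2|g|, and all terms are multiples of |g|^p: the left side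
contributes 2·3^{p-1} and the subtracted term at most 2. -/
lemma signedPow_sub_mul_le {p : ℝ} (hp : 1 < p) (g w : ℝ) :
    signedPow p (g - w) * w ≤
      (2 * 3 ^ (p - 1) + 2) * |g| ^ p - (1 / 2) ^ (p - 1) * |w| ^ p := by
  wlog hw : 0 ≤ w generalizing g w
  · have := this (-g) (-w) (by linarith)
    rw [abs_neg, abs_neg, show -g - -w = -(g - w) by ring, signedPow_neg] at this
    linarith
  have hC : (0 : ℝ) ≤ (2 * 3 ^ (p - 1) + 2) * |g| ^ p := by positivity
  have hsplit : ∀ t : ℝ, 0 ≤ t → t ^ p = t ^ (p - 1) * t := by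
    intro t ht
    rcases ht.eq_or_lt with rfl | ht
    · rw [mul_zero, Real.zero_rpow (by linarith)]
    · rw [← Real.rpow_add_one ht.ne']; ring_nf
  by_cases h : |g| ≤ w / 2
  · have h1 : signedPow p (g - w) ≤ signedPow p (-(w / 2)) :=
      (strictMono_signedPow hp).monotone (by linarith [le_abs_self g])
    rw [signedPow_neg, signedPow_of_nonneg hp (by linarith : 0 ≤ w / 2)] at h1
    have h2 : (w / 2) ^ (p - 1) = (1 / 2) ^ (p - 1) * w ^ (p - 1) := by
      rw [← Real.mul_rpow (by norm_num) hw]; ring_nf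
    rw [abs_of_nonneg hw, hsplit w hw]
    have := mul_le_mul_of_nonneg_right h1 hw
    rw [h2] at this
    linarith
  · push Not at h
    have h1 : |signedPow p (g - w)| ≤ (3 * |g|) ^ (p - 1) := by
      rw [abs_signedPow hp]
      refine Real.rpow_le_rpow (abs_nonneg _) ?_ (by linarith)
      have := abs_sub g w
      rw [abs_of_nonneg hw] at this
      linarith
    have h2 : signedPow p (g - w) * w ≤ (3 * |g|) ^ (p - 1) * (2 * |g|) :=
      mul_le_mul ((le_abs_self _).trans h1) (by linarith) hw (by positivity)
    rw [Real.mul_rpow (by norm_num) (abs_nonneg g)] at h2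
    have h3 : (1 / 2 : ℝ) ^ (p - 1) * |w| ^ p ≤ (1 / 2 : ℝ) ^ (p - 1) * (2 * |g|) ^ p := by
      gcongr
      rw [abs_of_nonneg hw]; linarith
    have h4 : (1 / 2 : ℝ) ^ (p - 1) * (2 * |g|) ^ p = 2 * |g| ^ p := by
      rw [Real.mul_rpow (by norm_num) (abs_nonneg g), hsplit 2 (by norm_num)]
      have : (1 / 2 : ℝ) ^ (p - 1) * 2 ^ (p - 1) = 1 := by
        rw [← Real.mul_rpow (by norm_num) (by norm_num)]; norm_num
      linear_combination (2 * |g| ^ p) * this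
    rw [h4] at h3
    rw [hsplit _ (abs_nonneg g)] at h3 ⊢
    linarith

/-- Pointwise Caccioppoli inequality for the truncation `(g - u)⁺`. -/
lemma signedPow_mul_posPart_sub_le {p : ℝ} (hp : 1 < p) (a b g g' : ℝ) :
    signedPow p (a - b) * (max (g - a) 0 - max (g' - b) 0) ≤
      (2 * 3 ^ (p - 1) + 2) * |g - g'| ^ p
        - (1 / 2) ^ (p - 1) * |max (g - a) 0 - max (g' - b) 0| ^ p := by
  have hm := (strictMono_signedPow hp).monotone
  have key := signedPow_sub_mul_le hp (g - g') (max (g - a) 0 - max (g' - b) 0)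
  refine le_trans ?_ key
  -- Let w be the difference of the truncations. When both are active, a - b equals g - g' - w. When
  -- one is active, the two numbers are ordered in the direction required by the sign of w.
  rcases le_total (g - a) 0 with h1 | h1 <;> rcases le_total (g' - b) 0 with h2 | h2
  · simp [max_eq_right h1, max_eq_right h2]
  · rw [max_eq_right h1, max_eq_left h2]
    refine mul_le_mul_of_nonpos_right (hm ?_) ?_ <;> linarith
  · rw [max_eq_left h1, max_eq_right h2]
    refine mul_le_mul_of_nonneg_right (hm ?_) ?_ <;> linarith
  · rw [max_eq_left h1, max_eq_left h2]
    refine le_of_eq ?_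
    congr 2; ring

/-- Truncation at level l is nondecreasing and 1-Lipschitz, so the truncated increment has the sign
of a - b and is no larger. This bounds the energy of a truncated subsolution by its pairing with the
truncation. -/
lemma rpow_abs_posPart_sub_le_signedPow_mul {p : ℝ} (hp : 1 < p) (a b l : ℝ) :
    |max (a - l) 0 - max (b - l) 0| ^ p ≤
      signedPow p (a - b) * (max (a - l) 0 - max (b - l) 0) := by
  wlog hab : b ≤ a generalizing a b
  · have := this b a (by linarith)
    rw [abs_sub_comm, ← neg_sub a b, signedPow_neg] at this
    linarith
  have hm := (strictMono_signedPow hp).monotone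
  set w := max (a - l) 0 - max (b - l) 0 with hw
  have h0 : 0 ≤ w := by
    rw [hw, sub_nonneg]; exact max_le_max (by linarith) le_rfl
  have h1 : w ≤ a - b := by
    have h3 : max (a - l) 0 ≤ (a - b) + max (b - l) 0 := by
      apply max_le
      · linarith [le_max_left (b - l) 0]
      · linarith [le_max_right (b - l) 0]
    linarith
  rw [← signedPow_mul_self hp]
  exact mul_le_mul_of_nonneg_right (hm h1) h0

lemma signedPow_sub_mul_posPart_nonneg {p : ℝ} (hp : 1 < p) (a b a' b' : ℝ) :
    0 ≤ (signedPow p (a - b) - signedPow p (a' - b')) * (max (a - a') 0 - max (b - b') 0) := by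
  have hm := (strictMono_signedPow hp).monotone
  rcases le_total (a - a') (b - b') with h | h
  · refine mul_nonneg_of_nonpos_of_nonpos (sub_nonpos.2 (hm (by linarith))) ?_
    exact sub_nonpos.2 (max_le_max h le_rfl)
  · refine mul_nonneg (sub_nonneg.2 (hm (by linarith))) ?_
    exact sub_nonneg.2 (max_le_max h le_rfl)

lemma posPart_sub_eq_of_signedPow_sub_mul {p : ℝ} (hp : 1 < p) {a b a' b' : ℝ}
    (h : (signedPow p (a - b) - signedPow p (a' - b')) * (max (a - a') 0 - max (b - b') 0) = 0) :
    max (a - a') 0 = max (b - b') 0 := by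
  rcases mul_eq_zero.1 h with h | h
  · have := (strictMono_signedPow hp).injective (sub_eq_zero.1 h)
    rw [show a - a' = b - b' by linarith]
  · linarith

lemma signedPow_sub_mul_sub_nonneg {p : ℝ} (hp : 1 < p) (s t : ℝ) :
    0 ≤ (signedPow p s - signedPow p t) * (s - t) := by
  have hm := (strictMono_signedPow hp).monotone
  rcases le_total s t with h | h
  · exact mul_nonneg_of_nonpos_of_nonpos (sub_nonpos.2 (hm h)) (sub_nonpos.2 h)
  · exact mul_nonneg (sub_nonneg.2 (hm h)) (sub_nonneg.2 h)

lemma eq_of_signedPow_sub_mul_sub_eq_zero {p : ℝ} (hp : 1 < p) {s t : ℝ}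
    (h : (signedPow p s - signedPow p t) * (s - t) = 0) : s = t := by
  rcases mul_eq_zero.1 h with h | h
  · exact (strictMono_signedPow hp).injective (sub_eq_zero.1 h)
  · linarith

/-- Fast geometric convergence. -/
lemma exists_tendsto_zero_of_superlinear {C b α : ℝ} (hC : 0 < C) (hb : 1 < b) (hα : 0 < α) :
    ∃ η : ℝ, 0 < η ∧ ∀ y : ℕ → ℝ, (∀ k, 0 ≤ y k) → y 0 ≤ η →
      (∀ k, y (k + 1) ≤ C * b ^ k * y k ^ (1 + α)) → Tendsto y atTop (𝓝 0) := by
  -- With b q^α = 1 and C η^α = q, the bound y_k ≤ q^k η reproduces itself: C b^k (q^k η)^{1+α} =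
  -- q^{k+1} η.
  set q : ℝ := b ^ (-1 / α) with hq
  have hq0 : 0 < q := Real.rpow_pos_of_pos (by linarith) _
  have hq1 : q < 1 := Real.rpow_lt_one_of_one_lt_of_neg hb (by
    rw [neg_div]; exact neg_neg_of_pos (by positivity))
  have hqα : q ^ α = b⁻¹ := by
    rw [hq, ← Real.rpow_mul (by linarith), div_mul_cancel₀ _ hα.ne', Real.rpow_neg_one]
  refine ⟨(q / C) ^ (1 / α), by positivity, fun y hy0 h0 hstep => ?_⟩
  set η := (q / C) ^ (1 / α) with hη
  have hη0 : 0 < η := by positivity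
  have hηα : C * η ^ α = q := by
    rw [hη, ← Real.rpow_mul (by positivity), one_div_mul_cancel hα.ne', Real.rpow_one]
    field_simp
  have hbound : ∀ k, y k ≤ q ^ k * η := by
    intro k
    induction k with
    | zero => simpa using h0
    | succ k ih =>
      calc y (k + 1) ≤ C * b ^ k * y k ^ (1 + α) := hstep k
        _ ≤ C * b ^ k * (q ^ k * η) ^ (1 + α) := by
          gcongr
          exact hy0 k
        _ = C * b ^ k * ((q ^ k * η) * ((q ^ α) ^ k * η ^ α)) := by
          rw [Real.rpow_add (by positivity), Real.rpow_one,
            Real.mul_rpow (by positivity) hη0.le, ← Real.rpow_natCast q k, ← Real.rpow_mul hq0.le,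
            mul_comm (k : ℝ) α, Real.rpow_mul hq0.le, Real.rpow_natCast, Real.rpow_natCast]
        _ = (b * b⁻¹) ^ k * (q ^ k * η) * (C * η ^ α) := by
          rw [hqα, mul_pow]; ring
        _ = q ^ (k + 1) * η := by
          rw [hηα, mul_inv_cancel₀ (by linarith)]; ring
  refine squeeze_zero hy0 hbound ?_
  simpa using (tendsto_pow_atTop_nhds_zero_of_lt_one hq0.le hq1).mul_const η

lemma exists_rpow_le_const_add {q p ε : ℝ} (hq : 0 < q) (hqp : q < p) (hε : 0 < ε) :
    ∃ C : ℝ, 0 ≤ C ∧ ∀ t : ℝ, 0 ≤ t → t ^ q ≤ ε + C * t ^ p := by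
  set τ : ℝ := ε ^ (1 / q) with hτ
  have hτ0 : 0 < τ := Real.rpow_pos_of_pos hε _
  refine ⟨τ ^ (q - p), by positivity, fun t ht => ?_⟩
  rcases le_total t τ with h | h
  · have : t ^ q ≤ ε := by
      calc t ^ q ≤ τ ^ q := by gcongr
        _ = ε := by rw [hτ, ← Real.rpow_mul hε.le, one_div_mul_cancel hq.ne', Real.rpow_one]
    have h2 : 0 ≤ τ ^ (q - p) * t ^ p := by positivity
    linarith
  · have h1 : t ^ q = t ^ (q - p) * t ^ p := by
      rw [← Real.rpow_add (by linarith)]; ring_nf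
    have h2 : t ^ (q - p) ≤ τ ^ (q - p) :=
      Real.rpow_le_rpow_of_nonpos hτ0 h (by linarith)
    have h3 : t ^ (q - p) * t ^ p ≤ τ ^ (q - p) * t ^ p := by gcongr
    linarith

lemma exists_rpow_le_mul_add_const {q p ε : ℝ} (hq : 0 < q) (hqp : q < p) (hε : 0 < ε) :
    ∃ C : ℝ, 0 ≤ C ∧ ∀ t : ℝ, 0 ≤ t → t ^ q ≤ ε * t ^ p + C := by
  set τ : ℝ := ε ^ (1 / (q - p)) with hτ
  have hτ0 : 0 < τ := Real.rpow_pos_of_pos hε _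
  refine ⟨τ ^ q, by positivity, fun t ht => ?_⟩
  rcases le_total t τ with h | h
  · have h1 : t ^ q ≤ τ ^ q := by gcongr
    have h2 : 0 ≤ ε * t ^ p := by positivity
    linarith
  · have h1 : t ^ q = t ^ (q - p) * t ^ p := by
      rw [← Real.rpow_add (by linarith)]; ring_nf
    have h2 : t ^ (q - p) ≤ τ ^ (q - p) :=
      Real.rpow_le_rpow_of_nonpos hτ0 h (by linarith)
    have h4 : τ ^ (q - p) = ε := by
      rw [hτ, ← Real.rpow_mul hε.le, one_div_mul_cancel (by linarith), Real.rpow_one]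
    have h3 : t ^ (q - p) * t ^ p ≤ τ ^ (q - p) * t ^ p := by gcongr
    rw [h4] at h3
    have : 0 ≤ τ ^ q := by positivity
    linarith

/-! ### The space X₀ as a space of functions with p-integrable differences. -/

/-- The assumptions on the exponents, the domain and the kernel that are used below. -/
structure Admissible (N : ℕ) (p s : ℝ) (K : EuclideanSpace ℝ (Fin N) → ℝ)
    (Ω : Set (EuclideanSpace ℝ (Fin N))) : Prop where
  dim_pos : 0 < N
  one_lt : 1 < p
  s_pos : 0 < s
  isOpen : IsOpen Ω
  nonempty : Ω.Nonempty
  isBounded : Bornology.IsBounded Ω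
  kernel : IsAdmissibleKernel p s K

/-- The measure `K(x - y) dx dy` on `Q`. -/
noncomputable def jumpMeasure {N : ℕ} (K : EuclideanSpace ℝ (Fin N) → ℝ)
    (Ω : Set (EuclideanSpace ℝ (Fin N))) :
    Measure (EuclideanSpace ℝ (Fin N) × EuclideanSpace ℝ (Fin N)) :=
  ((volume.prod volume).restrict (regionQ Ω)).withDensity
    (fun z => ENNReal.ofReal (K (z.1 - z.2)))

/-- The difference `(x, y) ↦ u(x) - u(y)`. -/
def diff {N : ℕ} (u : EuclideanSpace ℝ (Fin N) → ℝ)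
    (z : EuclideanSpace ℝ (Fin N) × EuclideanSpace ℝ (Fin N)) : ℝ := u z.1 - u z.2

section Jump

variable {N : ℕ} {p s : ℝ} {K : EuclideanSpace ℝ (Fin N) → ℝ}
  {Ω : Set (EuclideanSpace ℝ (Fin N))} {u v φ : EuclideanSpace ℝ (Fin N) → ℝ}

lemma jumpMeasure_absolutelyContinuous :
    jumpMeasure K Ω ≪ (volume : Measure (EuclideanSpace ℝ (Fin N))).prod volume :=
  (withDensity_absolutelyContinuous _ _).trans Measure.restrict_le_self.absolutelyContinuous

lemma ae_jumpMeasure {P : EuclideanSpace ℝ (Fin N) → Prop} (h : ∀ᵐ x, P x) :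
    ∀ᵐ z ∂(jumpMeasure K Ω), P z.1 ∧ P z.2 :=
  jumpMeasure_absolutelyContinuous.ae_le
    ((Measure.quasiMeasurePreserving_fst.ae h).and (Measure.quasiMeasurePreserving_snd.ae h))

lemma aestronglyMeasurable_diff (hu : AEStronglyMeasurable u volume) :
    AEStronglyMeasurable (diff u) ((volume : Measure (EuclideanSpace ℝ (Fin N))).prod volume) :=
  hu.comp_fst.sub hu.comp_snd

lemma aestronglyMeasurable_diff_jump (hu : AEStronglyMeasurable u volume) :
    AEStronglyMeasurable (diff u) (jumpMeasure K Ω) :=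
  (aestronglyMeasurable_diff hu).mono_ac jumpMeasure_absolutelyContinuous

namespace Admissible

variable (S : Admissible N p s K Ω)
include S

lemma pos : 0 < p := lt_trans one_pos S.one_lt

lemma nontrivial : Nontrivial (EuclideanSpace ℝ (Fin N)) := by
  have : Nonempty (Fin N) := ⟨⟨0, S.dim_pos⟩⟩
  infer_instance

lemma measurableSet : MeasurableSet Ω := S.isOpen.measurableSet

lemma measure_lt_top : volume Ω < ⊤ := S.isBounded.measure_lt_top

lemma isFiniteMeasure_restrict : IsFiniteMeasure (volume.restrict Ω) :=
  ⟨by simpa using S.measure_lt_top⟩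

lemma measure_pos : 0 < volume Ω := S.isOpen.measure_pos _ S.nonempty

lemma measurableSet_regionQ : MeasurableSet (regionQ Ω) :=
  (S.measurableSet.compl.prod S.measurableSet.compl).compl

lemma measurable_kernel_sub :
    Measurable (fun z : EuclideanSpace ℝ (Fin N) × EuclideanSpace ℝ (Fin N) => K (z.1 - z.2)) :=
  S.kernel.measurable.comp (measurable_fst.sub measurable_snd)

/-- The diagonal is null because points are null in positive dimension. This is what makes the value
`K 0` irrelevant. -/
lemma ae_ne : ∀ᵐ z ∂((volume : Measure (EuclideanSpace ℝ (Fin N))).prod volume), z.1 ≠ z.2 := by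
  have := S.nontrivial
  rw [Measure.ae_prod_iff_ae_ae]
  · refine Eventually.of_forall fun x => ?_
    have : ∀ᵐ y ∂(volume : Measure (EuclideanSpace ℝ (Fin N))), y ≠ x := by
      rw [ae_iff]; simp
    filter_upwards [this] with y hy using hy.symm
  · exact (measurableSet_eq_fun measurable_fst measurable_snd).compl

lemma ae_kernel_pos :
    ∀ᵐ z ∂((volume : Measure (EuclideanSpace ℝ (Fin N))).prod volume), 0 < K (z.1 - z.2) := by
  filter_upwards [S.ae_ne] with z hz using S.kernel.pos _ (sub_ne_zero.2 hz)

lemma integrable_jump_iff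
    {f : EuclideanSpace ℝ (Fin N) × EuclideanSpace ℝ (Fin N) → ℝ} :
    Integrable f (jumpMeasure K Ω) ↔
      IntegrableOn (fun z => f z * K (z.1 - z.2)) (regionQ Ω) (volume.prod volume) := by
  rw [jumpMeasure, integrable_withDensity_iff S.measurable_kernel_sub.ennreal_ofReal (by simp),
    IntegrableOn]
  refine integrable_congr ?_
  filter_upwards [ae_restrict_of_ae S.ae_kernel_pos] with z hz
  rw [ENNReal.toReal_ofReal hz.le]

lemma integral_jump (f : EuclideanSpace ℝ (Fin N) × EuclideanSpace ℝ (Fin N) → ℝ) :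
    ∫ z, f z ∂(jumpMeasure K Ω) =
      ∫ z in regionQ Ω, f z * K (z.1 - z.2) ∂(volume.prod volume) := by
  rw [jumpMeasure,
    integral_withDensity_eq_integral_toReal_smul S.measurable_kernel_sub.ennreal_ofReal (by simp)]
  refine integral_congr_ae ?_
  filter_upwards [ae_restrict_of_ae S.ae_kernel_pos] with z hz
  rw [ENNReal.toReal_ofReal hz.le, smul_eq_mul, mul_comm]

/-- With the kernel absorbed into the measure, the X₀ norm is the L^p norm of `diff u`, and the
general theory of L^p applies. No integrability is needed, as both sides take the default value 0
together. -/
lemma normPow_eq : normPow p K Ω u = ∫ z, |diff u z| ^ p ∂(jumpMeasure K Ω) :=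
  (S.integral_jump fun z => |diff u z| ^ p).symm

lemma pairing_eq : pairing p K Ω u φ =
    ∫ z, signedPow p (diff u z) * diff φ z ∂(jumpMeasure K Ω) :=
  (S.integral_jump fun z => signedPow p (diff u z) * diff φ z).symm

lemma integrable_rpow_iff {α : Type*} [MeasurableSpace α] {ν : Measure α} {f : α → ℝ}
    (hf : AEStronglyMeasurable f ν) :
    Integrable (fun x => |f x| ^ p) ν ↔ MemLp f (ENNReal.ofReal p) ν := by
  have := integrable_norm_rpow_iff hf (p := ENNReal.ofReal p) (by simp [S.pos]) (by simp)
  rw [← this, ENNReal.toReal_ofReal S.pos.le]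
  rfl

lemma ae_eq_zero (hu : MemX0 p K Ω u) : ∀ᵐ x, x ∉ Ω → u x = 0 :=
  (ae_restrict_iff' S.measurableSet.compl).1 hu.eq_zero

lemma memLp (hu : MemX0 p K Ω u) : MemLp u (ENNReal.ofReal p) volume := by
  have h := (memLp_indicator_iff_restrict S.measurableSet).2 hu.memLp
  refine (memLp_congr_ae ?_).1 h
  filter_upwards [S.ae_eq_zero hu] with x hx
  by_cases hxΩ : x ∈ Ω
  · simp [hxΩ]
  · simp [hxΩ, hx hxΩ]

lemma memLp_diff (hu : MemX0 p K Ω u) : MemLp (diff u) (ENNReal.ofReal p) (jumpMeasure K Ω) :=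
  (S.integrable_rpow_iff (aestronglyMeasurable_diff_jump hu.aestronglyMeasurable)).1
    (S.integrable_jump_iff.2 hu.integrableOn)

lemma memX0_of_memLp (h1 : MemLp u (ENNReal.ofReal p) volume)
    (h2 : MemLp (diff u) (ENNReal.ofReal p) (jumpMeasure K Ω))
    (h3 : ∀ᵐ x, x ∉ Ω → u x = 0) : MemX0 p K Ω u where
  aestronglyMeasurable := h1.1
  memLp := h1.restrict _
  integrableOn := S.integrable_jump_iff.1 ((S.integrable_rpow_iff h2.1).2 h2)
  eq_zero := (ae_restrict_iff' S.measurableSet.compl).2 h3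

lemma integrable_rpow (hu : MemX0 p K Ω u) : Integrable (fun x => |u x| ^ p) volume :=
  (S.integrable_rpow_iff hu.aestronglyMeasurable).2 (S.memLp hu)

lemma integrable_rpow_diff (hu : MemX0 p K Ω u) :
    Integrable (fun z => |diff u z| ^ p) (jumpMeasure K Ω) :=
  (S.integrable_rpow_iff (S.memLp_diff hu).1).2 (S.memLp_diff hu)

lemma memX0_add (hu : MemX0 p K Ω u) (hv : MemX0 p K Ω v) : MemX0 p K Ω (fun x => u x + v x) := by
  refine S.memX0_of_memLp ((S.memLp hu).add (S.memLp hv)) ?_ ?_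
  · refine (memLp_congr_ae (ae_of_all _ fun z => ?_)).1 ((S.memLp_diff hu).add (S.memLp_diff hv))
    simp only [Pi.add_apply, diff]; ring
  · filter_upwards [S.ae_eq_zero hu, S.ae_eq_zero hv] with x h1 h2 hx
    rw [h1 hx, h2 hx, add_zero]

lemma memX0_const_mul (c : ℝ) (hu : MemX0 p K Ω u) : MemX0 p K Ω (fun x => c * u x) := by
  refine S.memX0_of_memLp ((S.memLp hu).const_mul c) ?_ ?_
  · refine (memLp_congr_ae (ae_of_all _ fun z => ?_)).1 ((S.memLp_diff hu).const_mul c)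
    simp only [diff]; ring
  · filter_upwards [S.ae_eq_zero hu] with x h1 hx
    rw [h1 hx, mul_zero]

lemma memX0_neg (hu : MemX0 p K Ω u) : MemX0 p K Ω (fun x => -u x) := by
  simpa using S.memX0_const_mul (-1) hu

lemma memX0_sub (hu : MemX0 p K Ω u) (hv : MemX0 p K Ω v) : MemX0 p K Ω (fun x => u x - v x) := by
  simpa [sub_eq_add_neg] using S.memX0_add hu (S.memX0_neg hv)

/-- `X₀` is stable under normal contractions. -/
lemma memX0_of_abs_sub_le (hu : MemX0 p K Ω u) (hv : AEStronglyMeasurable v volume)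
    (h0 : ∀ x, |v x| ≤ |u x|) (h : ∀ x y, |v x - v y| ≤ |u x - u y|) : MemX0 p K Ω v := by
  refine S.memX0_of_memLp ((S.memLp hu).of_le hv (ae_of_all _ h0))
    ((S.memLp_diff hu).of_le (aestronglyMeasurable_diff_jump hv) (ae_of_all _ fun z => h _ _)) ?_
  filter_upwards [S.ae_eq_zero hu] with x h1 hx
  have := h0 x
  rw [h1 hx, abs_zero] at this
  exact abs_nonpos_iff.1 this

lemma memX0_abs (hu : MemX0 p K Ω u) : MemX0 p K Ω (fun x => |u x|) :=
  S.memX0_of_abs_sub_le hu hu.aestronglyMeasurable.norm (fun x => by simp)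
    (fun x y => abs_abs_sub_abs_le _ _)

lemma memX0_posPart_sub (hu : MemX0 p K Ω u) {l : ℝ} (hl : 0 ≤ l) :
    MemX0 p K Ω (fun x => max (u x - l) 0) := by
  refine S.memX0_of_abs_sub_le hu
    ((hu.aestronglyMeasurable.sub aestronglyMeasurable_const).sup aestronglyMeasurable_const)
    (fun x => ?_) (fun x y => ?_)
  · rw [abs_of_nonneg (le_max_right _ _)]
    exact max_le (by linarith [le_abs_self (u x)]) (abs_nonneg _)
  · refine (abs_max_sub_max_le_abs _ _ _).trans (le_of_eq ?_)
    congr 1; ring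

lemma memX0_posPart (hu : MemX0 p K Ω u) : MemX0 p K Ω (fun x => max (u x) 0) := by
  simpa using S.memX0_posPart_sub hu le_rfl

lemma normPow_nonneg : 0 ≤ normPow p K Ω u := by
  rw [S.normPow_eq]; exact integral_nonneg fun z => Real.rpow_nonneg (abs_nonneg _) _

lemma normPow_mono (hv : MemX0 p K Ω v) (h : ∀ x y, |u x - u y| ≤ |v x - v y|) :
    normPow p K Ω u ≤ normPow p K Ω v := by
  rw [S.normPow_eq, S.normPow_eq]
  refine integral_mono_of_nonneg (ae_of_all _ fun z => Real.rpow_nonneg (abs_nonneg _) _)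
    (S.integrable_rpow_diff hv) (ae_of_all _ fun z => ?_)
  exact Real.rpow_le_rpow (abs_nonneg _) (h _ _) S.pos.le

lemma normPow_const_mul (c : ℝ) : normPow p K Ω (fun x => c * u x) = |c| ^ p * normPow p K Ω u := by
  rw [S.normPow_eq, S.normPow_eq, ← integral_const_mul]
  congr 1; ext z
  rw [← Real.mul_rpow (abs_nonneg _) (abs_nonneg _), ← abs_mul, diff, diff, mul_sub]

lemma normPow_add_le (hu : MemX0 p K Ω u) (hv : MemX0 p K Ω v) :
    normPow p K Ω (fun x => u x + v x) ≤ 2 ^ p * (normPow p K Ω u + normPow p K Ω v) := by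
  rw [S.normPow_eq, S.normPow_eq, S.normPow_eq,
    ← integral_add (S.integrable_rpow_diff hu) (S.integrable_rpow_diff hv), ← integral_const_mul]
  refine integral_mono (S.integrable_rpow_diff (S.memX0_add hu hv))
    (((S.integrable_rpow_diff hu).add (S.integrable_rpow_diff hv)).const_mul _) fun z => ?_
  have := abs_add_rpow_le S.pos.le (diff u z) (diff v z)
  simpa [diff, add_sub_add_comm] using this

lemma normPow_congr (h : u =ᵐ[volume] v) : normPow p K Ω u = normPow p K Ω v := by
  rw [S.normPow_eq, S.normPow_eq]
  refine integral_congr_ae ?_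
  filter_upwards [ae_jumpMeasure h] with z hz
  rw [diff, diff, hz.1, hz.2]

lemma pairing_congr_right (h : u =ᵐ[volume] v) : pairing p K Ω φ u = pairing p K Ω φ v := by
  rw [S.pairing_eq, S.pairing_eq]
  refine integral_congr_ae ?_
  filter_upwards [ae_jumpMeasure h] with z hz
  simp only [diff, hz.1, hz.2]

lemma integrable_signedPow_mul {α : Type*} [MeasurableSpace α] {ν : Measure α} {f g : α → ℝ}
    (hf : MemLp f (ENNReal.ofReal p) ν) (hg : MemLp g (ENNReal.ofReal p) ν) :
    Integrable (fun x => signedPow p (f x) * g x) ν := by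
  refine Integrable.mono' ((((S.integrable_rpow_iff hf.1).2 hf).const_mul (1 - 1 / p)).add
    (((S.integrable_rpow_iff hg.1).2 hg).const_mul (1 / p)))
    (((measurable_signedPow p).comp_aemeasurable hf.1.aemeasurable).aestronglyMeasurable.mul hg.1)
    (ae_of_all _ fun x => ?_)
  exact abs_signedPow_mul_le S.one_lt _ _

lemma integrable_pairing (hu : MemX0 p K Ω u) (hv : MemX0 p K Ω v) :
    Integrable (fun z => signedPow p (diff u z) * diff v z) (jumpMeasure K Ω) :=
  S.integrable_signedPow_mul (S.memLp_diff hu) (S.memLp_diff hv)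

lemma pairing_add (hu : MemX0 p K Ω u) (hv : MemX0 p K Ω v) (hφ : MemX0 p K Ω φ) :
    pairing p K Ω u (fun x => v x + φ x) = pairing p K Ω u v + pairing p K Ω u φ := by
  rw [S.pairing_eq, S.pairing_eq, S.pairing_eq,
    ← integral_add (S.integrable_pairing hu hv) (S.integrable_pairing hu hφ)]
  congr 1; ext z; simp only [diff]; ring

lemma pairing_const_mul (c : ℝ) :
    pairing p K Ω u (fun x => c * v x) = c * pairing p K Ω u v := by
  rw [S.pairing_eq, S.pairing_eq, ← integral_const_mul]
  congr 1; ext z; simp only [diff]; ring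

lemma pairing_neg : pairing p K Ω u (fun x => -v x) = -pairing p K Ω u v := by
  simpa using S.pairing_const_mul (u := u) (v := v) (-1)

lemma pairing_sub (hu : MemX0 p K Ω u) (hv : MemX0 p K Ω v) (hφ : MemX0 p K Ω φ) :
    pairing p K Ω u (fun x => v x - φ x) = pairing p K Ω u v - pairing p K Ω u φ := by
  simpa [sub_eq_add_neg, S.pairing_neg] using S.pairing_add hu hv (S.memX0_neg hφ)

lemma pairing_self : pairing p K Ω u u = normPow p K Ω u := by
  rw [S.pairing_eq, S.normPow_eq]
  congr 1; ext z; exact signedPow_mul_self S.one_lt _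

lemma pairing_smul_left {c : ℝ} (hc : 0 ≤ c) :
    pairing p K Ω (fun x => c * u x) φ = c ^ (p - 1) * pairing p K Ω u φ := by
  rw [S.pairing_eq, S.pairing_eq, ← integral_const_mul]
  congr 1; ext z
  rw [show diff (fun x => c * u x) z = c * diff u z by simp [diff, mul_sub],
    signedPow_smul S.one_lt hc, mul_assoc]

/-- Young's inequality replaces Hölder's here: a bound linear in the two energies is the form in
which uniqueness uses it. -/
lemma pairing_le_young (hu : MemX0 p K Ω u) (hv : MemX0 p K Ω v) :
    pairing p K Ω u v ≤ (1 - 1 / p) * normPow p K Ω u + 1 / p * normPow p K Ω v := by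
  rw [S.pairing_eq, S.normPow_eq, S.normPow_eq, ← integral_const_mul, ← integral_const_mul,
    ← integral_add ((S.integrable_rpow_diff hu).const_mul _)
      ((S.integrable_rpow_diff hv).const_mul _)]
  exact integral_mono (S.integrable_pairing hu hv) (((S.integrable_rpow_diff hu).const_mul _).add
      ((S.integrable_rpow_diff hv).const_mul _))
      fun z => (le_abs_self _).trans (abs_signedPow_mul_le S.one_lt _ _)

lemma integrable (hu : MemX0 p K Ω u) : Integrable u volume := by
  have := S.isFiniteMeasure_restrict
  have h1 : IntegrableOn u Ω volume := hu.memLp.integrable (by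
    rw [← ENNReal.ofReal_one]; exact ENNReal.ofReal_le_ofReal S.one_lt.le)
  refine ((integrable_indicator_iff S.measurableSet).2 h1).congr ?_
  filter_upwards [S.ae_eq_zero hu] with x hx
  by_cases hxΩ : x ∈ Ω
  · simp [hxΩ]
  · simp [hxΩ, hx hxΩ]

end Admissible

end Jump

/-! ### Kernel estimates: Faber–Krahn, Poincaré, long-range interaction, Lipschitz energy. -/

namespace Admissible

variable {N : ℕ} {p s : ℝ} {K : EuclideanSpace ℝ (Fin N) → ℝ}
  {Ω : Set (EuclideanSpace ℝ (Fin N))} {u v φ : EuclideanSpace ℝ (Fin N) → ℝ}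
  (S : Admissible N p s K Ω)
include S

lemma exists_norm_sub_lt : ∃ R : ℝ, 0 < R ∧ ∀ x ∈ Ω, ∀ y ∈ Ω, ‖x - y‖ < R := by
  obtain ⟨C, hC⟩ := Metric.isBounded_iff.1 S.isBounded
  refine ⟨max C 0 + 1, by positivity, fun x hx y hy => ?_⟩
  rw [← dist_eq_norm]
  linarith [hC hx hy, le_max_left C 0]

lemma exponent_neg : -(N : ℝ) - p * s < 0 := by
  have h1 := S.dim_pos
  have h2 := mul_pos S.pos S.s_pos
  have : (0 : ℝ) < N := by exact_mod_cast h1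
  linarith

lemma exists_kernel_ge : ∃ κ : ℝ, 0 < κ ∧ ∀ x ∈ Ω, ∀ y ∈ Ω, x ≠ y → κ ≤ K (x - y) := by
  obtain ⟨R, hR, hR'⟩ := S.exists_norm_sub_lt
  obtain ⟨δ, hδ, hδ'⟩ := S.kernel.lower_bound
  refine ⟨δ * R ^ (-(N : ℝ) - p * s), by positivity, fun x hx y hy hxy => ?_⟩
  refine le_trans ?_ (hδ' _ (sub_ne_zero.2 hxy))
  gcongr δ * ?_
  exact Real.rpow_le_rpow_of_nonpos (norm_pos_iff.2 (sub_ne_zero.2 hxy)) (hR' x hx y hy).le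
    S.exponent_neg.le

/-- Since A ⊆ Ω, the strip A × ℝ^N lies inside Q, and Tonelli's theorem applies without any cut-off
in y. -/
lemma setLIntegral_jump {A : Set (EuclideanSpace ℝ (Fin N))} (hA : MeasurableSet A) (hAΩ : A ⊆ Ω)
    {f : EuclideanSpace ℝ (Fin N) × EuclideanSpace ℝ (Fin N) → ENNReal}
    (hf : AEMeasurable f (volume.prod volume)) :
    ∫⁻ z in A ×ˢ Set.univ, f z ∂(jumpMeasure K Ω) =
      ∫⁻ x in A, ∫⁻ y, f (x, y) * ENNReal.ofReal (K (x - y)) := by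
  have hsub : A ×ˢ Set.univ ⊆ regionQ Ω := fun z hz hz' => hz'.1 (hAΩ hz.1)
  have hm : MeasurableSet (A ×ˢ (Set.univ : Set (EuclideanSpace ℝ (Fin N)))) :=
    hA.prod MeasurableSet.univ
  rw [jumpMeasure, restrict_withDensity hm, Measure.restrict_restrict hm,
    Set.inter_eq_left.2 hsub, ← Measure.prod_restrict, Measure.restrict_univ]
  have hle : (volume.restrict A).prod (volume : Measure (EuclideanSpace ℝ (Fin N))) ≪
      volume.prod volume := Measure.restrict_le_self.absolutelyContinuous.prod
        Measure.AbsolutelyContinuous.rfl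
  have hk : AEMeasurable (fun z : EuclideanSpace ℝ (Fin N) × EuclideanSpace ℝ (Fin N) =>
      ENNReal.ofReal (K (z.1 - z.2)))
      ((volume.restrict A).prod (volume : Measure (EuclideanSpace ℝ (Fin N)))) :=
    S.measurable_kernel_sub.ennreal_ofReal.aemeasurable
  rw [lintegral_withDensity_eq_lintegral_mul₀ hk (hf.mono_ac hle),
    lintegral_prod _ (hk.mul (hf.mono_ac hle))]
  simp [mul_comm]

/-- Q is symmetric and K is even off the diagonal. -/
lemma measurePreserving_swap :
    MeasurePreserving Prod.swap (jumpMeasure K Ω) (jumpMeasure K Ω) := by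
  have hM : jumpMeasure K Ω = (volume.prod volume).withDensity
      ((regionQ Ω).indicator fun z => ENNReal.ofReal (K (z.1 - z.2))) := by
    rw [jumpMeasure, withDensity_indicator S.measurableSet_regionQ]
  refine ⟨measurable_swap, ?_⟩
  ext A hA
  have hk : Measurable ((regionQ Ω).indicator fun z => ENNReal.ofReal (K (z.1 - z.2))) :=
    S.measurable_kernel_sub.ennreal_ofReal.indicator S.measurableSet_regionQ
  rw [Measure.map_apply measurable_swap hA, hM, withDensity_apply _ (measurable_swap hA),
    withDensity_apply _ hA, ← lintegral_indicator (measurable_swap hA), ← lintegral_indicator hA,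
    ← (Measure.measurePreserving_swap (μ := (volume : Measure (EuclideanSpace ℝ (Fin N))))
      (ν := (volume : Measure (EuclideanSpace ℝ (Fin N))))).lintegral_comp (hk.indicator hA)]
  refine lintegral_congr_ae ?_
  filter_upwards [S.ae_ne] with z hz
  have hQ : z.swap ∈ regionQ Ω ↔ z ∈ regionQ Ω := by
    simp [regionQ, or_comm, imp_iff_not_or]
  have hK : K (z.2 - z.1) = K (z.1 - z.2) := by
    rw [← S.kernel.even _ (sub_ne_zero.2 hz), neg_sub]
  by_cases h1 : z.swap ∈ A <;> by_cases h2 : z ∈ regionQ Ω <;>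
    simp [Set.indicator, h1, h2, hQ, hK]

/-- A fractional Faber–Krahn inequality. -/
lemma exists_faber_krahn : ∃ C : ℝ, 0 < C ∧ ∀ w, MemX0 p K Ω w →
    ∀ A : Set (EuclideanSpace ℝ (Fin N)), volume A ≠ ⊤ → (∀ᵐ x, x ∉ A → w x = 0) →
      ∫ x, |w x| ^ p ≤ C * volume.real A ^ (p * s / N) * normPow p K Ω w := by
  obtain ⟨δ, hδ, hδ'⟩ := S.kernel.lower_bound
  have := S.nontrivial
  have hN : (0 : ℝ) < N := by exact_mod_cast S.dim_pos
  set ω : ℝ := volume.real (Metric.ball (0 : EuclideanSpace ℝ (Fin N)) 1) with hω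
  have hω0 : 0 < ω := ENNReal.toReal_pos (Metric.measure_ball_pos _ _ one_pos).ne'
    measure_ball_lt_top.ne
  set α : ℝ := p * s / N with hα
  have hα0 : 0 < α := div_pos (mul_pos S.pos S.s_pos) hN
  refine ⟨(2 / ω) ^ (1 + α) / δ, by positivity, ?_⟩
  have key : ∀ w, MemX0 p K Ω w → ∀ A : Set (EuclideanSpace ℝ (Fin N)), MeasurableSet A →
      volume A ≠ ⊤ → (∀ᵐ x, x ∉ A → w x = 0) →
      ∫ x, |w x| ^ p ≤ (2 / ω) ^ (1 + α) / δ * volume.real A ^ α * normPow p K Ω w := by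
    intro w hw A hA hAf hwA
    rcases eq_or_ne (volume A) 0 with h0 | h0
    · have : ∫ x, |w x| ^ p = 0 := by
        rw [← integral_zero (EuclideanSpace ℝ (Fin N)) ℝ (μ := volume)]
        refine integral_congr_ae ?_
        filter_upwards [hwA, measure_eq_zero_iff_ae_notMem.1 h0] with x h1 h2
        rw [h1 h2, abs_zero, Real.zero_rpow S.pos.ne']
      rw [this]
      have := S.normPow_nonneg (u := w)
      positivity
    set a := volume.real A with ha
    have ha0 : 0 < a := ENNReal.toReal_pos h0 hAf
    -- A ball of radius R has volume 2|A|, so around any x it contains a part of Aᶜ of measure at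
    -- least |A|. There w(y) = 0 and K(x - y) ≥ δ R^{-N-ps}, so integrating |w(x) - w(y)|^p K(x - y)
    -- in y gives at least c |w(x)|^p. The inverse of c is of order |A|^{ps/N}.
    set R : ℝ := (2 * a / ω) ^ (1 / (N : ℝ)) with hR
    have hR0 : 0 < R := by positivity
    have hball : ∀ x : EuclideanSpace ℝ (Fin N), volume.real (Metric.ball x R) = 2 * a := by
      intro x
      rw [measureReal_def, Measure.addHaar_ball_of_pos _ _ hR0, ENNReal.toReal_mul,
        ← measureReal_def, ← hω, finrank_euclideanSpace_fin,
        ENNReal.toReal_ofReal (by positivity), hR, ← Real.rpow_natCast, ← Real.rpow_mul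
        (by positivity), one_div_mul_cancel hN.ne', Real.rpow_one]
      field_simp
    set c : ℝ := δ * R ^ (-(N : ℝ) - p * s) * a with hc
    have hc0 : 0 < c := by positivity
    have hin : ∀ x, ENNReal.ofReal c ≤ ∫⁻ y in Aᶜ, ENNReal.ofReal (K (x - y)) := by
      intro x
      have hT : MeasurableSet ((Metric.ball x R \ A) \ {x}) :=
        (Metric.isOpen_ball.measurableSet.diff hA).diff (measurableSet_singleton x)
      have hTm : ENNReal.ofReal a ≤ volume ((Metric.ball x R \ A) \ {x}) := by
        rw [measure_sdiff_null (measure_singleton x), ENNReal.ofReal_le_iff_le_toReal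
          (ne_top_of_le_ne_top measure_ball_lt_top.ne (measure_mono Set.sdiff_subset))]
        have := le_measureReal_sdiff (μ := volume) (s₁ := Metric.ball x R) (s₂ := A) hAf
        rw [hball] at this
        rw [← measureReal_def]
        linarith
      calc ENNReal.ofReal c = ENNReal.ofReal (δ * R ^ (-(N : ℝ) - p * s)) * ENNReal.ofReal a := by
            rw [← ENNReal.ofReal_mul (by positivity)]
        _ ≤ ENNReal.ofReal (δ * R ^ (-(N : ℝ) - p * s)) *
              volume ((Metric.ball x R \ A) \ {x}) := by gcongr
        _ ≤ ∫⁻ y in (Metric.ball x R \ A) \ {x}, ENNReal.ofReal (K (x - y)) := by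
            refine setLIntegral_const .. |>.symm.le.trans (setLIntegral_mono' hT fun y hy => ?_)
            refine ENNReal.ofReal_le_ofReal ?_
            have hne : x - y ≠ 0 := sub_ne_zero.2 fun h => hy.2 h.symm
            refine le_trans ?_ (hδ' _ hne)
            gcongr δ * ?_
            refine Real.rpow_le_rpow_of_nonpos (norm_pos_iff.2 hne) ?_ S.exponent_neg.le
            rw [← dist_eq_norm, dist_comm]
            exact (Metric.mem_ball.1 hy.1.1).le
        _ ≤ _ := lintegral_mono_set fun y hy => hy.1.2
    have hmeas : AEMeasurable (fun z => ENNReal.ofReal (|diff w z| ^ p))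
        ((volume : Measure (EuclideanSpace ℝ (Fin N))).prod volume) :=
      ((aestronglyMeasurable_diff hw.aestronglyMeasurable).aemeasurable.norm.pow_const
        p).ennreal_ofReal
    have hE : ENNReal.ofReal c * ∫⁻ x, ENNReal.ofReal (|w x| ^ p) ≤
        ∫⁻ z, ENNReal.ofReal (|diff w z| ^ p) ∂(jumpMeasure K Ω) := by
      calc ENNReal.ofReal c * ∫⁻ x, ENNReal.ofReal (|w x| ^ p)
          = ENNReal.ofReal c * ∫⁻ x in Ω, ENNReal.ofReal (|w x| ^ p) := by
            rw [← lintegral_indicator S.measurableSet]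
            congr 1
            refine lintegral_congr_ae ?_
            filter_upwards [S.ae_eq_zero hw] with x hx
            by_cases h : x ∈ Ω
            · simp [h]
            · simp [h, hx h, Real.zero_rpow S.pos.ne']
        _ = ∫⁻ x in Ω, ENNReal.ofReal c * ENNReal.ofReal (|w x| ^ p) :=
            (lintegral_const_mul' _ _ ENNReal.ofReal_ne_top).symm
        _ ≤ ∫⁻ x in Ω, ∫⁻ y, ENNReal.ofReal (|diff w (x, y)| ^ p) *
              ENNReal.ofReal (K (x - y)) := by
            refine lintegral_mono fun x => ?_
            calc ENNReal.ofReal c * ENNReal.ofReal (|w x| ^ p)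
                ≤ (∫⁻ y in Aᶜ, ENNReal.ofReal (K (x - y))) * ENNReal.ofReal (|w x| ^ p) := by
                  gcongr; exact hin x
              _ = ∫⁻ y in Aᶜ, ENNReal.ofReal (|w x| ^ p) * ENNReal.ofReal (K (x - y)) := by
                  rw [mul_comm, lintegral_const_mul' _ _ ENNReal.ofReal_ne_top]
              _ = ∫⁻ y in Aᶜ, ENNReal.ofReal (|diff w (x, y)| ^ p) *
                    ENNReal.ofReal (K (x - y)) := by
                  refine lintegral_congr_ae ?_
                  filter_upwards [ae_restrict_of_ae hwA, ae_restrict_mem hA.compl] with y h1 h2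
                  simp [diff, h1 h2]
              _ ≤ _ := setLIntegral_le_lintegral _ _
        _ = ∫⁻ z in Ω ×ˢ Set.univ, ENNReal.ofReal (|diff w z| ^ p) ∂(jumpMeasure K Ω) :=
            (S.setLIntegral_jump S.measurableSet le_rfl hmeas).symm
        _ ≤ _ := setLIntegral_le_lintegral _ _
    rw [← ofReal_integral_eq_lintegral_ofReal (S.integrable_rpow hw)
        (ae_of_all _ fun x => Real.rpow_nonneg (abs_nonneg _) _),
      ← ofReal_integral_eq_lintegral_ofReal (S.integrable_rpow_diff hw)
        (ae_of_all _ fun x => Real.rpow_nonneg (abs_nonneg _) _),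
      ← ENNReal.ofReal_mul hc0.le, ← S.normPow_eq,
      ENNReal.ofReal_le_ofReal_iff S.normPow_nonneg] at hE
    have hcC : c * ((2 / ω) ^ (1 + α) / δ * a ^ α) = 1 := by
      have h1 : R ^ (-(N : ℝ) - p * s) = ((2 / ω) ^ (1 + α) * a ^ (1 + α))⁻¹ := by
        rw [hR, ← Real.rpow_mul (by positivity), ← Real.mul_rpow (by positivity) ha0.le,
          ← Real.rpow_neg (by positivity)]
        congr 1
        · ring
        · rw [hα]; field_simp; ring
      rw [hc, h1, Real.rpow_add ha0, Real.rpow_one]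
      field_simp
    calc ∫ x, |w x| ^ p = ((2 / ω) ^ (1 + α) / δ * a ^ α) * (c * ∫ x, |w x| ^ p) := by
          linear_combination (-∫ x, |w x| ^ p) * hcC
      _ ≤ _ := by gcongr
  -- A measurable hull of A has the same measure, so measurability can be dropped.
  intro w hw A hAf hwA
  have h := key w hw (toMeasurable volume A) (measurableSet_toMeasurable _ _)
    (by rwa [measure_toMeasurable]) (hwA.mono fun x hx hxA => hx fun h =>
      hxA (subset_toMeasurable _ _ h))
  rwa [measureReal_def, measure_toMeasurable, ← measureReal_def] at h

/-- The Poincaré inequality in `X₀`. -/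
lemma exists_poincare : ∃ C : ℝ, 0 < C ∧ ∀ w, MemX0 p K Ω w →
    ∫ x, |w x| ^ p ≤ C * normPow p K Ω w := by
  obtain ⟨C, hC, h⟩ := S.exists_faber_krahn
  have hΩ : 0 < volume.real Ω := ENNReal.toReal_pos S.measure_pos.ne' S.measure_lt_top.ne
  exact ⟨C * volume.real Ω ^ (p * s / N), by positivity,
    fun w hw => h w hw Ω S.measure_lt_top.ne (S.ae_eq_zero hw)⟩

/-- Only the pairs in Ω × B are kept, where the kernel is at least κ. This is how a nonlocal
interaction with a fixed set B is turned into a bound on an integral over Ω; the minimum principle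
and the comparison argument both rest on it. -/
lemma mul_integral_le_of_le_on_prod {κ : ℝ} (hκ : 0 ≤ κ)
    (hK : ∀ x ∈ Ω, ∀ y ∈ Ω, x ≠ y → κ ≤ K (x - y))
    {B : Set (EuclideanSpace ℝ (Fin N))} (hB : MeasurableSet B) (hBΩ : B ⊆ Ω)
    {f : EuclideanSpace ℝ (Fin N) → ℝ} (hf : Integrable f volume) (hf0 : ∀ x, 0 ≤ f x)
    {G : EuclideanSpace ℝ (Fin N) × EuclideanSpace ℝ (Fin N) → ℝ}
    (hG : Integrable G (jumpMeasure K Ω)) (hG0 : ∀ᵐ z ∂(jumpMeasure K Ω), 0 ≤ G z)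
    (hfG : ∀ᵐ z ∂(jumpMeasure K Ω), z.1 ∈ Ω → z.2 ∈ B → f z.1 ≤ G z) :
    κ * volume.real B * ∫ x in Ω, f x ≤ ∫ z, G z ∂(jumpMeasure K Ω) := by
  have := S.nontrivial
  have hBf : volume B ≠ ⊤ := ne_top_of_le_ne_top S.measure_lt_top.ne (measure_mono hBΩ)
  have hm : AEMeasurable (fun z : EuclideanSpace ℝ (Fin N) × EuclideanSpace ℝ (Fin N) =>
      ENNReal.ofReal (f z.1) * B.indicator 1 z.2)
      ((volume : Measure (EuclideanSpace ℝ (Fin N))).prod volume) :=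
    hf.1.comp_fst.aemeasurable.ennreal_ofReal.mul
      ((measurable_one.indicator hB).comp measurable_snd).aemeasurable
  have hmΩ : MeasurableSet (Ω ×ˢ (Set.univ : Set (EuclideanSpace ℝ (Fin N)))) :=
    S.measurableSet.prod MeasurableSet.univ
  have hE : ENNReal.ofReal (κ * volume.real B) * ∫⁻ x in Ω, ENNReal.ofReal (f x) ≤
      ∫⁻ z, ENNReal.ofReal (G z) ∂(jumpMeasure K Ω) := by
    calc ENNReal.ofReal (κ * volume.real B) * ∫⁻ x in Ω, ENNReal.ofReal (f x)
        = ∫⁻ x in Ω, ENNReal.ofReal (κ * volume.real B) * ENNReal.ofReal (f x) :=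
          (lintegral_const_mul' _ _ ENNReal.ofReal_ne_top).symm
      _ ≤ ∫⁻ x in Ω, ∫⁻ y, ENNReal.ofReal (f x) * B.indicator 1 y *
            ENNReal.ofReal (K (x - y)) := by
          refine setLIntegral_mono' S.measurableSet fun x hx => ?_
          have h1 : ENNReal.ofReal (κ * volume.real B) ≤
              ∫⁻ y in B, ENNReal.ofReal (K (x - y)) := by
            rw [ENNReal.ofReal_mul hκ, ofReal_measureReal hBf, ← setLIntegral_const]
            refine lintegral_mono_ae ?_
            have hne : ∀ᵐ y ∂(volume : Measure (EuclideanSpace ℝ (Fin N))), y ≠ x := by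
              rw [ae_iff]; simp
            filter_upwards [ae_restrict_of_ae hne, ae_restrict_mem hB] with y hy hyB
            exact ENNReal.ofReal_le_ofReal (hK x hx y (hBΩ hyB) hy.symm)
          calc ENNReal.ofReal (κ * volume.real B) * ENNReal.ofReal (f x)
              ≤ (∫⁻ y in B, ENNReal.ofReal (K (x - y))) * ENNReal.ofReal (f x) := by gcongr
            _ = ∫⁻ y in B, ENNReal.ofReal (f x) * ENNReal.ofReal (K (x - y)) := by
              rw [mul_comm, lintegral_const_mul' _ _ ENNReal.ofReal_ne_top]
            _ = ∫⁻ y, ENNReal.ofReal (f x) * B.indicator 1 y * ENNReal.ofReal (K (x - y)) := by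
              rw [← lintegral_indicator hB]
              congr 1; ext y
              by_cases hy : y ∈ B <;> simp [hy]
            _ ≤ _ := le_rfl
      _ = ∫⁻ z in Ω ×ˢ Set.univ, ENNReal.ofReal (f z.1) * B.indicator 1 z.2
            ∂(jumpMeasure K Ω) := (S.setLIntegral_jump S.measurableSet le_rfl hm).symm
      _ ≤ ∫⁻ z in Ω ×ˢ Set.univ, ENNReal.ofReal (G z) ∂(jumpMeasure K Ω) := by
          refine lintegral_mono_ae ?_
          filter_upwards [ae_restrict_of_ae hfG, ae_restrict_mem hmΩ] with z hz hzΩ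
          by_cases hzB : z.2 ∈ B
          · simpa [hzB] using ENNReal.ofReal_le_ofReal (hz hzΩ.1 hzB)
          · simp [hzB]
      _ ≤ _ := setLIntegral_le_lintegral _ _
  rw [← ofReal_integral_eq_lintegral_ofReal hf.integrableOn (ae_of_all _ hf0),
    ← ofReal_integral_eq_lintegral_ofReal hG hG0, ← ENNReal.ofReal_mul (by positivity),
    ENNReal.ofReal_le_ofReal_iff (integral_nonneg_of_ae hG0)] at hE
  exact hE

/-- Energy of a bounded Lipschitz function on the pairs that meet a set. -/
lemma exists_lipschitz_energy_le {f : EuclideanSpace ℝ (Fin N) → ℝ} {L D : ℝ} (hL : 0 ≤ L)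
    (hfL : ∀ x y, |f x - f y| ≤ L * ‖x - y‖) (hfD : ∀ x y, |f x - f y| ≤ D) :
    ∃ Λ : ℝ, 0 ≤ Λ ∧ ∀ A : Set (EuclideanSpace ℝ (Fin N)), MeasurableSet A → A ⊆ Ω →
      ∫⁻ z in {z | z.1 ∈ A ∨ z.2 ∈ A}, ENNReal.ofReal (|diff f z| ^ p) ∂(jumpMeasure K Ω) ≤
        ENNReal.ofReal (Λ * volume.real A) := by
  have hD : 0 ≤ D := (abs_nonneg _).trans (hfD 0 0)
  set I : ℝ := ∫ x, min (‖x‖ ^ p) 1 * K x with hI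
  set Λ₀ : ℝ := max (L ^ p) (D ^ p) with hΛ₀
  have hΛ₀0 : 0 ≤ Λ₀ := le_max_of_le_left (by positivity)
  have := S.nontrivial
  have hpos : ∀ᵐ x : EuclideanSpace ℝ (Fin N), 0 ≤ min (‖x‖ ^ p) 1 * K x := by
    have hne : ∀ᵐ y ∂(volume : Measure (EuclideanSpace ℝ (Fin N))), y ≠ 0 := by
      rw [ae_iff]; simp
    filter_upwards [hne] with x hx
    have := S.kernel.pos x hx
    positivity
  have hI0 : 0 ≤ I := integral_nonneg_of_ae hpos
  have hfm : Continuous f := by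
    have : LipschitzWith ⟨L, hL⟩ f := LipschitzWith.of_dist_le_mul fun x y => by
      rw [Real.dist_eq, dist_eq_norm]; exact hfL x y
    exact this.continuous
  -- The Lipschitz bound serves near the diagonal and the oscillation bound far from it; the
  -- resulting majorant is exactly what the kernel assumption makes integrable in y.
  have hbound : ∀ x y, |f x - f y| ^ p ≤ Λ₀ * min (‖x - y‖ ^ p) 1 := by
    intro x y
    have h1 : |f x - f y| ^ p ≤ L ^ p * ‖x - y‖ ^ p := by
      rw [← Real.mul_rpow hL (norm_nonneg _)]
      exact Real.rpow_le_rpow (abs_nonneg _) (hfL x y) S.pos.le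
    have h2 : |f x - f y| ^ p ≤ D ^ p := Real.rpow_le_rpow (abs_nonneg _) (hfD x y) S.pos.le
    rcases min_cases (‖x - y‖ ^ p) 1 with ⟨h, _⟩ | ⟨h, _⟩ <;> rw [h]
    · refine h1.trans ?_
      gcongr
      exact le_max_left _ _
    · rw [mul_one]
      exact h2.trans (le_max_right _ _)
  have hmeas : Measurable (fun z => ENNReal.ofReal (|diff f z| ^ p)) := by
    have : Continuous (diff f) := (hfm.comp continuous_fst).sub (hfm.comp continuous_snd)
    exact (this.measurable.norm.pow_const p).ennreal_ofReal
  refine ⟨2 * (Λ₀ * I), by positivity, fun A hA hAΩ => ?_⟩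
  have hAf : volume A ≠ ⊤ := ne_top_of_le_ne_top S.measure_lt_top.ne (measure_mono hAΩ)
  have hmA : MeasurableSet (A ×ˢ (Set.univ : Set (EuclideanSpace ℝ (Fin N)))) :=
    hA.prod MeasurableSet.univ
  have h1 : ∫⁻ z in A ×ˢ Set.univ, ENNReal.ofReal (|diff f z| ^ p) ∂(jumpMeasure K Ω) ≤
      ENNReal.ofReal (Λ₀ * I * volume.real A) := by
    rw [S.setLIntegral_jump hA hAΩ hmeas.aemeasurable]
    calc ∫⁻ x in A, ∫⁻ y, ENNReal.ofReal (|diff f (x, y)| ^ p) * ENNReal.ofReal (K (x - y))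
        ≤ ∫⁻ _ in A, ENNReal.ofReal (Λ₀ * I) := by
          refine lintegral_mono fun x => ?_
          have hsub := lintegral_sub_left_eq_self (μ := volume)
            (fun y => ENNReal.ofReal (Λ₀ * (min (‖y‖ ^ p) 1 * K y))) x
          rw [hI, ← integral_const_mul, ofReal_integral_eq_lintegral_ofReal
            (S.kernel.integrable.const_mul _) (hpos.mono fun y hy => mul_nonneg hΛ₀0 hy), ← hsub]
          refine lintegral_mono fun y => ?_
          rw [← ENNReal.ofReal_mul (by positivity)]
          by_cases hxy : x = y
          · subst hxy
            simp [diff, Real.zero_rpow S.pos.ne']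
          · refine ENNReal.ofReal_le_ofReal ?_
            rw [← mul_assoc]
            exact mul_le_mul_of_nonneg_right (hbound x y)
              (S.kernel.pos _ (sub_ne_zero.2 hxy)).le
      _ = ENNReal.ofReal (Λ₀ * I * volume.real A) := by
          rw [setLIntegral_const, ENNReal.ofReal_mul (mul_nonneg hΛ₀0 hI0), ofReal_measureReal hAf]
  -- Pairs with y ∈ A contribute as much as pairs with x ∈ A, which explains the factor 2 in Λ.
  have h2 : ∫⁻ z in Set.univ ×ˢ A, ENNReal.ofReal (|diff f z| ^ p) ∂(jumpMeasure K Ω) =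
      ∫⁻ z in A ×ˢ Set.univ, ENNReal.ofReal (|diff f z| ^ p) ∂(jumpMeasure K Ω) := by
    rw [← lintegral_indicator hmA, ← lintegral_indicator (MeasurableSet.univ.prod hA),
      ← S.measurePreserving_swap.lintegral_comp (hmeas.indicator hmA)]
    refine lintegral_congr fun z => ?_
    by_cases hz : z ∈ Set.univ ×ˢ A
    · have hz' : z.swap ∈ A ×ˢ Set.univ := by simpa using hz
      rw [Set.indicator_of_mem hz, Set.indicator_of_mem hz', diff, diff, abs_sub_comm]; rfl
    · have hz' : z.swap ∉ A ×ˢ Set.univ := by simpa using hz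
      rw [Set.indicator_of_notMem hz, Set.indicator_of_notMem hz']
  have hset : {z : EuclideanSpace ℝ (Fin N) × EuclideanSpace ℝ (Fin N) | z.1 ∈ A ∨ z.2 ∈ A} =
      A ×ˢ Set.univ ∪ Set.univ ×ˢ A := by
    ext z; simp
  rw [hset]
  refine (lintegral_union_le _ _ _).trans ?_
  rw [h2]
  refine (add_le_add h1 h1).trans (le_of_eq ?_)
  rw [← ENNReal.ofReal_add (by positivity) (by positivity)]
  congr 1; ring

end Admissible

/-! ### Caccioppoli estimate for the barrier and strong minimum principle. -/

/-- The truncation `(ε (dist(x, Ωᶜ) - τ) - u)⁺`. -/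
noncomputable def barrier {N : ℕ} (Ω : Set (EuclideanSpace ℝ (Fin N)))
    (u : EuclideanSpace ℝ (Fin N) → ℝ) (ε τ : ℝ) (x : EuclideanSpace ℝ (Fin N)) : ℝ :=
  max (ε * Metric.infDist x Ωᶜ - u x - ε * τ) 0

namespace Admissible

variable {N : ℕ} {p s : ℝ} {K : EuclideanSpace ℝ (Fin N) → ℝ}
  {Ω : Set (EuclideanSpace ℝ (Fin N))} {u v φ : EuclideanSpace ℝ (Fin N) → ℝ}
  (S : Admissible N p s K Ω)
include S

lemma exists_infDist_le : ∃ D : ℝ, 0 < D ∧ ∀ x, Metric.infDist x Ωᶜ ≤ D := by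
  have := S.nontrivial
  obtain ⟨R, hR, hR'⟩ := S.exists_norm_sub_lt
  obtain ⟨x₀, hx₀⟩ := S.nonempty
  obtain ⟨e, he⟩ := exists_norm_eq (EuclideanSpace ℝ (Fin N)) hR.le
  have hmem : x₀ + e ∈ Ωᶜ := fun h => by
    have := hR' _ h _ hx₀
    rw [add_sub_cancel_left, he] at this
    exact lt_irrefl _ this
  refine ⟨2 * R, by positivity, fun x => ?_⟩
  by_cases hx : x ∈ Ω
  · refine (Metric.infDist_le_dist_of_mem hmem).trans ?_
    rw [dist_eq_norm, show x - (x₀ + e) = (x - x₀) - e by abel]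
    have h1 := norm_sub_le (x - x₀) e
    have h2 := hR' x hx x₀ hx₀
    linarith
  · rw [Metric.infDist_zero_of_mem (show x ∈ Ωᶜ from hx)]; positivity

lemma infDist_pos {x : EuclideanSpace ℝ (Fin N)} (hx : x ∈ Ω) : 0 < Metric.infDist x Ωᶜ := by
  have := S.nontrivial
  have hne : (Ωᶜ).Nonempty := by
    by_contra h
    rw [Set.not_nonempty_iff_eq_empty, Set.compl_empty_iff] at h
    obtain ⟨R, hR, hR'⟩ := S.exists_norm_sub_lt
    obtain ⟨e, he⟩ := exists_norm_eq (EuclideanSpace ℝ (Fin N)) hR.le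
    have := hR' e (h ▸ Set.mem_univ _) 0 (h ▸ Set.mem_univ _)
    rw [sub_zero, he] at this
    exact lt_irrefl _ this
  exact (S.isOpen.isClosed_compl.notMem_iff_infDist_pos hne).1 (fun h => h hx)

lemma memX0_of_lipschitz {f : EuclideanSpace ℝ (Fin N) → ℝ} {L D : ℝ} (hL : 0 ≤ L)
    (hfL : ∀ x y, |f x - f y| ≤ L * ‖x - y‖) (hfD : ∀ x, |f x| ≤ D)
    (hf0 : ∀ x, x ∉ Ω → f x = 0) : MemX0 p K Ω f := by
  have hD2 : ∀ x y, |f x - f y| ≤ 2 * D := fun x y => by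
    have := abs_sub (f x) (f y)
    linarith [hfD x, hfD y]
  obtain ⟨Λ, hΛ, h⟩ := S.exists_lipschitz_energy_le hL hfL hD2
  have hfm : Continuous f := by
    have : LipschitzWith ⟨L, hL⟩ f := LipschitzWith.of_dist_le_mul fun x y => by
      rw [Real.dist_eq, dist_eq_norm]; exact hfL x y
    exact this.continuous
  have := S.isFiniteMeasure_restrict
  refine ⟨hfm.aestronglyMeasurable, MemLp.of_bound hfm.aestronglyMeasurable D (ae_of_all _ hfD),
    ?_, (ae_restrict_iff' S.measurableSet.compl).2 (ae_of_all _ hf0)⟩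
  refine S.integrable_jump_iff.1 ⟨(((aestronglyMeasurable_diff_jump
    hfm.aestronglyMeasurable).aemeasurable.norm.pow_const p)).aestronglyMeasurable, ?_⟩
  rw [hasFiniteIntegral_iff_ofReal (ae_of_all _ fun z => Real.rpow_nonneg (abs_nonneg _) _)]
  have h1 := h Ω S.measurableSet le_rfl
  refine lt_of_le_of_lt (le_trans (le_of_eq ?_) h1) ENNReal.ofReal_lt_top
  have hset : {z : EuclideanSpace ℝ (Fin N) × EuclideanSpace ℝ (Fin N) | z.1 ∈ Ω ∨ z.2 ∈ Ω} =
      regionQ Ω := by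
    ext z; simp [regionQ, imp_iff_not_or]
  rw [hset, jumpMeasure, restrict_withDensity S.measurableSet_regionQ,
    Measure.restrict_restrict S.measurableSet_regionQ, Set.inter_self]
  rfl

omit S in
lemma abs_infDist_sub_le (x y : EuclideanSpace ℝ (Fin N)) :
    |Metric.infDist x Ωᶜ - Metric.infDist y Ωᶜ| ≤ 1 * ‖x - y‖ := by
  have := (Metric.lipschitz_infDist_pt Ωᶜ).dist_le_mul x y
  rwa [Real.dist_eq, dist_eq_norm] at this

lemma memX0_infDist : MemX0 p K Ω (fun x => Metric.infDist x Ωᶜ) := by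
  obtain ⟨D, -, hD'⟩ := S.exists_infDist_le
  refine S.memX0_of_lipschitz zero_le_one abs_infDist_sub_le (D := D) (fun x => ?_)
    (fun x hx => Metric.infDist_zero_of_mem hx)
  rw [abs_of_nonneg Metric.infDist_nonneg]
  exact hD' x

lemma memX0_barrier (hu : MemX0 p K Ω u) {ε τ : ℝ} (hε : 0 ≤ ε) (hτ : 0 ≤ τ) :
    MemX0 p K Ω (barrier Ω u ε τ) :=
  S.memX0_posPart_sub (S.memX0_sub (S.memX0_const_mul ε S.memX0_infDist) hu) (mul_nonneg hε hτ)

/-- On pairs that meet B this is the scalar Caccioppoli inequality with g = ε(d - τ); on all other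
pairs the truncation vanishes at both points. The majorant G is kept pointwise because the remainder
G - (pairing density) is later bounded below pointwise, and not only integrated. -/
lemma exists_caccioppoli : ∃ Λ : ℝ, 0 < Λ ∧ ∀ ε τ : ℝ, 0 < ε →
    ∀ B, MeasurableSet B → B ⊆ Ω → (∀ᵐ x, 0 < barrier Ω u ε τ x → x ∈ B) →
    ∃ G, Integrable G (jumpMeasure K Ω) ∧ (∀ z, 0 ≤ G z) ∧
      (∀ᵐ z ∂(jumpMeasure K Ω), (1 / 2) ^ (p - 1) * |diff (barrier Ω u ε τ) z| ^ p ≤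
        G z - signedPow p (diff u z) * diff (barrier Ω u ε τ) z) ∧
      ∫ z, G z ∂(jumpMeasure K Ω) ≤ Λ * ε ^ p * volume.real B := by
  obtain ⟨D, hD, hD'⟩ := S.exists_infDist_le
  have hd := S.memX0_infDist
  obtain ⟨Λ, hΛ, h⟩ := S.exists_lipschitz_energy_le zero_le_one (abs_infDist_sub_le (Ω := Ω))
    (D := D) (fun x y => abs_sub_le_of_nonneg_of_le Metric.infDist_nonneg (hD' x)
      Metric.infDist_nonneg (hD' y))
  set C : ℝ := 2 * 3 ^ (p - 1) + 2 with hC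
  refine ⟨C * (Λ + 1), by positivity, fun ε τ hε B hB hBΩ hsupp => ?_⟩
  set T : Set (EuclideanSpace ℝ (Fin N) × EuclideanSpace ℝ (Fin N)) := {z | z.1 ∈ B ∨ z.2 ∈ B}
    with hT
  have hTm : MeasurableSet T := (measurable_fst hB).union (measurable_snd hB)
  set d : EuclideanSpace ℝ (Fin N) → ℝ := fun x => Metric.infDist x Ωᶜ with hd'
  have hint : Integrable (T.indicator fun z => |diff d z| ^ p) (jumpMeasure K Ω) :=
    (S.integrable_rpow_diff hd).indicator hTm
  have hI : ∫ z, T.indicator (fun z => |diff d z| ^ p) z ∂(jumpMeasure K Ω) ≤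
      Λ * volume.real B := by
    rw [integral_indicator hTm, integral_eq_lintegral_of_nonneg_ae
      (ae_of_all _ fun z => Real.rpow_nonneg (abs_nonneg _) _)
      (S.integrable_rpow_diff hd).1.restrict]
    refine ENNReal.toReal_le_of_le_ofReal (by positivity) (h B hB hBΩ)
  refine ⟨fun z => C * ε ^ p * T.indicator (fun z => |diff d z| ^ p) z, hint.const_mul _,
    fun z => mul_nonneg (by positivity)
      (Set.indicator_nonneg (fun z _ => Real.rpow_nonneg (abs_nonneg _) _) _), ?_, ?_⟩
  · filter_upwards [ae_jumpMeasure hsupp] with z hz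
    by_cases hzT : z ∈ T
    · rw [Set.indicator_of_mem hzT]
      have key := signedPow_mul_posPart_sub_le S.one_lt (u z.1) (u z.2)
        (ε * d z.1 - ε * τ) (ε * d z.2 - ε * τ)
      have e1 : ∀ x, ε * d x - ε * τ - u x = ε * d x - u x - ε * τ := fun x => by ring
      have e2 : |ε * d z.1 - ε * τ - (ε * d z.2 - ε * τ)| ^ p = ε ^ p * |diff d z| ^ p := by
        rw [← Real.mul_rpow hε.le (abs_nonneg _), ← abs_of_pos hε, ← abs_mul, abs_of_pos hε, diff]
        congr 2; ring
      rw [e1, e1, e2] at key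
      simp only [diff, barrier] at key ⊢
      linarith
    · rw [Set.indicator_of_notMem hzT]
      have hz1 : barrier Ω u ε τ z.1 = 0 := le_antisymm
        (not_lt.1 fun h => hzT (Or.inl (hz.1 h))) (le_max_right _ _)
      have hz2 : barrier Ω u ε τ z.2 = 0 := le_antisymm
        (not_lt.1 fun h => hzT (Or.inr (hz.2 h))) (le_max_right _ _)
      have : diff (barrier Ω u ε τ) z = 0 := by rw [diff, hz1, hz2, sub_zero]
      simp [this, Real.zero_rpow S.pos.ne']
  · rw [integral_const_mul]
    calc C * ε ^ p * ∫ z, T.indicator (fun z => |diff d z| ^ p) z ∂(jumpMeasure K Ω)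
        ≤ C * ε ^ p * (Λ * volume.real B) := by gcongr
      _ ≤ C * ε ^ p * ((Λ + 1) * volume.real B) := by gcongr; linarith
      _ = _ := by ring

/-- If every superlevel set at height 1/(n+1) of a measurable representative were null in Ω, u would
vanish almost everywhere. -/
lemma exists_measurable_superlevel (hu : MemX0 p K Ω u) (hu0 : ∀ᵐ x, 0 ≤ u x)
    (hne : ¬ u =ᵐ[volume] 0) : ∃ c : ℝ, 0 < c ∧ ∃ B, MeasurableSet B ∧ B ⊆ Ω ∧
      0 < volume.real B ∧ ∀ᵐ x, x ∈ B → c ≤ u x := by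
  set g := hu.aestronglyMeasurable.mk u with hg
  have hgm : Measurable g := hu.aestronglyMeasurable.stronglyMeasurable_mk.measurable
  have hug : u =ᵐ[volume] g := hu.aestronglyMeasurable.ae_eq_mk
  by_contra! hcon
  refine hne ?_
  have hnull : ∀ n : ℕ, ∀ᵐ x, x ∉ Ω ∩ {x | 1 / ((n : ℝ) + 1) ≤ g x} := by
    intro n
    rw [← measure_eq_zero_iff_ae_notMem]
    have hm : MeasurableSet (Ω ∩ {x | 1 / ((n : ℝ) + 1) ≤ g x}) :=
      S.measurableSet.inter (measurableSet_le measurable_const hgm)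
    by_contra h0
    refine hcon (1 / ((n : ℝ) + 1)) (by positivity) _ hm Set.inter_subset_left
      (ENNReal.toReal_pos h0 (ne_top_of_le_ne_top S.measure_lt_top.ne
        (measure_mono Set.inter_subset_left))) ?_
    filter_upwards [hug] with x hx hxB
    have := hxB.1.2
    rw [Set.mem_ofPred_eq, ← hx] at this
    exact hxB.2.not_ge this
  filter_upwards [ae_all_iff.2 hnull, hug, hu0, S.ae_eq_zero hu] with x h1 h2 h3 h4
  by_cases hx : x ∈ Ω
  · refine le_antisymm (not_lt.1 fun hpos => ?_) h3
    obtain ⟨n, hn⟩ := exists_nat_one_div_lt hpos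
    exact h1 n ⟨hx, by rw [Set.mem_ofPred_eq, ← h2]; exact hn.le⟩
  · exact h4 hx

lemma ae_mem_of_barrier_pos (hu : MemX0 p K Ω u) {ε τ : ℝ} (hε : 0 < ε)
    (hτ : 0 ≤ τ) : ∀ᵐ x, 0 < barrier Ω u ε τ x → x ∈ Ω := by
  filter_upwards [S.ae_eq_zero (S.memX0_barrier hu hε.le hτ)] with x hx h
  by_contra hxΩ
  exact h.ne' (hx hxΩ)

/-- This starts the iteration. Let u ≥ c on B and let w be the barrier with τ = 0. Testing with w,
the interaction of {w > 0} with B costs at least a fixed multiple of ∫ w, while the Caccioppoli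
bound allows only order ε^p. As w ≥ ετ on the support of the barrier with parameter τ, that support
has measure of order ε^{p-1}/τ, which is small because p > 1. -/
lemma exists_measure_barrier_le (hu : MemX0 p K Ω u) (hu0 : ∀ᵐ x, 0 ≤ u x)
    (hne : ¬ u =ᵐ[volume] 0)
    (hsup : ∀ φ, MemX0 p K Ω φ → (∀ x, 0 ≤ φ x) → 0 ≤ pairing p K Ω u φ)
    {τ η : ℝ} (hτ : 0 < τ) (hη : 0 < η) :
    ∃ ε : ℝ, 0 < ε ∧ volume.real {x | 0 < barrier Ω u ε τ x} ≤ η := by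
  obtain ⟨D, hD, hD'⟩ := S.exists_infDist_le
  obtain ⟨Λ, hΛ, hcacc⟩ := S.exists_caccioppoli (u := u)
  obtain ⟨κ, hκ, hKκ⟩ := S.exists_kernel_ge
  obtain ⟨c, hc, B, hB, hBΩ, hBpos, hBc⟩ := S.exists_measurable_superlevel hu hu0 hne
  have hΩpos : 0 < volume.real Ω := ENNReal.toReal_pos S.measure_pos.ne' S.measure_lt_top.ne
  have hp1 : 0 < p - 1 := by linarith [S.one_lt]
  set m : ℝ := κ * volume.real B * (c / 2) ^ (p - 1) with hm
  have hm0 : 0 < m := by positivity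
  -- The first bound keeps εd ≤ c/2, so that w vanishes on B and u ≤ c/2 wherever w > 0; the second
  -- makes the measure at most η.
  set ε : ℝ := min (c / (2 * D)) ((η * m * τ / (Λ * volume.real Ω)) ^ (1 / (p - 1))) with hε
  have hε0 : 0 < ε := by positivity
  have hεD : ε * D ≤ c / 2 := by
    have : ε ≤ c / (2 * D) := min_le_left _ _
    calc ε * D ≤ c / (2 * D) * D := by gcongr
      _ = c / 2 := by field_simp
  have hεp : ε ^ p * (Λ * volume.real Ω) ≤ η * m * (ε * τ) := by
    have h1 : ε ^ (p - 1) ≤ η * m * τ / (Λ * volume.real Ω) := by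
      calc ε ^ (p - 1) ≤ ((η * m * τ / (Λ * volume.real Ω)) ^ (1 / (p - 1))) ^ (p - 1) := by
            gcongr; exact min_le_right _ _
        _ = _ := by rw [← Real.rpow_mul (by positivity), one_div_mul_cancel hp1.ne', Real.rpow_one]
    rw [le_div_iff₀ (by positivity)] at h1
    have h2 : ε ^ p = ε ^ (p - 1) * ε := by rw [← Real.rpow_add_one hε0.ne']; ring_nf
    rw [h2]
    nlinarith
  refine ⟨ε, hε0, ?_⟩
  set w := barrier Ω u ε 0 with hw
  have hwX : MemX0 p K Ω w := S.memX0_barrier hu hε0.le le_rfl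
  have hw0 : ∀ x, 0 ≤ w x := fun x => le_max_right _ _
  obtain ⟨G, hG, hG0, hGw, hGint⟩ := hcacc ε 0 hε0 Ω S.measurableSet le_rfl
    (S.ae_mem_of_barrier_pos hu hε0 le_rfl)
  have hpair := hsup w hwX hw0
  rw [S.pairing_eq] at hpair
  have hR : Integrable (fun z => G z - signedPow p (diff u z) * diff w z) (jumpMeasure K Ω) :=
    hG.sub (S.integrable_pairing hu hwX)
  have hRint : ∫ z, (G z - signedPow p (diff u z) * diff w z) ∂(jumpMeasure K Ω) ≤
      Λ * ε ^ p * volume.real Ω := by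
    rw [integral_sub hG (S.integrable_pairing hu hwX)]; linarith
  have hR0 : ∀ᵐ z ∂(jumpMeasure K Ω), 0 ≤ G z - signedPow p (diff u z) * diff w z := by
    filter_upwards [hGw] with z hz
    exact le_trans (by positivity) hz
  have hmain := S.mul_integral_le_of_le_on_prod hκ.le hKκ hB hBΩ
    ((S.integrable hwX).const_mul ((c / 2) ^ (p - 1))) (fun x => mul_nonneg (by positivity) (hw0 x))
    hR hR0 (by
      filter_upwards [hR0, ae_jumpMeasure hBc] with z hz0 hzc _ hzB
      rcases (hw0 z.1).eq_or_lt with h0 | h0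
      · rw [← h0, mul_zero]; exact hz0
      · have hu1 : u z.1 ≤ c / 2 := by
          rw [hw, barrier, lt_max_iff] at h0
          rcases h0 with h0 | h0
          · nlinarith [hD' z.1]
          · exact absurd h0 (lt_irrefl _)
        have hw2 : w z.2 = 0 := by
          rw [hw, barrier, max_eq_right]
          nlinarith [hD' z.2, hzc.2 hzB]
        have hdiff : diff u z ≤ -(c / 2) := by
          rw [diff]; linarith [hzc.2 hzB]
        have hj := (strictMono_signedPow S.one_lt).monotone hdiff
        rw [signedPow_neg, signedPow_of_nonneg S.one_lt (by positivity : 0 ≤ c / 2)] at hj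
        have hdw : diff w z = w z.1 := by rw [diff, hw2, sub_zero]
        rw [hdw]
        nlinarith [hG0 z])
  rw [integral_const_mul] at hmain
  have hwint : ∫ x in Ω, w x = ∫ x, w x := by
    refine setIntegral_eq_integral_of_ae_compl_eq_zero ?_
    exact S.ae_eq_zero hwX
  rw [hwint] at hmain
  have hmarkov := mul_meas_ge_le_integral_of_nonneg (ae_of_all _ hw0) (S.integrable hwX) (ε * τ)
  have hsub : volume.real {x | 0 < barrier Ω u ε τ x} ≤ volume.real {x | ε * τ ≤ w x} := by
    refine measureReal_mono (fun x hx => ?_) ?_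
    · have hx' : 0 < barrier Ω u ε τ x := hx
      rw [barrier, lt_max_iff] at hx'
      rcases hx' with h | h
      · have h1 : ε * Metric.infDist x Ωᶜ - u x - ε * 0 ≤ w x := le_max_left _ _
        change ε * τ ≤ w x
        linarith
      · exact absurd h (lt_irrefl (0 : ℝ))
    · exact ((S.integrable hwX).measure_ge_lt_top (mul_pos hε0 hτ)).ne
  have hfin : m * (ε * τ * volume.real {x | ε * τ ≤ w x}) ≤ η * m * (ε * τ) := by
    calc m * (ε * τ * volume.real {x | ε * τ ≤ w x}) ≤ m * ∫ x, w x := by gcongr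
      _ = κ * volume.real B * ((c / 2) ^ (p - 1) * ∫ x, w x) := by rw [hm]; ring
      _ ≤ Λ * ε ^ p * volume.real Ω := hmain.trans hRint
      _ = ε ^ p * (Λ * volume.real Ω) := by ring
      _ ≤ _ := hεp
  refine hsub.trans (le_of_mul_le_mul_left ?_ (mul_pos hm0 (mul_pos hε0 hτ)))
  linarith

/-- A nonnegative nontrivial supersolution lies above a multiple of the distance to `Ωᶜ`, up to
an arbitrarily small error. -/
lemma exists_barrier_le_supersolution (hu : MemX0 p K Ω u) (hu0 : ∀ᵐ x, 0 ≤ u x)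
    (hne : ¬ u =ᵐ[volume] 0)
    (hsup : ∀ φ, MemX0 p K Ω φ → (∀ x, 0 ≤ φ x) → 0 ≤ pairing p K Ω u φ) {τ : ℝ} (hτ : 0 < τ) :
    ∃ ε : ℝ, 0 < ε ∧ ∀ᵐ x, ε * (Metric.infDist x Ωᶜ - τ) ≤ u x := by
  obtain ⟨Λ, hΛ, hcacc⟩ := S.exists_caccioppoli (u := u)
  obtain ⟨F, hF, hFK⟩ := S.exists_faber_krahn
  have hα : 0 < p * s / N := div_pos (mul_pos S.pos S.s_pos) (by exact_mod_cast S.dim_pos)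
  -- The recursion constant does not depend on ε: energies scale like ε^p, and so does the p-th
  -- power of the gap between levels. Hence the threshold η is fixed first, and ε is chosen
  -- afterwards to meet it.
  obtain ⟨η, hη, hiter⟩ := exists_tendsto_zero_of_superlinear
    (C := F * (2 ^ (p - 1) * Λ) * (4 / τ) ^ p) (b := 2 ^ p) (α := p * s / N) (by positivity)
    (Real.one_lt_rpow (by norm_num) S.pos) hα
  obtain ⟨ε, hε, hsmall⟩ := S.exists_measure_barrier_le hu hu0 hne hsup (half_pos hτ) hη
  refine ⟨ε, hε, ?_⟩
  -- The levels increase from τ/2 to τ with gaps τ/2^{k+2}.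
  set t : ℕ → ℝ := fun k => τ * (1 - (1 / 2) ^ (k + 1)) with ht
  have ht0 : ∀ k, 0 ≤ t k := fun k => by
    have : ((1 : ℝ) / 2) ^ (k + 1) ≤ 1 := pow_le_one₀ (by norm_num) (by norm_num)
    exact mul_nonneg hτ.le (by linarith)
  have htτ : ∀ k, t k ≤ τ := fun k => by
    have : (0 : ℝ) ≤ ((1 : ℝ) / 2) ^ (k + 1) := by positivity
    nlinarith
  have hwX : ∀ k, MemX0 p K Ω (barrier Ω u ε (t k)) := fun k => S.memX0_barrier hu hε.le (ht0 k)
  have hw0 : ∀ k x, 0 ≤ barrier Ω u ε (t k) x := fun k x => le_max_right _ _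
  have hwΩ := fun k => S.ae_mem_of_barrier_pos hu hε (ht0 k)
  have hAfin : ∀ θ, 0 ≤ θ → volume {x | 0 < barrier Ω u ε θ x} ≠ ⊤ := fun θ hθ =>
    ne_top_of_le_ne_top S.measure_lt_top.ne
      (measure_mono_ae (S.ae_mem_of_barrier_pos hu hε hθ))
  have hlim := hiter (fun k => volume.real {x | 0 < barrier Ω u ε (t k) x})
    (fun k => measureReal_nonneg) (by
      have : t 0 = τ / 2 := by simp only [ht]; ring
      simpa only [this] using hsmall) (fun k => by
      set w := barrier Ω u ε (t k) with hw
      set A : Set (EuclideanSpace ℝ (Fin N)) := {x | 0 < w x} with hA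
      have hAf : volume A ≠ ⊤ := hAfin _ (ht0 k)
      set y : ℝ := volume.real A with hy
      have hy0 : 0 ≤ y := measureReal_nonneg
      -- A need not be Borel. The hull keeps its measure, and the intersection keeps B inside Ω.
      set B := toMeasurable volume (A ∩ Ω) ∩ Ω with hB
      have hBA : volume.real B ≤ y := by
        rw [hy, measureReal_def, measureReal_def]
        refine ENNReal.toReal_mono hAf ((measure_mono Set.inter_subset_left).trans ?_)
        rw [measure_toMeasurable]
        exact measure_mono Set.inter_subset_left
      obtain ⟨G, hG, hG0, hGw, hGint⟩ := hcacc ε (t k) hε B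
        ((measurableSet_toMeasurable _ _).inter S.measurableSet) Set.inter_subset_right (by
          filter_upwards [hwΩ k] with x hx h
          exact ⟨subset_toMeasurable _ _ ⟨h, hx h⟩, hx h⟩)
      have hpair := hsup w (hwX k) (hw0 k)
      have hen : (1 / 2) ^ (p - 1) * normPow p K Ω w ≤ Λ * ε ^ p * y := by
        rw [S.pairing_eq] at hpair
        rw [S.normPow_eq, ← integral_const_mul]
        calc ∫ z, (1 / 2) ^ (p - 1) * |diff w z| ^ p ∂(jumpMeasure K Ω)
            ≤ ∫ z, (G z - signedPow p (diff u z) * diff w z) ∂(jumpMeasure K Ω) :=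
              integral_mono_ae ((S.integrable_rpow_diff (hwX k)).const_mul _)
                (hG.sub (S.integrable_pairing hu (hwX k))) hGw
          _ ≤ ∫ z, G z ∂(jumpMeasure K Ω) := by
              rw [integral_sub hG (S.integrable_pairing hu (hwX k))]; linarith
          _ ≤ Λ * ε ^ p * volume.real B := hGint
          _ ≤ Λ * ε ^ p * y := by gcongr
      have hen' : normPow p K Ω w ≤ 2 ^ (p - 1) * (Λ * ε ^ p * y) := by
        have h2 : (2 : ℝ) ^ (p - 1) * (1 / 2) ^ (p - 1) = 1 := by
          rw [← Real.mul_rpow (by norm_num) (by norm_num)]; norm_num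
        calc normPow p K Ω w = 2 ^ (p - 1) * ((1 / 2) ^ (p - 1) * normPow p K Ω w) := by
              rw [← mul_assoc, h2, one_mul]
          _ ≤ _ := by gcongr
      have hfk := hFK w (hwX k) A hAf (ae_of_all _ fun x hx =>
        le_antisymm (not_lt.1 hx) (hw0 k x))
      set l : ℝ := ε * (τ * (1 / 2) ^ (k + 2)) with hl
      have hl0 : 0 < l := by positivity
      have hmarkov := mul_meas_ge_le_integral_of_nonneg
        (ae_of_all _ fun x => Real.rpow_nonneg (abs_nonneg (w x)) p)
        (S.integrable_rpow (hwX k)) (l ^ p)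
      have hsub : volume.real {x | 0 < barrier Ω u ε (t (k + 1)) x} ≤
          volume.real {x | l ^ p ≤ |w x| ^ p} := by
        refine measureReal_mono (fun x hx => ?_)
          ((S.integrable_rpow (hwX k)).measure_ge_lt_top (by positivity)).ne
        have hx' : 0 < barrier Ω u ε (t (k + 1)) x := hx
        rw [barrier, lt_max_iff] at hx'
        rcases hx' with h | h
        · refine Real.rpow_le_rpow hl0.le ?_ S.pos.le
          rw [abs_of_nonneg (hw0 k x)]
          refine le_trans ?_ (le_max_left _ _)
          have : t (k + 1) - t k = τ * (1 / 2) ^ (k + 2) := by simp only [ht]; ring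
          have : l = ε * t (k + 1) - ε * t k := by rw [hl, ← this]; ring
          linarith
        · exact absurd h (lt_irrefl (0 : ℝ))
      have hlp : (4 / τ) ^ p * (2 ^ p) ^ k * l ^ p = ε ^ p := by
        rw [← Real.rpow_natCast, ← Real.rpow_mul (by norm_num), mul_comm p, Real.rpow_mul
          (by norm_num), Real.rpow_natCast, ← Real.mul_rpow (by positivity) (by positivity),
          ← Real.mul_rpow (by positivity) (by positivity)]
        congr 1
        have h2 : (2 : ℝ) ^ k * (1 / 2) ^ k = 1 := by rw [← mul_pow]; norm_num
        rw [hl, pow_add]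
        field_simp
        linear_combination 4 * h2
      have hfin : l ^ p * volume.real {x | 0 < barrier Ω u ε (t (k + 1)) x} ≤
          l ^ p * (F * (2 ^ (p - 1) * Λ) * (4 / τ) ^ p * (2 ^ p) ^ k * y ^ (1 + p * s / N)) := by
        calc l ^ p * volume.real {x | 0 < barrier Ω u ε (t (k + 1)) x}
            ≤ l ^ p * volume.real {x | l ^ p ≤ |w x| ^ p} := by gcongr
          _ ≤ F * y ^ (p * s / N) * normPow p K Ω w := hmarkov.trans hfk
          _ ≤ F * y ^ (p * s / N) * (2 ^ (p - 1) * (Λ * ε ^ p * y)) := by gcongr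
          _ = _ := by
            rw [← hlp, Real.rpow_add' hy0 (by positivity), Real.rpow_one]; ring
      exact le_of_mul_le_mul_left hfin (by positivity))
  have hnull : volume.real {x | 0 < barrier Ω u ε τ x} = 0 := by
    refine le_antisymm (ge_of_tendsto' hlim fun k => ?_) measureReal_nonneg
    refine measureReal_mono (fun x hx => ?_) (hAfin _ (ht0 k))
    refine lt_of_lt_of_le (show 0 < barrier Ω u ε τ x from hx) (max_le_max ?_ le_rfl)
    have := mul_le_mul_of_nonneg_left (htτ k) hε.le
    linarith
  rw [measureReal_def, ENNReal.toReal_eq_zero_iff, or_iff_left (hAfin _ hτ.le),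
    measure_eq_zero_iff_ae_notMem] at hnull
  filter_upwards [hnull] with x hx
  have h1 : barrier Ω u ε τ x ≤ 0 := not_lt.1 hx
  have h2 := (le_max_left _ _).trans h1
  linarith

/-- The strong minimum principle. -/
lemma positiveIn_of_supersolution (hu : MemX0 p K Ω u) (hu0 : ∀ᵐ x, 0 ≤ u x)
    (hne : ¬ u =ᵐ[volume] 0)
    (hsup : ∀ φ, MemX0 p K Ω φ → (∀ x, 0 ≤ φ x) → 0 ≤ pairing p K Ω u φ) : PositiveIn Ω u := by
  intro V hV hVΩ
  rcases V.eq_empty_or_nonempty with rfl | hVne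
  · exact ⟨1, one_pos, by simp⟩
  obtain ⟨x₀, hx₀, hmin⟩ := hV.exists_isMinOn hVne
    (Metric.continuous_infDist_pt Ωᶜ).continuousOn
  have hpos := S.infDist_pos (hVΩ hx₀)
  -- With τ half the distance from V to Ωᶜ, the barrier is bounded below on V.
  obtain ⟨ε, hε, h⟩ := S.exists_barrier_le_supersolution hu hu0 hne hsup (half_pos hpos)
  refine ⟨ε * (Metric.infDist x₀ Ωᶜ / 2), by positivity, ?_⟩
  filter_upwards [ae_restrict_of_ae h, ae_restrict_mem hV.measurableSet] with x hx hxV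
  refine le_trans ?_ hx
  have : Metric.infDist x₀ Ωᶜ ≤ Metric.infDist x Ωᶜ := hmin hxV
  gcongr
  linarith

end Admissible

/-! ### Boundedness of subsolutions and comparison with supersolutions. -/

namespace Admissible

variable {N : ℕ} {p s : ℝ} {K : EuclideanSpace ℝ (Fin N) → ℝ}
  {Ω : Set (EuclideanSpace ℝ (Fin N))} {u v φ : EuclideanSpace ℝ (Fin N) → ℝ}
  (S : Admissible N p s K Ω)
include S

lemma ae_eq_zero_of_integral_rpow_le_zero (hu : MemX0 p K Ω u) (h : ∫ x, |u x| ^ p ≤ 0) :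
    u =ᵐ[volume] 0 := by
  have h0 : ∀ x, 0 ≤ |u x| ^ p := fun x => Real.rpow_nonneg (abs_nonneg _) _
  have := (integral_eq_zero_iff_of_nonneg h0 (S.integrable_rpow hu)).1
    (le_antisymm h (integral_nonneg h0))
  filter_upwards [this] with x hx
  exact abs_eq_zero.1 ((Real.rpow_eq_zero (abs_nonneg _) S.pos.ne').1 hx)

lemma ae_eq_zero_of_normPow_eq_zero (hu : MemX0 p K Ω u) (h : normPow p K Ω u = 0) :
    u =ᵐ[volume] 0 := by
  obtain ⟨C, hC, hP⟩ := S.exists_poincare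
  have := hP u hu
  rw [h, mul_zero] at this
  exact S.ae_eq_zero_of_integral_rpow_le_zero hu this

lemma ae_eq_zero_of_diff_ae_eq_zero (hu : MemX0 p K Ω u)
    (h : ∀ᵐ z ∂(jumpMeasure K Ω), diff u z = 0) : u =ᵐ[volume] 0 := by
  refine S.ae_eq_zero_of_normPow_eq_zero hu ?_
  rw [S.normPow_eq]
  refine (integral_congr_ae ?_).trans (integral_zero _ _)
  filter_upwards [h] with z hz
  rw [hz, abs_zero, Real.zero_rpow S.pos.ne']

/-- Subsolutions of the eigenvalue equation with small `L^p` norm are at most `1`. -/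
lemma exists_le_one_of_small {lam : ℝ} (hlam : 0 ≤ lam) : ∃ η : ℝ, 0 < η ∧ ∀ v, MemX0 p K Ω v →
    (∀ᵐ x, 0 ≤ v x) →
    (∀ φ, MemX0 p K Ω φ → (∀ x, 0 ≤ φ x) →
      pairing p K Ω v φ ≤ lam * ∫ x in Ω, |v x| ^ (p - 2) * v x * φ x) →
    ∫ x, |v x| ^ p ≤ η → ∀ᵐ x, v x ≤ 1 := by
  obtain ⟨F, hF, hFK⟩ := S.exists_faber_krahn
  have hp1 := S.one_lt
  have hp0 := S.pos
  have hα : 0 < p * s / N := div_pos (mul_pos S.pos S.s_pos) (by exact_mod_cast S.dim_pos)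
  set α := p * s / N with hα'
  -- Growth per step of the iteration: 2^{pα} comes from Markov's inequality inside Faber–Krahn, and
  -- 2^{p-1} from replacing v^{p-1} by a multiple of w_k^{p-1}.
  set r : ℝ := p * α + (p - 1) with hr
  have hr0 : 0 < r := by have := mul_pos hp0 hα; linarith
  obtain ⟨η, hη, hiter⟩ := exists_tendsto_zero_of_superlinear
    (C := F * (lam + 1) * 2 ^ r) (b := 2 ^ r) (α := α) (by positivity)
    (Real.one_lt_rpow (by norm_num) hr0) hα
  refine ⟨η, hη, fun v hv hv0 hsub hsmall => ?_⟩
  set l : ℕ → ℝ := fun k => 1 - (1 / 2) ^ k with hl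
  have hl0 : ∀ k, 0 ≤ l k := fun k => by
    have : ((1 : ℝ) / 2) ^ k ≤ 1 := pow_le_one₀ (by norm_num) (by norm_num)
    simp only [hl]; linarith
  set w : ℕ → EuclideanSpace ℝ (Fin N) → ℝ := fun k x => max (v x - l k) 0 with hw
  have hwX : ∀ k, MemX0 p K Ω (w k) := fun k => S.memX0_posPart_sub hv (hl0 k)
  have hw0 : ∀ k x, 0 ≤ w k x := fun k x => le_max_right _ _
  have hlim := hiter (fun k => ∫ x, |w k x| ^ p)
    (fun k => integral_nonneg fun x => Real.rpow_nonneg (abs_nonneg _) _) (by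
      refine (le_of_eq (integral_congr_ae ?_)).trans hsmall
      filter_upwards [hv0] with x hx
      simp [hw, hl, hx]) (fun k => by
      set y : ℝ := ∫ x, |w k x| ^ p with hy
      have hy0 : 0 ≤ y := integral_nonneg fun x => Real.rpow_nonneg (abs_nonneg _) _
      set q : ℝ := 2 ^ (k + 1) with hq
      have hq0 : 0 < q := by positivity
      have hlq : l (k + 1) - l k = q⁻¹ := by
        simp only [hl, hq, pow_succ, one_div, inv_pow]
        field_simp; ring
      -- Where the next truncation is active, the current one is at least the gap 1/q. As the levels
      -- stay below 1, this also gives v ≤ q w_k, so the right-hand side is controlled by w_k alone.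
      have hpos : ∀ x, 0 < w (k + 1) x → q⁻¹ ≤ w k x ∧ v x ≤ q * w k x ∧ w (k + 1) x ≤ w k x := by
        intro x hx
        rcases lt_max_iff.1 hx with h | h
        · have h1 : v x - l k ≤ w k x := le_max_left _ _
          have h2 : w (k + 1) x = v x - l (k + 1) := max_eq_left h.le
          have hq1 : 0 < q⁻¹ := by positivity
          have h3 : l (k + 1) ≤ 1 := by
            have : (0 : ℝ) ≤ (1 / 2) ^ (k + 1) := by positivity
            simp only [hl]; linarith
          refine ⟨by linarith, ?_, by linarith⟩
          have h4 : q * (v x - l k) ≤ q * w k x := by gcongr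
          refine le_trans ?_ h4
          have h5 : q * q⁻¹ = 1 := mul_inv_cancel₀ hq0.ne'
          have h6 : 1 ≤ q := one_le_pow₀ (by norm_num)
          have h7 : l k = l (k + 1) - q⁻¹ := by linarith
          rw [h7]
          nlinarith
        · exact absurd h (lt_irrefl _)
      have hw1 : ∀ x, w (k + 1) x = 0 ∨ 0 < w (k + 1) x := fun x => by
        rcases (hw0 (k + 1) x).eq_or_lt with h | h
        · exact Or.inl h.symm
        · exact Or.inr h
      have hen : normPow p K Ω (w (k + 1)) ≤ (lam + 1) * (q ^ (p - 1) * y) := by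
        have h1 : normPow p K Ω (w (k + 1)) ≤ pairing p K Ω v (w (k + 1)) := by
          rw [S.normPow_eq, S.pairing_eq]
          exact integral_mono (S.integrable_rpow_diff (hwX _)) (S.integrable_pairing hv (hwX _))
            fun z => rpow_abs_posPart_sub_le_signedPow_mul S.one_lt _ _ _
        have h2 : ∫ x in Ω, |v x| ^ (p - 2) * v x * w (k + 1) x ≤ q ^ (p - 1) * y := by
          rw [hy, ← integral_const_mul]
          calc ∫ x in Ω, |v x| ^ (p - 2) * v x * w (k + 1) x
              ≤ ∫ x in Ω, q ^ (p - 1) * |w k x| ^ p := by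
                refine integral_mono_ae
                  (S.integrable_signedPow_mul (S.memLp hv) (S.memLp (hwX _))).integrableOn
                  ((S.integrable_rpow (hwX k)).const_mul _).integrableOn ?_
                filter_upwards [ae_restrict_of_ae hv0] with x hx
                rcases hw1 x with h | h
                · rw [h, mul_zero]; positivity
                · obtain ⟨-, h3, h4⟩ := hpos x h
                  have h5 := signedPow_of_nonneg S.one_lt hx
                  rw [signedPow] at h5
                  rw [h5, abs_of_nonneg (hw0 k x)]
                  calc v x ^ (p - 1) * w (k + 1) x ≤ (q * w k x) ^ (p - 1) * w k x := by
                        gcongr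
                    _ = q ^ (p - 1) * (w k x ^ (p - 1) * w k x) := by
                        rw [Real.mul_rpow hq0.le (hw0 k x)]; ring
                    _ = q ^ (p - 1) * w k x ^ p := by
                        rw [← signedPow_of_nonneg S.one_lt (hw0 k x),
                          signedPow_mul_self S.one_lt, abs_of_nonneg (hw0 k x)]
            _ ≤ _ := setIntegral_le_integral ((S.integrable_rpow (hwX k)).const_mul _)
                (ae_of_all _ fun x => by positivity)
        calc normPow p K Ω (w (k + 1)) ≤ lam * ∫ x in Ω, |v x| ^ (p - 2) * v x * w (k + 1) x :=
              h1.trans (hsub _ (hwX _) (hw0 _))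
          _ ≤ lam * (q ^ (p - 1) * y) := by gcongr
          _ ≤ _ := by gcongr; linarith
      have hmarkov := mul_meas_ge_le_integral_of_nonneg
        (ae_of_all _ fun x => Real.rpow_nonneg (abs_nonneg (w k x)) p)
        (S.integrable_rpow (hwX k)) (q⁻¹ ^ p)
      have hTfin : volume {x | q⁻¹ ^ p ≤ |w k x| ^ p} ≠ ⊤ :=
        ((S.integrable_rpow (hwX k)).measure_ge_lt_top (by positivity)).ne
      have hT : volume.real {x | q⁻¹ ^ p ≤ |w k x| ^ p} ≤ q ^ p * y := by
        have h1 : q ^ p * q⁻¹ ^ p = 1 := by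
          rw [← Real.mul_rpow hq0.le (by positivity), mul_inv_cancel₀ hq0.ne', Real.one_rpow]
        calc volume.real {x | q⁻¹ ^ p ≤ |w k x| ^ p}
            = q ^ p * (q⁻¹ ^ p * volume.real {x | q⁻¹ ^ p ≤ |w k x| ^ p}) := by
              rw [← mul_assoc, h1, one_mul]
          _ ≤ _ := by gcongr
      have hfk := hFK (w (k + 1)) (hwX _) {x | q⁻¹ ^ p ≤ |w k x| ^ p} hTfin
        (ae_of_all _ fun x hx => (hw1 x).resolve_right fun h => hx (by
          refine Real.rpow_le_rpow (by positivity) ?_ hp0.le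
          rw [abs_of_nonneg (hw0 k x)]
          exact (hpos x h).1))
      calc ∫ x, |w (k + 1) x| ^ p
          ≤ F * volume.real {x | q⁻¹ ^ p ≤ |w k x| ^ p} ^ α * normPow p K Ω (w (k + 1)) := hfk
        _ ≤ F * (q ^ p * y) ^ α * ((lam + 1) * (q ^ (p - 1) * y)) := by
            have := S.normPow_nonneg (u := w (k + 1))
            gcongr
        _ = F * (lam + 1) * (q ^ r) * (y ^ α * y) := by
            rw [Real.mul_rpow (by positivity) hy0, ← Real.rpow_mul hq0.le, hr,
              Real.rpow_add hq0]
            ring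
        _ = F * (lam + 1) * 2 ^ r * (2 ^ r) ^ k * y ^ (1 + α) := by
            have h1 : q ^ r = 2 ^ r * (2 ^ r) ^ k := by
              rw [hq, ← pow_succ', ← Real.rpow_natCast, ← Real.rpow_natCast,
                ← Real.rpow_mul (by norm_num), ← Real.rpow_mul (by norm_num), mul_comm]
            rw [h1, Real.rpow_add' hy0 (by positivity), Real.rpow_one]; ring)
  have hlast : ∫ x, |max (v x - 1) 0| ^ p ≤ 0 := by
    refine ge_of_tendsto' hlim fun k => ?_
    refine integral_mono (S.integrable_rpow (S.memX0_posPart_sub hv zero_le_one))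
      (S.integrable_rpow (hwX k)) fun x => ?_
    refine Real.rpow_le_rpow (abs_nonneg _) ?_ hp0.le
    rw [abs_of_nonneg (le_max_right _ _), abs_of_nonneg (hw0 k x)]
    refine max_le_max ?_ le_rfl
    have : (0 : ℝ) ≤ (1 / 2) ^ k := by positivity
    simp only [hl]; linarith
  filter_upwards [S.ae_eq_zero_of_integral_rpow_le_zero
    (S.memX0_posPart_sub hv zero_le_one) hlast] with x hx
  have h1 : v x - 1 ≤ max (v x - 1) 0 := le_max_left _ _
  have h2 : max (v x - 1) 0 = 0 := hx
  linarith

/-- The inequality is homogeneous of degree p - 1 in v, so a small multiple of v has small L^p norm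
and is at most 1. -/
lemma exists_ae_le_of_subsolution {lam : ℝ} (hlam : 0 ≤ lam) (hv : MemX0 p K Ω v)
    (hv0 : ∀ᵐ x, 0 ≤ v x)
    (hsub : ∀ φ, MemX0 p K Ω φ → (∀ x, 0 ≤ φ x) →
      pairing p K Ω v φ ≤ lam * ∫ x in Ω, |v x| ^ (p - 2) * v x * φ x) :
    ∃ M : ℝ, 0 < M ∧ ∀ᵐ x, v x ≤ M := by
  obtain ⟨η, hη, h⟩ := S.exists_le_one_of_small hlam
  set Y := ∫ x, |v x| ^ p with hY
  have hY0 : 0 ≤ Y := integral_nonneg fun x => Real.rpow_nonneg (abs_nonneg _) _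
  set c : ℝ := (η / (Y + 1)) ^ (1 / p) with hc
  have hc0 : 0 < c := by positivity
  have hcp : c ^ p = η / (Y + 1) := by
    rw [hc, ← Real.rpow_mul (by positivity), one_div_mul_cancel S.pos.ne', Real.rpow_one]
  refine ⟨1 / c, by positivity, ?_⟩
  have := h (fun x => c * v x) (S.memX0_const_mul c hv)
    (hv0.mono fun x hx => mul_nonneg hc0.le hx) (fun φ hφ hφ0 => by
      rw [S.pairing_smul_left hc0.le]
      have e : ∀ x, |c * v x| ^ (p - 2) * (c * v x) * φ x =
          c ^ (p - 1) * (|v x| ^ (p - 2) * v x * φ x) := fun x => by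
        have := signedPow_smul S.one_lt hc0.le (v x)
        rw [signedPow, signedPow] at this
        rw [this]; ring
      simp only [e]
      rw [integral_const_mul, mul_left_comm]
      exact mul_le_mul_of_nonneg_left (hsub φ hφ hφ0) (by positivity)) (by
      have e : ∀ x, |c * v x| ^ p = c ^ p * |v x| ^ p := fun x => by
        rw [abs_mul, Real.mul_rpow (abs_nonneg _) (abs_nonneg _), abs_of_pos hc0]
      simp only [e]
      rw [integral_const_mul, hcp, div_mul_eq_mul_div, div_le_iff₀ (by positivity)]
      nlinarith)
  filter_upwards [this] with x hx
  rw [le_div_iff₀ hc0]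
  linarith

/-- A positive supersolution dominates a multiple of any bounded subsolution of the eigenvalue
equation. -/
lemma exists_mul_le_supersolution (hu : MemX0 p K Ω u) (hupos : PositiveIn Ω u)
    (hsup : ∀ φ, MemX0 p K Ω φ → (∀ x, 0 ≤ φ x) → 0 ≤ pairing p K Ω u φ)
    {lam M : ℝ} (hlam : 0 ≤ lam) (hv : MemX0 p K Ω v) (hv0 : ∀ᵐ x, 0 ≤ v x)
    (hvM : ∀ᵐ x, v x ≤ M) (hM : 0 < M)
    (hsub : ∀ φ, MemX0 p K Ω φ → (∀ x, 0 ≤ φ x) →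
      pairing p K Ω v φ ≤ lam * ∫ x in Ω, |v x| ^ (p - 2) * v x * φ x) :
    ∃ ε : ℝ, 0 < ε ∧ ∀ᵐ x, ε * v x ≤ u x := by
  obtain ⟨D, hD, hD'⟩ := S.exists_infDist_le
  obtain ⟨κ, hκ, hKκ⟩ := S.exists_kernel_ge
  obtain ⟨x₀, hx₀⟩ := S.nonempty
  have hp1 : 0 < p - 1 := by linarith [S.one_lt]
  have hmono := (strictMono_signedPow S.one_lt).monotone
  set d : EuclideanSpace ℝ (Fin N) → ℝ := fun x => Metric.infDist x Ωᶜ with hd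
  have hdc : Continuous d := Metric.continuous_infDist_pt _
  have hdΩ : ∀ x, 0 < d x → x ∈ Ω := fun x hx => by
    by_contra h
    exact hx.ne' (Metric.infDist_zero_of_mem h)
  set r : ℝ := d x₀ / 3 with hr
  have hr0 : 0 < r := by have := S.infDist_pos hx₀; positivity
  set A : Set (EuclideanSpace ℝ (Fin N)) := {x | r ≤ d x} with hA
  set B : Set (EuclideanSpace ℝ (Fin N)) := {x | 2 * r < d x} with hB
  have hAΩ : A ⊆ Ω := fun x hx => hdΩ x (hr0.trans_le hx)
  have hBΩ : B ⊆ Ω := fun x hx => hdΩ x (lt_trans (by positivity) (show 2 * r < d x from hx))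
  have hBo : IsOpen B := isOpen_lt continuous_const hdc
  have hBpos : 0 < volume.real B := by
    refine ENNReal.toReal_pos (hBo.measure_pos _ ⟨x₀, ?_⟩).ne'
      (ne_top_of_le_ne_top S.measure_lt_top.ne (measure_mono hBΩ))
    change 2 * r < d x₀
    linarith
  have hAc : IsCompact A :=
    Metric.isCompact_of_isClosed_isBounded (isClosed_le continuous_const hdc)
      (S.isBounded.subset hAΩ)
  obtain ⟨c₀, hc₀, hc₀u⟩ := hupos A hAc hAΩ
  rw [ae_restrict_iff' hAc.measurableSet] at hc₀u
  -- The bump vanishes off the compact set A, on which u ≥ c₀, and is at least r on the smaller open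
  -- set B. The multiple c keeps cη ≤ c₀/2.
  set η : EuclideanSpace ℝ (Fin N) → ℝ := fun x => max (d x - r) 0 with hη
  have hηX : MemX0 p K Ω η := S.memX0_posPart_sub S.memX0_infDist hr0.le
  have hη0 : ∀ x, 0 ≤ η x := fun x => le_max_right _ _
  have hηA : ∀ x, x ∉ A → η x = 0 := fun x hx =>
    max_eq_right (by have h1 : ¬ r ≤ d x := hx; linarith)
  have hηD : ∀ x, η x ≤ D := fun x => max_le (by linarith [hD' x]) hD.le
  have hηB : ∀ x, x ∈ B → r ≤ η x := fun x hx => by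
    have h1 : d x - r ≤ η x := le_max_left _ _
    have h2 : 2 * r < d x := hx
    linarith
  set c : ℝ := c₀ / (2 * D) with hc
  have hcpos : 0 < c := by positivity
  have hcη : ∀ x, c * η x ≤ c₀ / 2 := fun x => by
    calc c * η x ≤ c * D := by gcongr; exact hηD x
      _ = c₀ / 2 := by rw [hc]; field_simp
  set c₁ : ℝ := c * r with hc₁
  have hc₁pos : 0 < c₁ := by positivity
  -- For x outside A and y in B, the increment of εv is at least -c₁/4, while that of εv + cη is at
  -- most -c₁/2. Thus m is the gain caused by the bump, per pair and per unit of φ(x).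
  set m : ℝ := (c₁ / 2) ^ (p - 1) - (c₁ / 4) ^ (p - 1) with hm
  have hm0 : 0 < m := sub_pos.2 (Real.rpow_lt_rpow (by positivity) (by linarith) hp1)
  set ε : ℝ := min (min (c₀ / 2) (c₁ / 4) / M)
    ((κ * volume.real B * m / (lam * M ^ (p - 1) + 1)) ^ (1 / (p - 1))) with hε
  have hε0 : 0 < ε := by positivity
  have hεM : ε * M ≤ min (c₀ / 2) (c₁ / 4) := by
    rw [← le_div_iff₀ hM]; exact min_le_left _ _
  have hεM1 : ε * M ≤ c₀ / 2 := hεM.trans (min_le_left _ _)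
  have hεM2 : ε * M ≤ c₁ / 4 := hεM.trans (min_le_right _ _)
  have hεp : ε ^ (p - 1) * (lam * M ^ (p - 1)) ≤ κ * volume.real B * m := by
    have h1 : ε ^ (p - 1) ≤ κ * volume.real B * m / (lam * M ^ (p - 1) + 1) := by
      calc ε ^ (p - 1)
          ≤ ((κ * volume.real B * m / (lam * M ^ (p - 1) + 1)) ^ (1 / (p - 1))) ^ (p - 1) := by
            gcongr; exact min_le_right _ _
        _ = _ := by rw [← Real.rpow_mul (by positivity), one_div_mul_cancel hp1.ne', Real.rpow_one]
    rw [le_div_iff₀ (by positivity)] at h1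
    refine le_trans ?_ h1
    gcongr
    linarith
  set w : EuclideanSpace ℝ (Fin N) → ℝ := fun x => ε * v x + c * η x with hw
  have hεv : MemX0 p K Ω (fun x => ε * v x) := S.memX0_const_mul ε hv
  have hwX : MemX0 p K Ω w := S.memX0_add hεv (S.memX0_const_mul c hηX)
  set φ : EuclideanSpace ℝ (Fin N) → ℝ := fun x => max (w x - u x) 0 with hφ
  have hφX : MemX0 p K Ω φ := S.memX0_posPart (S.memX0_sub hwX hu)
  have hφ0 : ∀ x, 0 ≤ φ x := fun x => le_max_right _ _
  -- On A both εv and cη are at most c₀/2, and u ≥ c₀. The test function therefore lives only where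
  -- the bump vanishes, which also fixes the sign of G on all pairs.
  have hφA : ∀ᵐ x, x ∈ A → φ x = 0 := by
    filter_upwards [hc₀u, hvM] with x h1 h2 hx
    refine max_eq_right ?_
    have := mul_le_mul_of_nonneg_left h2 hε0.le
    simp only [hw]
    linarith [h1 hx, hcη x]
  set G : EuclideanSpace ℝ (Fin N) × EuclideanSpace ℝ (Fin N) → ℝ := fun z =>
    signedPow p (diff (fun x => ε * v x) z) * diff φ z - signedPow p (diff w z) * diff φ z with hG
  have hGi : Integrable G (jumpMeasure K Ω) :=
    (S.integrable_pairing hεv hφX).sub (S.integrable_pairing hwX hφX)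
  have hdw : ∀ z, diff w z = diff (fun x => ε * v x) z + c * (η z.1 - η z.2) := fun z => by
    simp only [diff, hw]; ring
  have hG0 : ∀ᵐ z ∂(jumpMeasure K Ω), 0 ≤ G z := by
    filter_upwards [ae_jumpMeasure hφA] with z hz
    have e : G z = (signedPow p (diff (fun x => ε * v x) z) - signedPow p (diff w z)) *
        diff φ z := by simp only [hG]; ring
    rw [e]
    by_cases h1 : z.1 ∈ A <;> by_cases h2 : z.2 ∈ A
    · rw [show diff φ z = φ z.1 - φ z.2 from rfl, hz.1 h1, hz.2 h2]; simp
    · refine mul_nonneg_of_nonpos_of_nonpos (sub_nonpos.2 (hmono ?_)) ?_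
      · rw [hdw, hηA _ h2, sub_zero]
        have := mul_nonneg hcpos.le (hη0 z.1)
        linarith
      · rw [show diff φ z = φ z.1 - φ z.2 from rfl, hz.1 h1]; linarith [hφ0 z.2]
    · refine mul_nonneg (sub_nonneg.2 (hmono ?_)) ?_
      · rw [hdw, hηA _ h1, zero_sub]
        have := mul_nonneg hcpos.le (hη0 z.2)
        linarith
      · rw [show diff φ z = φ z.1 - φ z.2 from rfl, hz.2 h2]; linarith [hφ0 z.1]
    · rw [hdw, hηA _ h1, hηA _ h2]; simp
  have hGB : ∀ᵐ z ∂(jumpMeasure K Ω), z.1 ∈ Ω → z.2 ∈ B → m * φ z.1 ≤ G z := by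
    filter_upwards [ae_jumpMeasure hφA, ae_jumpMeasure hv0, ae_jumpMeasure hvM, hG0]
      with z hz hz0 hzM hGz _ hzB
    by_cases h1 : z.1 ∈ A
    · rw [hz.1 h1, mul_zero]; exact hGz
    · have h2 : z.2 ∈ A := by
        change r ≤ d z.2
        have : 2 * r < d z.2 := hzB
        linarith
      have e : G z = (signedPow p (diff (fun x => ε * v x) z) - signedPow p (diff w z)) *
          diff φ z := by simp only [hG]; ring
      have hdφ : diff φ z = φ z.1 := by rw [diff, hz.2 h2, sub_zero]
      have b1 := mul_le_mul_of_nonneg_left hzM.1 hε0.le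
      have b2 := mul_le_mul_of_nonneg_left hzM.2 hε0.le
      have b3 := mul_nonneg hε0.le hz0.1
      have b4 := mul_nonneg hε0.le hz0.2
      have hlo : signedPow p (-(c₁ / 4)) ≤ signedPow p (diff (fun x => ε * v x) z) :=
        hmono (by simp only [diff]; linarith)
      have hhi : signedPow p (diff w z) ≤ signedPow p (-(c₁ / 2)) := hmono (by
        have := mul_le_mul_of_nonneg_left (hηB _ hzB) hcpos.le
        rw [hdw, hηA _ h1]
        simp only [diff]
        linarith)
      rw [signedPow_neg, signedPow_of_nonneg S.one_lt (by positivity : 0 ≤ c₁ / 4)] at hlo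
      rw [signedPow_neg, signedPow_of_nonneg S.one_lt (by positivity : 0 ≤ c₁ / 2)] at hhi
      rw [e, hdφ]
      refine mul_le_mul_of_nonneg_right ?_ (hφ0 _)
      linarith
  have hmain := S.mul_integral_le_of_le_on_prod hκ.le hKκ hBo.measurableSet hBΩ
    ((S.integrable hφX).const_mul m) (fun x => mul_nonneg hm0.le (hφ0 x)) hGi hG0 hGB
  rw [integral_const_mul] at hmain
  have hGint : ∫ z, G z ∂(jumpMeasure K Ω) =
      ε ^ (p - 1) * pairing p K Ω v φ - pairing p K Ω w φ := by
    rw [← S.pairing_smul_left hε0.le, S.pairing_eq, S.pairing_eq]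
    exact integral_sub (S.integrable_pairing hεv hφX) (S.integrable_pairing hwX hφX)
  have hIφ : 0 ≤ ∫ x in Ω, φ x := integral_nonneg hφ0
  have hsubφ : pairing p K Ω v φ ≤ lam * (M ^ (p - 1) * ∫ x in Ω, φ x) := by
    refine (hsub φ hφX hφ0).trans (mul_le_mul_of_nonneg_left ?_ hlam)
    rw [← integral_const_mul]
    refine integral_mono_ae
      (S.integrable_signedPow_mul (S.memLp hv) (S.memLp hφX)).integrableOn
      ((S.integrable hφX).const_mul _).integrableOn ?_
    filter_upwards [ae_restrict_of_ae hv0, ae_restrict_of_ae hvM] with x h1 h2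
    have h5 := signedPow_of_nonneg S.one_lt h1
    rw [signedPow] at h5
    rw [h5]
    have := hφ0 x
    gcongr
  -- The gain κ|B|m ∫φ pays for the eigenvalue term, by the choice of ε.
  have hw_le : pairing p K Ω w φ ≤ 0 := by
    have h1 : ε ^ (p - 1) * pairing p K Ω v φ ≤ κ * volume.real B * (m * ∫ x in Ω, φ x) := by
      calc ε ^ (p - 1) * pairing p K Ω v φ
          ≤ ε ^ (p - 1) * (lam * (M ^ (p - 1) * ∫ x in Ω, φ x)) := by gcongr
        _ = (ε ^ (p - 1) * (lam * M ^ (p - 1))) * ∫ x in Ω, φ x := by ring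
        _ ≤ (κ * volume.real B * m) * ∫ x in Ω, φ x := by gcongr
        _ = _ := by ring
    linarith
  have hu_ge := hsup φ hφX hφ0
  have hfinal : ∀ᵐ z ∂(jumpMeasure K Ω),
      signedPow p (diff w z) * diff φ z - signedPow p (diff u z) * diff φ z = 0 := by
    have hnn : ∀ z, 0 ≤ signedPow p (diff w z) * diff φ z - signedPow p (diff u z) * diff φ z := by
      intro z
      rw [← sub_mul]
      exact signedPow_sub_mul_posPart_nonneg S.one_lt _ _ _ _
    have hi := (S.integrable_pairing hwX hφX).sub (S.integrable_pairing hu hφX)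
    refine (integral_eq_zero_iff_of_nonneg hnn hi).1 (le_antisymm ?_ (integral_nonneg hnn))
    rw [S.pairing_eq] at hw_le hu_ge
    have := integral_sub (S.integrable_pairing hwX hφX) (S.integrable_pairing hu hφX)
    exact this.le.trans (by linarith)
  have hφzero := S.ae_eq_zero_of_diff_ae_eq_zero hφX (hfinal.mono fun z hz => by
    rw [← sub_mul] at hz
    have : φ z.1 = φ z.2 := posPart_sub_eq_of_signedPow_sub_mul S.one_lt hz
    rw [diff, this, sub_self])
  refine ⟨ε, hε0, ?_⟩
  filter_upwards [hφzero] with x hx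
  have h1 : w x - u x ≤ φ x := le_max_left _ _
  have h2 : φ x = 0 := hx
  have h3 := mul_nonneg hcpos.le (hη0 x)
  have h4 : w x = ε * v x + c * η x := rfl
  linarith

end Admissible

/-! ### Compact embedding of X₀ in L^p. -/

namespace Admissible

variable {N : ℕ} {p s : ℝ} {K : EuclideanSpace ℝ (Fin N) → ℝ}
  {Ω : Set (EuclideanSpace ℝ (Fin N))} {u v φ : EuclideanSpace ℝ (Fin N) → ℝ}
  (S : Admissible N p s K Ω)
include S

/-- Jensen's inequality for t ↦ t^p. -/
lemma abs_sub_average_rpow_le (hu : MemX0 p K Ω u) {r : ℝ} (hr : 0 < r)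
    (c x : EuclideanSpace ℝ (Fin N)) :
    |u x - ⨍ y in Metric.ball c r, u y| ^ p ≤ ⨍ y in Metric.ball c r, |u x - u y| ^ p := by
  have hB0 : volume (Metric.ball c r) ≠ 0 := (Metric.measure_ball_pos _ _ hr).ne'
  have hBf : volume (Metric.ball c r) ≠ ⊤ := measure_ball_lt_top.ne
  have : IsFiniteMeasure (volume.restrict (Metric.ball c r)) := ⟨by simpa using hBf.lt_top⟩
  have hmem : MemLp (fun y => u x - u y) (ENNReal.ofReal p) (volume.restrict (Metric.ball c r)) :=
    (memLp_const (u x)).sub ((S.memLp hu).restrict _)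
  have hint : IntegrableOn (fun y => u x - u y) (Metric.ball c r) volume :=
    (integrable_const _).sub (S.integrable hu).integrableOn
  have h1 : |u x - ⨍ y in Metric.ball c r, u y| ≤ ⨍ y in Metric.ball c r, |u x - u y| := by
    have e : u x - ⨍ y in Metric.ball c r, u y = ⨍ y in Metric.ball c r, (u x - u y) := by
      rw [setAverage_eq, setAverage_eq, integral_sub (integrable_const _)
        (S.integrable hu).integrableOn, setIntegral_const, smul_sub, smul_smul,
        inv_mul_cancel₀ (show volume.real (Metric.ball c r) ≠ 0 from
          (ENNReal.toReal_pos hB0 hBf).ne'), one_smul]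
    rw [e, setAverage_eq, setAverage_eq, smul_eq_mul, smul_eq_mul, abs_mul,
      abs_of_nonneg (inv_nonneg.2 measureReal_nonneg)]
    exact mul_le_mul_of_nonneg_left abs_integral_le_integral_abs
      (inv_nonneg.2 measureReal_nonneg)
  refine (Real.rpow_le_rpow (abs_nonneg _) h1 S.pos.le).trans ?_
  exact (convexOn_rpow S.one_lt.le).map_set_average_le
    (fun t _ => (Real.continuous_rpow_const S.pos.le).continuousAt.continuousWithinAt)
    isClosed_Ici hB0 hBf (ae_of_all _ fun y => Set.mem_Ici.2 (abs_nonneg _)) hint.abs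
    ((S.integrable_rpow_iff hmem.1).2 hmem)

/-- Points of a ball of radius r are less than 2r apart, so there K ≥ δ(2r)^{-N-ps}. Dividing by the
volume of the ball leaves the factor r^{ps}. -/
lemma exists_abs_sub_average_rpow_le : ∃ A : ℝ, 0 < A ∧ ∀ r : ℝ, 0 < r → ∀ u, MemX0 p K Ω u →
    ∀ c x, x ∈ Metric.ball c r →
      ENNReal.ofReal (|u x - ⨍ y in Metric.ball c r, u y| ^ p) ≤
        ENNReal.ofReal (A * r ^ (p * s)) *
          ∫⁻ y, ENNReal.ofReal (|diff u (x, y)| ^ p) * ENNReal.ofReal (K (x - y)) := by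
  obtain ⟨δ, hδ, hδ'⟩ := S.kernel.lower_bound
  have := S.nontrivial
  set ω : ℝ := volume.real (Metric.ball (0 : EuclideanSpace ℝ (Fin N)) 1) with hω
  have hω0 : 0 < ω := ENNReal.toReal_pos (Metric.measure_ball_pos _ _ one_pos).ne'
    measure_ball_lt_top.ne
  refine ⟨2 ^ ((N : ℝ) + p * s) / (ω * δ), by positivity, fun r hr u hu c x hx => ?_⟩
  have hBf : volume (Metric.ball c r) ≠ ⊤ := measure_ball_lt_top.ne
  have hball : volume.real (Metric.ball c r) = r ^ (N : ℝ) * ω := by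
    rw [measureReal_def, Measure.addHaar_ball_of_pos _ _ hr, ENNReal.toReal_mul,
      ← measureReal_def, ← hω, finrank_euclideanSpace_fin,
      ENNReal.toReal_ofReal (by positivity), Real.rpow_natCast]
  have : IsFiniteMeasure (volume.restrict (Metric.ball c r)) := ⟨by simpa using hBf.lt_top⟩
  have hmem : MemLp (fun y => u x - u y) (ENNReal.ofReal p) (volume.restrict (Metric.ball c r)) :=
    (memLp_const (u x)).sub ((S.memLp hu).restrict _)
  have hint := (S.integrable_rpow_iff hmem.1).2 hmem
  set k : ℝ := δ * (2 * r) ^ (-(N : ℝ) - p * s) with hk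
  have hk0 : 0 < k := by positivity
  have hconst : (r ^ (N : ℝ) * ω)⁻¹ = 2 ^ ((N : ℝ) + p * s) / (ω * δ) * r ^ (p * s) * k := by
    have h1 : (2 * r) ^ (-(N : ℝ) - p * s) =
        (2 ^ ((N : ℝ) + p * s) * (r ^ (N : ℝ) * r ^ (p * s)))⁻¹ := by
      rw [← Real.rpow_add hr, ← Real.mul_rpow (by norm_num) hr.le, ← Real.rpow_neg (by positivity)]
      congr 1; ring
    rw [hk, h1]
    field_simp
  have h1 := S.abs_sub_average_rpow_le hu hr c x
  rw [setAverage_eq _ (fun y => |u x - u y| ^ p), hball, smul_eq_mul, hconst] at h1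
  calc ENNReal.ofReal (|u x - ⨍ y in Metric.ball c r, u y| ^ p)
      ≤ ENNReal.ofReal (2 ^ ((N : ℝ) + p * s) / (ω * δ) * r ^ (p * s) * k *
          ∫ y in Metric.ball c r, |u x - u y| ^ p) := ENNReal.ofReal_le_ofReal h1
    _ = ENNReal.ofReal (2 ^ ((N : ℝ) + p * s) / (ω * δ) * r ^ (p * s)) *
          (ENNReal.ofReal k * ∫⁻ y in Metric.ball c r, ENNReal.ofReal (|u x - u y| ^ p)) := by
        rw [mul_assoc, ENNReal.ofReal_mul (by positivity), ENNReal.ofReal_mul hk0.le,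
          ofReal_integral_eq_lintegral_ofReal hint
            (ae_of_all _ fun y => Real.rpow_nonneg (abs_nonneg _) _)]
    _ ≤ _ := by
        gcongr ENNReal.ofReal _ * ?_
        rw [← lintegral_const_mul' _ _ ENNReal.ofReal_ne_top]
        calc ∫⁻ y in Metric.ball c r, ENNReal.ofReal k * ENNReal.ofReal (|u x - u y| ^ p)
            ≤ ∫⁻ y in Metric.ball c r,
                ENNReal.ofReal (|diff u (x, y)| ^ p) * ENNReal.ofReal (K (x - y)) := by
              refine setLIntegral_mono' measurableSet_ball fun y hy => ?_
              rw [mul_comm]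
              by_cases hxy : x = y
              · simp [hxy, Real.zero_rpow S.pos.ne']
              · refine mul_le_mul_right (ENNReal.ofReal_le_ofReal ?_) _
                have hne := sub_ne_zero.2 hxy
                refine le_trans ?_ (hδ' _ hne)
                rw [hk]
                gcongr δ * ?_
                refine Real.rpow_le_rpow_of_nonpos (norm_pos_iff.2 hne) ?_ S.exponent_neg.le
                rw [← dist_eq_norm]
                have h2 := dist_triangle_right x y c
                have h3 := Metric.mem_ball.1 hx
                have h4 := Metric.mem_ball.1 hy
                linarith
          _ ≤ _ := setLIntegral_le_lintegral _ _

/-- At bounded energy, the L^p norm is determined up to O(r^{ps}) by the averages over a cover by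
balls of radius r; with a finite cover these are the coordinates in the compactness proof. -/
lemma exists_integral_rpow_le_averages : ∃ A : ℝ, 0 < A ∧ ∀ r : ℝ, 0 < r →
    ∀ t : Set (EuclideanSpace ℝ (Fin N)), Ω ⊆ ⋃ c ∈ t, Metric.ball c r →
    ∀ u, MemX0 p K Ω u → ∀ m : ℝ, 0 ≤ m → (∀ c ∈ t, |⨍ y in Metric.ball c r, u y| ≤ m) →
      ∫ x, |u x| ^ p ≤ A * r ^ (p * s) * normPow p K Ω u + 2 ^ p * m ^ p * volume.real Ω := by
  obtain ⟨A, hA, h⟩ := S.exists_abs_sub_average_rpow_le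
  refine ⟨2 ^ p * A, by positivity, fun r hr t ht u hu m hm hmt => ?_⟩
  have hmeas : AEMeasurable (fun z => ENNReal.ofReal (|diff u z| ^ p))
      ((volume : Measure (EuclideanSpace ℝ (Fin N))).prod volume) :=
    ((aestronglyMeasurable_diff hu.aestronglyMeasurable).aemeasurable.norm.pow_const
      p).ennreal_ofReal
  have hpt : ∀ x ∈ Ω, ENNReal.ofReal (|u x| ^ p) ≤ ENNReal.ofReal (2 ^ p * A * r ^ (p * s)) *
      (∫⁻ y, ENNReal.ofReal (|diff u (x, y)| ^ p) * ENNReal.ofReal (K (x - y))) +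
      ENNReal.ofReal (2 ^ p * m ^ p) := by
    intro x hx
    obtain ⟨c, hc, hxc⟩ := Set.mem_iUnion₂.1 (ht hx)
    have h1 := abs_add_rpow_le S.pos.le (u x - ⨍ y in Metric.ball c r, u y)
      (⨍ y in Metric.ball c r, u y)
    rw [sub_add_cancel] at h1
    have h2 : |⨍ y in Metric.ball c r, u y| ^ p ≤ m ^ p :=
      Real.rpow_le_rpow (abs_nonneg _) (hmt c hc) S.pos.le
    have h3 := h r hr u hu c x hxc
    calc ENNReal.ofReal (|u x| ^ p)
        ≤ ENNReal.ofReal (2 ^ p * |u x - ⨍ y in Metric.ball c r, u y| ^ p + 2 ^ p * m ^ p) := by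
          refine ENNReal.ofReal_le_ofReal (h1.trans ?_)
          rw [mul_add]
          gcongr
      _ = ENNReal.ofReal (2 ^ p) * ENNReal.ofReal (|u x - ⨍ y in Metric.ball c r, u y| ^ p) +
            ENNReal.ofReal (2 ^ p * m ^ p) := by
          rw [ENNReal.ofReal_add (by positivity) (by positivity),
            ENNReal.ofReal_mul (by positivity)]
      _ ≤ ENNReal.ofReal (2 ^ p) * (ENNReal.ofReal (A * r ^ (p * s)) *
            ∫⁻ y, ENNReal.ofReal (|diff u (x, y)| ^ p) * ENNReal.ofReal (K (x - y))) +
            ENNReal.ofReal (2 ^ p * m ^ p) := by gcongr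
      _ = _ := by
          rw [← mul_assoc, ← ENNReal.ofReal_mul (by positivity), ← mul_assoc]
  have hE : ENNReal.ofReal (∫ x, |u x| ^ p) ≤ ENNReal.ofReal
      (2 ^ p * A * r ^ (p * s) * normPow p K Ω u + 2 ^ p * m ^ p * volume.real Ω) := by
    calc ENNReal.ofReal (∫ x, |u x| ^ p) = ∫⁻ x, ENNReal.ofReal (|u x| ^ p) :=
          ofReal_integral_eq_lintegral_ofReal (S.integrable_rpow hu)
            (ae_of_all _ fun x => Real.rpow_nonneg (abs_nonneg _) _)
      _ = ∫⁻ x in Ω, ENNReal.ofReal (|u x| ^ p) := by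
          rw [← lintegral_indicator S.measurableSet]
          refine lintegral_congr_ae ?_
          filter_upwards [S.ae_eq_zero hu] with x hx
          by_cases h : x ∈ Ω
          · simp [h]
          · simp [h, hx h, Real.zero_rpow S.pos.ne']
      _ ≤ ∫⁻ x in Ω, (ENNReal.ofReal (2 ^ p * A * r ^ (p * s)) *
            (∫⁻ y, ENNReal.ofReal (|diff u (x, y)| ^ p) * ENNReal.ofReal (K (x - y))) +
            ENNReal.ofReal (2 ^ p * m ^ p)) := setLIntegral_mono' S.measurableSet hpt
      _ = ENNReal.ofReal (2 ^ p * A * r ^ (p * s)) *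
            (∫⁻ z in Ω ×ˢ Set.univ, ENNReal.ofReal (|diff u z| ^ p) ∂(jumpMeasure K Ω)) +
            ENNReal.ofReal (2 ^ p * m ^ p) * volume Ω := by
          rw [lintegral_add_right _ measurable_const, setLIntegral_const,
            lintegral_const_mul' _ _ ENNReal.ofReal_ne_top,
            S.setLIntegral_jump S.measurableSet le_rfl hmeas]
      _ ≤ ENNReal.ofReal (2 ^ p * A * r ^ (p * s)) *
            (∫⁻ z, ENNReal.ofReal (|diff u z| ^ p) ∂(jumpMeasure K Ω)) +
            ENNReal.ofReal (2 ^ p * m ^ p) * volume Ω := by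
          gcongr
          exact Measure.restrict_le_self
      _ = _ := by
          rw [← ofReal_integral_eq_lintegral_ofReal (S.integrable_rpow_diff hu)
            (ae_of_all _ fun x => Real.rpow_nonneg (abs_nonneg _) _), ← S.normPow_eq,
            ENNReal.ofReal_add (mul_nonneg (by positivity) S.normPow_nonneg) (by positivity),
            ENNReal.ofReal_mul (p := 2 ^ p * A * r ^ (p * s)) (by positivity),
            ENNReal.ofReal_mul (q := volume.real Ω)
            (by positivity), ofReal_measureReal S.measure_lt_top.ne]
  exact (ENNReal.ofReal_le_ofReal_iff (add_nonneg (mul_nonneg (by positivity) S.normPow_nonneg)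
    (by positivity))).1 hE

end Admissible

/-- A family of vectors in a metric space is totally bounded if its distances are controlled by
finitely many bounded coordinates. -/
lemma totallyBounded_range_of_coordinates {ι X : Type} [PseudoMetricSpace X] (x : ι → X)
    (H : ∀ ε : ℝ, 0 < ε → ∃ (T : Type) (_ : Fintype T) (F : ι → T → ℝ) (R ρ : ℝ), 0 < ρ ∧
      (∀ i, ‖F i‖ ≤ R) ∧ ∀ i j, dist (F i) (F j) < ρ → dist (x i) (x j) < ε) :
    TotallyBounded (Set.range x) := by
  refine Metric.totallyBounded_of_finite_discretization fun ε hε => ?_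
  obtain ⟨T, _, F, R, ρ, hρ, hR, hF⟩ := H ε hε
  obtain ⟨t, -, htf, ht⟩ := finite_cover_balls_of_compact
    (isCompact_closedBall (0 : T → ℝ) R) (half_pos hρ)
  have hcov : ∀ i, ∃ c : t, F i ∈ Metric.ball (c : T → ℝ) (ρ / 2) := fun i => by
    obtain ⟨c, hc, hic⟩ := Set.mem_iUnion₂.1 (ht (mem_closedBall_zero_iff.2 (hR i)))
    exact ⟨⟨c, hc⟩, hic⟩
  choose g hg using hcov
  refine ⟨t, htf.fintype, fun y => g y.2.choose, fun y z hyz => ?_⟩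
  have h1 := y.2.choose_spec
  have h2 := z.2.choose_spec
  rw [← h1, ← h2]
  refine hF _ _ ?_
  have h3 := Metric.mem_ball.1 (hg y.2.choose)
  have h4 := Metric.mem_ball.1 (hg z.2.choose)
  dsimp only at hyz
  rw [hyz] at h3
  have := dist_triangle_right (F y.2.choose) (F z.2.choose) (g z.2.choose : T → ℝ)
  linarith

namespace Admissible

variable {N : ℕ} {p s : ℝ} {K : EuclideanSpace ℝ (Fin N) → ℝ}
  {Ω : Set (EuclideanSpace ℝ (Fin N))} {u v φ : EuclideanSpace ℝ (Fin N) → ℝ}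
  (S : Admissible N p s K Ω)
include S

lemma eLpNorm_eq (hu : MemLp u (ENNReal.ofReal p) volume) :
    eLpNorm u (ENNReal.ofReal p) volume = ENNReal.ofReal ((∫ x, |u x| ^ p) ^ p⁻¹) := by
  rw [hu.eLpNorm_eq_integral_rpow_norm (by simp [S.pos]) (by simp),
    ENNReal.toReal_ofReal S.pos.le]
  rfl

lemma integral_abs_le (hu : MemX0 p K Ω u) :
    ∫ x, |u x| ≤ volume.real Ω + ∫ x, |u x| ^ p := by
  have hfin := S.isFiniteMeasure_restrict
  have h1 : ∫ x, |u x| = ∫ x in Ω, |u x| := (setIntegral_eq_integral_of_ae_compl_eq_zero (by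
    filter_upwards [S.ae_eq_zero hu] with x hx h
    rw [hx h, abs_zero])).symm
  have h2 : ∫ x, |u x| ^ p = ∫ x in Ω, |u x| ^ p :=
    (setIntegral_eq_integral_of_ae_compl_eq_zero (by
      filter_upwards [S.ae_eq_zero hu] with x hx h
      rw [hx h, abs_zero, Real.zero_rpow S.pos.ne'])).symm
  have h3 : volume.real Ω = ∫ _ in Ω, (1 : ℝ) := by simp
  rw [h1, h2, h3, ← integral_add (integrable_const _) (S.integrable_rpow hu).integrableOn]
  refine integral_mono (S.integrable hu).integrableOn.abs
    ((integrable_const _).add (S.integrable_rpow hu).integrableOn) fun x => ?_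
  have h0 : 0 ≤ |u x| ^ p := Real.rpow_nonneg (abs_nonneg _) _
  rcases le_total |u x| 1 with h | h
  · change |u x| ≤ 1 + |u x| ^ p
    linarith
  · change |u x| ≤ 1 + |u x| ^ p
    have := Real.rpow_le_rpow_of_exponent_le h S.one_lt.le
    rw [Real.rpow_one] at this
    linarith

lemma totallyBounded_range_toLp [Fact (1 ≤ ENNReal.ofReal p)]
    {f : ℕ → EuclideanSpace ℝ (Fin N) → ℝ} (hf : ∀ n, MemX0 p K Ω (f n)) {M : ℝ}
    (hM : ∀ n, normPow p K Ω (f n) ≤ M) :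
    TotallyBounded (Set.range fun n => (S.memLp (hf n)).toLp (f n)) := by
  obtain ⟨A, hA, hAv⟩ := S.exists_integral_rpow_le_averages
  obtain ⟨C, hC, hP⟩ := S.exists_poincare
  have hps : 0 < p * s := mul_pos S.pos S.s_pos
  have hp0 := S.pos
  have hM0 : 0 ≤ M := S.normPow_nonneg.trans (hM 0)
  refine totallyBounded_range_of_coordinates _ fun ε hε => ?_
  -- M' bounds the energy of the difference of two members of the family. Then r makes the
  -- oscillation term smaller than ε^p/2, and m makes the term from the averages at most ε^p/2.
  set M' : ℝ := 2 ^ p * (M + M) with hM'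
  set r : ℝ := (ε ^ p / (2 * (A * (M' + 1)))) ^ (1 / (p * s)) with hr
  have hr0 : 0 < r := by positivity
  have hrp : A * r ^ (p * s) * M' < ε ^ p / 2 := by
    have h1 : r ^ (p * s) = ε ^ p / (2 * (A * (M' + 1))) := by
      rw [hr, ← Real.rpow_mul (by positivity), one_div_mul_cancel hps.ne', Real.rpow_one]
    have h2 : A * r ^ (p * s) * (M' + 1) = ε ^ p / 2 := by
      have : 0 < M' + 1 := by positivity
      rw [h1]; field_simp
    have h3 : 0 < A * r ^ (p * s) := by positivity
    nlinarith
  set m : ℝ := (ε ^ p / (2 * (2 ^ p * (volume.real Ω + 1)))) ^ (1 / p) with hm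
  have hm0 : 0 < m := by positivity
  have hmp : 2 ^ p * m ^ p * volume.real Ω ≤ ε ^ p / 2 := by
    have h1 : m ^ p = ε ^ p / (2 * (2 ^ p * (volume.real Ω + 1))) := by
      rw [hm, ← Real.rpow_mul (by positivity), one_div_mul_cancel hp0.ne', Real.rpow_one]
    have h2 : 2 ^ p * m ^ p * (volume.real Ω + 1) = ε ^ p / 2 := by rw [h1]; field_simp
    have h3 : 0 < 2 ^ p * m ^ p := by positivity
    nlinarith
  obtain ⟨t, -, htf, ht⟩ := finite_cover_balls_of_compact S.isBounded.isCompact_closure hr0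
  set b : ℝ := volume.real (Metric.ball (0 : EuclideanSpace ℝ (Fin N)) r) with hb
  have hb0 : 0 < b := ENNReal.toReal_pos (Metric.measure_ball_pos _ _ hr0).ne'
    measure_ball_lt_top.ne
  have hbc : ∀ c : EuclideanSpace ℝ (Fin N), volume.real (Metric.ball c r) = b := fun c => by
    rw [hb, measureReal_def, measureReal_def, Measure.addHaar_ball_center]
  have htfin := htf.fintype
  refine ⟨t, htfin, fun n c => ⨍ y in Metric.ball (c : EuclideanSpace ℝ (Fin N)) r, f n y,
    b⁻¹ * (volume.real Ω + C * M), m, hm0, fun n => ?_, fun i j hij => ?_⟩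
  · rw [pi_norm_le_iff_of_nonneg (by positivity)]
    intro c
    dsimp only
    rw [setAverage_eq, hbc, smul_eq_mul, norm_mul, norm_inv, Real.norm_of_nonneg hb0.le]
    refine mul_le_mul_of_nonneg_left ?_ (by positivity)
    calc ‖∫ y in Metric.ball (c : EuclideanSpace ℝ (Fin N)) r, f n y‖
        ≤ ∫ y in Metric.ball (c : EuclideanSpace ℝ (Fin N)) r, |f n y| :=
          norm_integral_le_integral_norm _
      _ ≤ ∫ y, |f n y| := setIntegral_le_integral (S.integrable (hf n)).abs
          (ae_of_all _ fun y => abs_nonneg _)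
      _ ≤ volume.real Ω + ∫ y, |f n y| ^ p := S.integral_abs_le (hf n)
      _ ≤ volume.real Ω + C * M := by
          gcongr
          exact (hP _ (hf n)).trans (by gcongr; exact hM n)
  · have hsub : MemX0 p K Ω (fun x => f i x - f j x) := S.memX0_sub (hf i) (hf j)
    have hnorm : normPow p K Ω (fun x => f i x - f j x) ≤ M' := by
      have h1 := S.normPow_add_le (hf i) (S.memX0_neg (hf j))
      have h2 : normPow p K Ω (fun x => -f j x) = normPow p K Ω (f j) := by
        simpa using S.normPow_const_mul (u := f j) (-1)
      rw [h2] at h1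
      simp only [← sub_eq_add_neg] at h1
      refine h1.trans ?_
      rw [hM']
      exact mul_le_mul_of_nonneg_left (add_le_add (hM i) (hM j)) (by positivity)
    have havg : ∀ c ∈ t, |⨍ y in Metric.ball c r, (f i y - f j y)| ≤ m := by
      intro c hc
      have h1 := (dist_le_pi_dist _ _ ⟨c, hc⟩).trans hij.le
      rw [Real.dist_eq] at h1
      refine le_trans (le_of_eq ?_) h1
      congr 1
      dsimp only
      rw [setAverage_eq, setAverage_eq, setAverage_eq, integral_sub
        (S.integrable (hf i)).integrableOn (S.integrable (hf j)).integrableOn, smul_sub]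
    have hint := hAv r hr0 t (subset_closure.trans ht) _ hsub m hm0.le havg
    have hlt : ∫ x, |f i x - f j x| ^ p < ε ^ p := by
      have : A * r ^ (p * s) * normPow p K Ω (fun x => f i x - f j x) ≤
          A * r ^ (p * s) * M' := by gcongr
      linarith
    rw [dist_eq_norm, ← MemLp.toLp_sub, Lp.norm_toLp]
    have e := S.eLpNorm_eq (S.memLp hsub)
    have h0 : 0 ≤ ∫ x, |f i x - f j x| ^ p :=
      integral_nonneg fun x => Real.rpow_nonneg (abs_nonneg _) _
    rw [show f i - f j = fun x => f i x - f j x from rfl, e, ENNReal.toReal_ofReal (by positivity)]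
    calc (∫ x, |f i x - f j x| ^ p) ^ p⁻¹ < (ε ^ p) ^ p⁻¹ :=
          Real.rpow_lt_rpow h0 hlt (by positivity)
      _ = ε := by rw [← Real.rpow_mul hε.le, mul_inv_cancel₀ hp0.ne', Real.rpow_one]

/-- Fatou's lemma for the jump measure; almost everywhere convergence replaces weak convergence. -/
lemma normPow_le_of_tendsto {f : ℕ → EuclideanSpace ℝ (Fin N) → ℝ} (hf : ∀ n, MemX0 p K Ω (f n))
    {g : EuclideanSpace ℝ (Fin N) → ℝ} (hg : MemLp g (ENNReal.ofReal p) volume)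
    (hlim : ∀ᵐ x, Tendsto (fun n => f n x) atTop (𝓝 (g x))) {c : ℝ}
    (hc : Tendsto (fun n => normPow p K Ω (f n)) atTop (𝓝 c)) :
    MemX0 p K Ω g ∧ normPow p K Ω g ≤ c := by
  have hc0 : 0 ≤ c := ge_of_tendsto' hc fun n => S.normPow_nonneg
  have hfatou : ∫⁻ z, ENNReal.ofReal (|diff g z| ^ p) ∂(jumpMeasure K Ω) ≤ ENNReal.ofReal c := by
    calc ∫⁻ z, ENNReal.ofReal (|diff g z| ^ p) ∂(jumpMeasure K Ω)
        = ∫⁻ z, liminf (fun n => ENNReal.ofReal (|diff (f n) z| ^ p)) atTop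
            ∂(jumpMeasure K Ω) := by
          refine lintegral_congr_ae ?_
          filter_upwards [ae_jumpMeasure hlim] with z hz
          refine (Tendsto.liminf_eq ?_).symm
          refine ENNReal.tendsto_ofReal ?_
          have := ((hz.1.sub hz.2).abs).rpow_const (p := p) (Or.inr S.pos.le)
          exact this
      _ ≤ liminf (fun n => ∫⁻ z, ENNReal.ofReal (|diff (f n) z| ^ p) ∂(jumpMeasure K Ω)) atTop :=
          lintegral_liminf_le' fun n =>
            ((aestronglyMeasurable_diff_jump (hf n).aestronglyMeasurable).aemeasurable.norm.pow_const
              p).ennreal_ofReal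
      _ = liminf (fun n => ENNReal.ofReal (normPow p K Ω (f n))) atTop := by
          congr 1; ext n
          rw [S.normPow_eq, ofReal_integral_eq_lintegral_ofReal (S.integrable_rpow_diff (hf n))
            (ae_of_all _ fun z => Real.rpow_nonneg (abs_nonneg _) _)]
      _ = ENNReal.ofReal c := (ENNReal.tendsto_ofReal hc).liminf_eq
  have hm : AEStronglyMeasurable (diff g) (jumpMeasure K Ω) := aestronglyMeasurable_diff_jump hg.1
  have hi : Integrable (fun z => |diff g z| ^ p) (jumpMeasure K Ω) := by
    refine ⟨(hm.aemeasurable.norm.pow_const p).aestronglyMeasurable, ?_⟩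
    rw [hasFiniteIntegral_iff_ofReal (ae_of_all _ fun z => Real.rpow_nonneg (abs_nonneg _) _)]
    exact lt_of_le_of_lt hfatou ENNReal.ofReal_lt_top
  constructor
  · refine S.memX0_of_memLp hg ((S.integrable_rpow_iff hm).1 hi) ?_
    filter_upwards [hlim, ae_all_iff.2 fun n => S.ae_eq_zero (hf n)] with x h1 h2 hx
    refine tendsto_nhds_unique h1 ?_
    simp only [h2 _ hx]
    exact tendsto_const_nhds
  · rw [← ofReal_integral_eq_lintegral_ofReal hi
      (ae_of_all _ fun z => Real.rpow_nonneg (abs_nonneg _) _), ← S.normPow_eq] at hfatou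
    exact (ENNReal.ofReal_le_ofReal_iff hc0).1 hfatou

/-- Compactness of the embedding of `X₀` in `L^p`, with weak lower semicontinuity of the energy. -/
lemma exists_subseq_tendsto {f : ℕ → EuclideanSpace ℝ (Fin N) → ℝ} (hf : ∀ n, MemX0 p K Ω (f n))
    {M : ℝ} (hM : ∀ n, normPow p K Ω (f n) ≤ M) :
    ∃ ψ : ℕ → ℕ, StrictMono ψ ∧ ∃ g c, MemX0 p K Ω g ∧
      (∀ᵐ x, Tendsto (fun n => f (ψ n) x) atTop (𝓝 (g x))) ∧
      Tendsto (fun n => ∫ x, |f (ψ n) x - g x| ^ p) atTop (𝓝 0) ∧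
      Tendsto (fun n => normPow p K Ω (f (ψ n))) atTop (𝓝 c) ∧ normPow p K Ω g ≤ c := by
  have hfact : Fact (1 ≤ ENNReal.ofReal p) := ⟨by
    rw [← ENNReal.ofReal_one]; exact ENNReal.ofReal_le_ofReal S.one_lt.le⟩
  have hp0 := S.pos
  -- Three successive extractions follow: convergence in L^p, almost everywhere, and of the
  -- energies.
  have htb := (S.totallyBounded_range_toLp hf hM).closure.isCompact_of_isClosed isClosed_closure
  obtain ⟨g, -, ψ₁, hψ₁, hlim₁⟩ := htb.tendsto_subseq
    (x := fun n => (S.memLp (hf n)).toLp (f n)) fun n => subset_closure ⟨n, rfl⟩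
  have hgL : MemLp g (ENNReal.ofReal p) volume := Lp.memLp g
  have hLp : Tendsto (fun n => eLpNorm (f (ψ₁ n) - (g : EuclideanSpace ℝ (Fin N) → ℝ)) (ENNReal.ofReal p) volume) atTop (𝓝 0) := by
    rw [Lp.tendsto_Lp_iff_tendsto_eLpNorm'] at hlim₁
    refine hlim₁.congr fun n => eLpNorm_congr_ae ?_
    exact (MemLp.coeFn_toLp (S.memLp (hf (ψ₁ n)))).sub EventuallyEq.rfl
  obtain ⟨ψ₂, hψ₂, hae⟩ := (tendstoInMeasure_of_tendsto_eLpNorm (by simp [hp0])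
    (fun n => (hf (ψ₁ n)).aestronglyMeasurable) hgL.1 hLp).exists_seq_tendsto_ae
  obtain ⟨c, -, ψ₃, hψ₃, hc⟩ := tendsto_subseq_of_bounded (Metric.isBounded_Icc (0 : ℝ) M)
    (x := fun n => normPow p K Ω (f (ψ₁ (ψ₂ n)))) fun n => ⟨S.normPow_nonneg, hM _⟩
  have hae' : ∀ᵐ x, Tendsto (fun n => f (ψ₁ (ψ₂ (ψ₃ n))) x) atTop (𝓝 (g x)) :=
    hae.mono fun x hx => hx.comp hψ₃.tendsto_atTop
  obtain ⟨hg, hle⟩ := S.normPow_le_of_tendsto (fun n => hf (ψ₁ (ψ₂ (ψ₃ n)))) hgL hae' hc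
  refine ⟨ψ₁ ∘ ψ₂ ∘ ψ₃, hψ₁.comp (hψ₂.comp hψ₃), g, c, hg, hae', ?_, hc, hle⟩
  have h1 := hLp.comp (hψ₂.comp hψ₃).tendsto_atTop
  have h2 := (ENNReal.tendsto_toReal ENNReal.zero_ne_top).comp h1
  have h3 := h2.rpow_const (p := p) (Or.inr hp0.le)
  rw [ENNReal.toReal_zero, Real.zero_rpow hp0.ne'] at h3
  refine h3.congr fun n => ?_
  have hsub := S.memX0_sub (hf (ψ₁ (ψ₂ (ψ₃ n)))) hg
  have h0 : 0 ≤ ∫ x, |f (ψ₁ (ψ₂ (ψ₃ n))) x - g x| ^ p :=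
    integral_nonneg fun x => Real.rpow_nonneg (abs_nonneg _) _
  have e := S.eLpNorm_eq (S.memLp hsub)
  simp only [Function.comp_apply]
  rw [show f (ψ₁ (ψ₂ (ψ₃ n))) - (g : EuclideanSpace ℝ (Fin N) → ℝ) =
    fun x => f (ψ₁ (ψ₂ (ψ₃ n))) x - g x from rfl, e, ENNReal.toReal_ofReal (by positivity),
    ← Real.rpow_mul h0, inv_mul_cancel₀ hp0.ne', Real.rpow_one]

end Admissible

/-! ### Differentiability of the norm and the first eigenfunction. -/

namespace Admissible

variable {N : ℕ} {p s : ℝ} {K : EuclideanSpace ℝ (Fin N) → ℝ}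
  {Ω : Set (EuclideanSpace ℝ (Fin N))} {u v φ : EuclideanSpace ℝ (Fin N) → ℝ}
  (S : Admissible N p s K Ω)
include S

/-- Differentiation under the integral sign: for |t| < 1, Young's inequality dominates the
derivative by a combination of |f|^p and |g|^p. It serves both for the jump measure and for Lebesgue
measure on Ω. -/
lemma hasDerivAt_integral_rpow {α : Type*} [MeasurableSpace α] {ν : Measure α} {f g : α → ℝ}
    (hf : MemLp f (ENNReal.ofReal p) ν) (hg : MemLp g (ENNReal.ofReal p) ν) :
    HasDerivAt (fun t : ℝ => ∫ x, |f x + t * g x| ^ p ∂ν)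
      (p * ∫ x, signedPow p (f x) * g x ∂ν) 0 := by
  have hp0 := S.pos
  have hfi := (S.integrable_rpow_iff hf.1).2 hf
  have hgi := (S.integrable_rpow_iff hg.1).2 hg
  have hfg : ∀ t : ℝ, AEStronglyMeasurable (fun x => f x + t * g x) ν := fun t =>
    hf.1.add (hg.1.const_mul t)
  have key := hasDerivAt_integral_of_dominated_loc_of_deriv_le (μ := ν) (𝕜 := ℝ) (x₀ := 0)
    (s := Metric.ball 0 1) (F := fun t x => |f x + t * g x| ^ p)
    (F' := fun t x => p * signedPow p (f x + t * g x) * g x)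
    (bound := fun x => p * (2 ^ p * (|f x| ^ p + |g x| ^ p) + |g x| ^ p))
    (Metric.ball_mem_nhds _ one_pos)
    (Eventually.of_forall fun t => ((hfg t).aemeasurable.norm.pow_const p).aestronglyMeasurable)
    (by simpa using hfi)
    (((((measurable_signedPow p).comp_aemeasurable (hfg 0).aemeasurable).const_mul p).mul
      hg.1.aemeasurable).aestronglyMeasurable)
    (ae_of_all _ fun x t ht => by
      have ht1 : |t| ≤ 1 := by
        have := Metric.mem_ball.1 ht
        rw [Real.dist_eq, sub_zero] at this
        exact this.le
      rw [mul_assoc, Real.norm_eq_abs, abs_mul, abs_of_pos hp0]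
      refine mul_le_mul_of_nonneg_left ?_ hp0.le
      have h1 := abs_signedPow_mul_le S.one_lt (f x + t * g x) (g x)
      have h2 := abs_add_rpow_le hp0.le (f x) (t * g x)
      have h3 : |t * g x| ^ p ≤ |g x| ^ p := by
        refine Real.rpow_le_rpow (abs_nonneg _) ?_ hp0.le
        rw [abs_mul]
        exact mul_le_of_le_one_left (abs_nonneg _) ht1
      have h4 : |f x + t * g x| ^ p ≤ 2 ^ p * (|f x| ^ p + |g x| ^ p) :=
        h2.trans (by gcongr)
      have h5 : 0 ≤ 1 / p := by positivity
      have h6 : 1 / p ≤ 1 := by rw [div_le_one hp0]; exact S.one_lt.le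
      have h7 : 0 ≤ |f x + t * g x| ^ p := by positivity
      have h8 : 0 ≤ |g x| ^ p := by positivity
      nlinarith)
    (((hfi.add hgi).const_mul _).add hgi |>.const_mul p)
    (ae_of_all _ fun x t _ => by
      have h1 := (hasDerivAt_abs_rpow (f x + t * g x) S.one_lt)
      have h2 : HasDerivAt (fun t : ℝ => f x + t * g x) (g x) t := by
        simpa using ((hasDerivAt_id t).mul_const (g x)).const_add (f x)
      have := h1.comp t h2
      refine this.congr_deriv ?_
      rw [signedPow]; ring)
  refine key.2.congr_deriv ?_
  rw [← integral_const_mul]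
  congr 1; ext x
  rw [zero_mul, add_zero, mul_assoc]

lemma hasDerivAt_normPow (hu : MemX0 p K Ω u) (hφ : MemX0 p K Ω φ) :
    HasDerivAt (fun t : ℝ => normPow p K Ω (fun x => u x + t * φ x)) (p * pairing p K Ω u φ) 0 := by
  rw [S.pairing_eq]
  refine (S.hasDerivAt_integral_rpow (S.memLp_diff hu) (S.memLp_diff hφ)).congr_of_eventuallyEq
    (Eventually.of_forall fun t => ?_)
  simp only [S.normPow_eq]
  congr 1; ext z
  congr 2
  simp only [diff]; ring

lemma setIntegral_rpow (hu : MemX0 p K Ω u) : ∫ x in Ω, |u x| ^ p = ∫ x, |u x| ^ p :=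
  setIntegral_eq_integral_of_ae_compl_eq_zero (by
    filter_upwards [S.ae_eq_zero hu] with x hx h
    rw [hx h, abs_zero, Real.zero_rpow S.pos.ne'])

lemma integral_rpow_pos (hu : MemX0 p K Ω u) (h : ¬ u =ᵐ[volume] 0) : 0 < ∫ x, |u x| ^ p := by
  by_contra hcon
  exact h (S.ae_eq_zero_of_integral_rpow_le_zero hu (not_lt.1 hcon))

lemma not_ae_eq_zero_infDist :
    ¬ (fun x : EuclideanSpace ℝ (Fin N) => Metric.infDist x Ωᶜ) =ᵐ[volume] 0 := by
  intro h
  refine S.measure_pos.ne' (measure_eq_zero_iff_ae_notMem.2 ?_)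
  filter_upwards [h] with x hx hxΩ
  exact (S.infDist_pos hxΩ).ne' hx

lemma firstEigenvalue_nonneg : 0 ≤ firstEigenvalue p K Ω := by
  refine Real.sInf_nonneg ?_
  rintro r ⟨w, -, -, rfl⟩
  exact div_nonneg S.normPow_nonneg (integral_nonneg fun x => Real.rpow_nonneg (abs_nonneg _) _)

lemma firstEigenvalue_mul_le (hu : MemX0 p K Ω u) :
    firstEigenvalue p K Ω * ∫ x, |u x| ^ p ≤ normPow p K Ω u := by
  by_cases h : u =ᵐ[volume] 0
  · have : ∫ x, |u x| ^ p = 0 := by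
      refine (integral_congr_ae ?_).trans (integral_zero _ _)
      filter_upwards [h] with x hx
      rw [hx, Pi.zero_apply, abs_zero, Real.zero_rpow S.pos.ne']
    rw [this, mul_zero]
    exact S.normPow_nonneg
  · rw [← le_div_iff₀ (S.integral_rpow_pos hu h)]
    refine csInf_le ⟨0, ?_⟩ ⟨u, hu, h, by rw [S.setIntegral_rpow hu]⟩
    rintro r ⟨w, -, -, rfl⟩
    exact div_nonneg S.normPow_nonneg (integral_nonneg fun x => Real.rpow_nonneg (abs_nonneg _) _)

/-- Minkowski's inequality. The normalization survives in the limit, so the limit is nonzero. -/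
lemma one_le_integral_rpow_of_tendsto {f : ℕ → EuclideanSpace ℝ (Fin N) → ℝ}
    (hf : ∀ n, MemX0 p K Ω (f n)) (hf1 : ∀ n, ∫ x, |f n x| ^ p = 1)
    {g : EuclideanSpace ℝ (Fin N) → ℝ} (hg : MemX0 p K Ω g)
    (hlim : Tendsto (fun n => ∫ x, |f n x - g x| ^ p) atTop (𝓝 0)) : 1 ≤ ∫ x, |g x| ^ p := by
  have hp0 := S.pos
  have h0 : 0 ≤ ∫ x, |g x| ^ p := integral_nonneg fun x => Real.rpow_nonneg (abs_nonneg _) _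
  have h1 : ∀ n, (1 : ℝ) ≤ (∫ x, |f n x - g x| ^ p) ^ p⁻¹ + (∫ x, |g x| ^ p) ^ p⁻¹ := by
    intro n
    have hsub := S.memX0_sub (hf n) hg
    have h2 := eLpNorm_add_le (S.memLp hsub).1 (S.memLp hg).1 (p := ENNReal.ofReal p)
      (by rw [← ENNReal.ofReal_one]; exact ENNReal.ofReal_le_ofReal S.one_lt.le)
    have e : (fun x => f n x - g x) + g = f n := by ext x; simp
    have h3 : 0 ≤ ∫ x, |f n x - g x| ^ p := integral_nonneg fun x => by positivity
    rw [e, S.eLpNorm_eq (S.memLp (hf n)), S.eLpNorm_eq (S.memLp hsub), S.eLpNorm_eq (S.memLp hg),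
      hf1, Real.one_rpow, ← ENNReal.ofReal_add (by positivity) (by positivity)] at h2
    exact (ENNReal.ofReal_le_ofReal_iff (by positivity)).1 h2
  have h2 : Tendsto (fun n => (∫ x, |f n x - g x| ^ p) ^ p⁻¹ + (∫ x, |g x| ^ p) ^ p⁻¹) atTop
      (𝓝 (0 ^ p⁻¹ + (∫ x, |g x| ^ p) ^ p⁻¹)) :=
    (hlim.rpow_const (Or.inr (by positivity))).add_const _
  rw [Real.zero_rpow (by positivity), zero_add] at h2
  have h3 := ge_of_tendsto' h2 h1
  by_contra hlt
  exact absurd h3 (not_le.2 (Real.rpow_lt_one h0 (not_le.1 hlt) (by positivity)))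

lemma exists_firstEigenvalue_minimizer : ∃ v, MemX0 p K Ω v ∧ (∀ᵐ x, 0 ≤ v x) ∧
    1 ≤ ∫ x, |v x| ^ p ∧ normPow p K Ω v ≤ firstEigenvalue p K Ω := by
  have hp0 := S.pos
  have hne : {r : ℝ | ∃ w, MemX0 p K Ω w ∧ ¬ (w =ᵐ[volume] 0) ∧
      r = normPow p K Ω w / ∫ x in Ω, |w x| ^ p}.Nonempty :=
    ⟨_, _, S.memX0_infDist, S.not_ae_eq_zero_infDist, rfl⟩
  have hbdd : BddBelow {r : ℝ | ∃ w, MemX0 p K Ω w ∧ ¬ (w =ᵐ[volume] 0) ∧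
      r = normPow p K Ω w / ∫ x in Ω, |w x| ^ p} := by
    refine ⟨0, ?_⟩
    rintro r ⟨w, -, -, rfl⟩
    exact div_nonneg S.normPow_nonneg (integral_nonneg fun x => Real.rpow_nonneg (abs_nonneg _) _)
  obtain ⟨R, -, hRlim, hR⟩ := exists_seq_tendsto_sInf hne hbdd
  choose w hwX hw0 hwR using hR
  set c : ℕ → ℝ := fun n => (∫ x, |w n x| ^ p) ^ (-p⁻¹) with hc
  have hI : ∀ n, 0 < ∫ x, |w n x| ^ p := fun n => S.integral_rpow_pos (hwX n) (hw0 n)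
  have hc0 : ∀ n, 0 < c n := fun n => Real.rpow_pos_of_pos (hI n) _
  have hcp : ∀ n, c n ^ p = (∫ x, |w n x| ^ p)⁻¹ := fun n => by
    rw [hc, ← Real.rpow_mul (hI n).le, neg_mul, inv_mul_cancel₀ hp0.ne', Real.rpow_neg_one]
  -- Absolute values do not increase the energy, and c_n normalizes in L^p, so this is still a
  -- minimizing sequence.
  set f : ℕ → EuclideanSpace ℝ (Fin N) → ℝ := fun n x => c n * |w n x| with hf
  have hfX : ∀ n, MemX0 p K Ω (f n) := fun n => S.memX0_const_mul _ (S.memX0_abs (hwX n))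
  have hf1 : ∀ n, ∫ x, |f n x| ^ p = 1 := fun n => by
    have e : ∀ x, |f n x| ^ p = c n ^ p * |w n x| ^ p := fun x => by
      rw [hf, abs_mul, abs_abs, abs_of_pos (hc0 n), Real.mul_rpow (hc0 n).le (abs_nonneg _)]
    simp only [e]
    rw [integral_const_mul, hcp, inv_mul_cancel₀ (hI n).ne']
  have hfR : ∀ n, normPow p K Ω (f n) ≤ R n := fun n => by
    rw [hf, S.normPow_const_mul, abs_of_pos (hc0 n), hcp, hwR, S.setIntegral_rpow (hwX n),
      div_eq_inv_mul]
    refine mul_le_mul_of_nonneg_left ?_ (inv_nonneg.2 (hI n).le)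
    exact S.normPow_mono (hwX n) fun x y => abs_abs_sub_abs_le _ _
  obtain ⟨M, hM⟩ := hRlim.bddAbove_range
  obtain ⟨ψ, hψ, g, L, hg, hae, hLp, hL, hgL⟩ := S.exists_subseq_tendsto hfX
    (M := M) fun n => (hfR n).trans (hM ⟨n, rfl⟩)
  refine ⟨g, hg, ?_, S.one_le_integral_rpow_of_tendsto (fun n => hfX (ψ n)) (fun n => hf1 (ψ n)) hg
    hLp, hgL.trans ?_⟩
  · filter_upwards [hae] with x hx
    exact ge_of_tendsto' hx fun n => mul_nonneg (hc0 _).le (abs_nonneg _)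
  · exact le_of_tendsto_of_tendsto' hL (hRlim.comp hψ.tendsto_atTop) fun n => hfR (ψ n)

lemma exists_isPositiveFirstEigenfunction :
    ∃ v, IsPositiveFirstEigenfunction p K Ω v := by
  obtain ⟨v, hv, hv0, hv1, hvmin⟩ := S.exists_firstEigenvalue_minimizer
  have hlam := S.firstEigenvalue_nonneg
  set lam := firstEigenvalue p K Ω with hlamdef
  have hweak : ∀ φ, MemX0 p K Ω φ →
      pairing p K Ω v φ = lam * ∫ x in Ω, |v x| ^ (p - 2) * v x * φ x := by
    intro φ hφ
    have hd := (S.hasDerivAt_normPow hv hφ).sub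
      ((S.hasDerivAt_integral_rpow hv.memLp hφ.memLp).const_mul lam)
    have hnn : ∀ t : ℝ, 0 ≤ normPow p K Ω (fun x => v x + t * φ x) -
        lam * ∫ x in Ω, |v x + t * φ x| ^ p := fun t => by
      have hX := S.memX0_add hv (S.memX0_const_mul t hφ)
      have := S.firstEigenvalue_mul_le hX
      rw [← S.setIntegral_rpow hX] at this
      linarith
    -- The function is nonnegative by definition of λ₁, and its value at 0 is at most λ₁ - λ₁ ∫|v|^p
    -- ≤ 0.
    have hmin : IsLocalMin (fun t : ℝ => normPow p K Ω (fun x => v x + t * φ x) -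
        lam * ∫ x in Ω, |v x + t * φ x| ^ p) 0 := by
      refine Eventually.of_forall fun t => le_trans ?_ (hnn t)
      simp only [zero_mul, add_zero]
      rw [S.setIntegral_rpow hv]
      nlinarith
    have hz := hmin.hasDerivAt_eq_zero hd
    have hfac : p * (pairing p K Ω v φ - lam * ∫ x in Ω, signedPow p (v x) * φ x) = 0 := by
      linarith
    have := (mul_eq_zero.1 hfac).resolve_left S.pos.ne'
    exact sub_eq_zero.1 this
  refine ⟨v, hv, S.positiveIn_of_supersolution hv hv0 ?_ ?_, hweak⟩
  · intro h
    have : ∫ x, |v x| ^ p = 0 := by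
      refine (integral_congr_ae ?_).trans (integral_zero _ _)
      filter_upwards [h] with x hx
      rw [hx, Pi.zero_apply, abs_zero, Real.zero_rpow S.pos.ne']
    linarith
  · intro φ hφ hφ0
    rw [hweak φ hφ]
    refine mul_nonneg hlam (integral_nonneg_of_ae ?_)
    filter_upwards [ae_restrict_of_ae hv0] with x hx
    have := hφ0 x
    simp only [Pi.zero_apply]
    positivity

end Admissible

/-! ### The Kirchhoff energy and its minimizer. -/

/-- The sublinear potential `∫_Ω h |u|^q`. -/
noncomputable def potential {N : ℕ} (q : ℝ) (Ω : Set (EuclideanSpace ℝ (Fin N)))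
    (h u : EuclideanSpace ℝ (Fin N) → ℝ) : ℝ := ∫ x in Ω, h x * |u x| ^ q

/-- The energy functional of the Kirchhoff problem, with `q = 1 - γ`. -/
noncomputable def kirchhoffEnergy {N : ℕ} (p a b q μ : ℝ) (K : EuclideanSpace ℝ (Fin N) → ℝ)
    (Ω : Set (EuclideanSpace ℝ (Fin N))) (h u : EuclideanSpace ℝ (Fin N) → ℝ) : ℝ :=
  a / p * normPow p K Ω u + b / (2 * p) * normPow p K Ω u ^ 2 - μ / q * potential q Ω h u

/-- A bounded nonnegative weight on `Ω`. -/
structure IsWeight {N : ℕ} (Ω : Set (EuclideanSpace ℝ (Fin N))) (H : ℝ)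
    (h : EuclideanSpace ℝ (Fin N) → ℝ) : Prop where
  aestronglyMeasurable : AEStronglyMeasurable h (volume.restrict Ω)
  nonneg : ∀ x ∈ Ω, 0 ≤ h x
  le : ∀ x ∈ Ω, h x ≤ H

/-- Subadditivity of t ↦ t^q for q ≤ 1; it makes the potential continuous for L^p convergence. -/
lemma abs_abs_rpow_sub_abs_rpow_le {q : ℝ} (hq : 0 < q) (hq1 : q ≤ 1) (s t : ℝ) :
    |(|s| ^ q - |t| ^ q)| ≤ |s - t| ^ q := by
  have key : ∀ a b : ℝ, |a| ^ q ≤ |a - b| ^ q + |b| ^ q := fun a b =>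
    calc |a| ^ q ≤ (|a - b| + |b|) ^ q := by
          refine Real.rpow_le_rpow (abs_nonneg _) ?_ hq.le
          have := abs_add_le (a - b) b
          rwa [sub_add_cancel] at this
      _ ≤ _ := Real.rpow_add_le_add_rpow (abs_nonneg _) (abs_nonneg _) hq.le hq1
  have h1 := key s t
  have h2 := key t s
  rw [abs_sub_comm t s] at h2
  exact abs_le.2 ⟨by linarith, by linarith⟩

namespace Admissible

variable {N : ℕ} {p s : ℝ} {K : EuclideanSpace ℝ (Fin N) → ℝ}
  {Ω : Set (EuclideanSpace ℝ (Fin N))} {u v φ h : EuclideanSpace ℝ (Fin N) → ℝ} {q H : ℝ}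
  (S : Admissible N p s K Ω)
include S

lemma weight_bound_nonneg (hh : IsWeight Ω H h) : 0 ≤ H := by
  obtain ⟨x, hx⟩ := S.nonempty
  exact (hh.nonneg x hx).trans (hh.le x hx)

lemma integrable_potential (hh : IsWeight Ω H h) (hq : 0 < q) (hqp : q < p)
    (hu : MemX0 p K Ω u) : Integrable (fun x => h x * |u x| ^ q) (volume.restrict Ω) := by
  have := S.isFiniteMeasure_restrict
  have hH := S.weight_bound_nonneg hh
  obtain ⟨C, hC, hCt⟩ := exists_rpow_le_const_add hq hqp one_pos
  refine Integrable.mono' (((integrable_const 1).add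
    ((S.integrable_rpow hu).integrableOn.const_mul C)).const_mul H)
    (hh.aestronglyMeasurable.mul
      (hu.aestronglyMeasurable.restrict.aemeasurable.norm.pow_const q).aestronglyMeasurable) ?_
  filter_upwards [ae_restrict_mem S.measurableSet] with x hx
  have h0 := hh.nonneg x hx
  rw [Real.norm_of_nonneg (by positivity)]
  exact mul_le_mul (hh.le x hx) (hCt _ (abs_nonneg _)) (by positivity) hH

lemma potential_nonneg (hh : IsWeight Ω H h) : 0 ≤ potential q Ω h u := by
  refine setIntegral_nonneg S.measurableSet fun x hx => ?_
  have h0 := hh.nonneg x hx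
  positivity

lemma exists_potential_le (hh : IsWeight Ω H h) (hq : 0 < q) (hqp : q < p) {ε : ℝ} (hε : 0 < ε) :
    ∃ C : ℝ, ∀ u, MemX0 p K Ω u → potential q Ω h u ≤ ε * normPow p K Ω u + C := by
  have := S.isFiniteMeasure_restrict
  have hH := S.weight_bound_nonneg hh
  obtain ⟨P, hP, hPoin⟩ := S.exists_poincare
  obtain ⟨C, hC, hCt⟩ := exists_rpow_le_mul_add_const hq hqp
    (show 0 < ε / ((H + 1) * P) by positivity)
  refine ⟨H * (C * volume.real Ω), fun u hu => ?_⟩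
  have hi := (S.integrable_rpow hu).integrableOn (s := Ω)
  calc potential q Ω h u ≤ ∫ x in Ω, H * (ε / ((H + 1) * P) * |u x| ^ p + C) := by
        refine integral_mono_ae (S.integrable_potential hh hq hqp hu)
          (((hi.const_mul _).add (integrable_const C)).const_mul H) ?_
        filter_upwards [ae_restrict_mem S.measurableSet] with x hx
        exact mul_le_mul (hh.le x hx) (hCt _ (abs_nonneg _)) (by positivity) hH
    _ = H * (ε / ((H + 1) * P) * ∫ x, |u x| ^ p) + H * (C * volume.real Ω) := by
        rw [integral_const_mul, integral_add (hi.const_mul _) (integrable_const C),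
          integral_const_mul, S.setIntegral_rpow hu, setIntegral_const, smul_eq_mul]
        ring
    _ ≤ ε * normPow p K Ω u + H * (C * volume.real Ω) := by
        refine add_le_add ?_ le_rfl
        have h1 := hPoin u hu
        have hE := S.normPow_nonneg (u := u)
        calc H * (ε / ((H + 1) * P) * ∫ x, |u x| ^ p)
            ≤ (H + 1) * (ε / ((H + 1) * P) * (P * normPow p K Ω u)) := by
              have : 0 ≤ ∫ x, |u x| ^ p :=
                integral_nonneg fun x => Real.rpow_nonneg (abs_nonneg _) _
              gcongr
              linarith
          _ = ε * normPow p K Ω u := by field_simp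

lemma tendsto_potential (hh : IsWeight Ω H h) (hq : 0 < q) (hq1 : q ≤ 1)
    {f : ℕ → EuclideanSpace ℝ (Fin N) → ℝ} (hf : ∀ n, MemX0 p K Ω (f n))
    {g : EuclideanSpace ℝ (Fin N) → ℝ} (hg : MemX0 p K Ω g)
    (hlim : Tendsto (fun n => ∫ x, |f n x - g x| ^ p) atTop (𝓝 0)) :
    Tendsto (fun n => potential q Ω h (f n)) atTop (𝓝 (potential q Ω h g)) := by
  have hfin := S.isFiniteMeasure_restrict
  have hH := S.weight_bound_nonneg hh
  have hqp : q < p := hq1.trans_lt S.one_lt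
  rw [Metric.tendsto_atTop]
  intro ε hε
  set η : ℝ := ε / (2 * ((H + 1) * (volume.real Ω + 1))) with hη
  have hη0 : 0 < η := by positivity
  obtain ⟨C, hC, hCt⟩ := exists_rpow_le_const_add hq hqp hη0
  obtain ⟨n₀, hn₀⟩ := (Metric.tendsto_atTop.1 hlim) (ε / (2 * ((H + 1) * (C + 1))))
    (by positivity)
  refine ⟨n₀, fun n hn => ?_⟩
  have h1 := hn₀ n hn
  have hI0 : 0 ≤ ∫ x, |f n x - g x| ^ p := integral_nonneg fun x => by positivity
  rw [Real.dist_eq, sub_zero, abs_of_nonneg hI0, lt_div_iff₀ (by positivity)] at h1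
  have hsub := S.memX0_sub (hf n) hg
  have hi := (S.integrable_rpow hsub).integrableOn (s := Ω)
  have hbound : |potential q Ω h (f n) - potential q Ω h g| ≤
      H * (η * volume.real Ω + C * ∫ x, |f n x - g x| ^ p) := by
    rw [potential, potential, ← integral_sub (S.integrable_potential hh hq hqp (hf n))
      (S.integrable_potential hh hq hqp hg)]
    refine abs_integral_le_integral_abs.trans ?_
    calc ∫ x in Ω, |h x * |f n x| ^ q - h x * |g x| ^ q|
        ≤ ∫ x in Ω, H * (η + C * |f n x - g x| ^ p) := by
          refine integral_mono_ae ((S.integrable_potential hh hq hqp (hf n)).sub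
            (S.integrable_potential hh hq hqp hg)).abs
            (((integrable_const η).add (hi.const_mul C)).const_mul H) ?_
          filter_upwards [ae_restrict_mem S.measurableSet] with x hx
          rw [← mul_sub, abs_mul, abs_of_nonneg (hh.nonneg x hx)]
          exact mul_le_mul (hh.le x hx) ((abs_abs_rpow_sub_abs_rpow_le hq hq1 _ _).trans
            (hCt _ (abs_nonneg _))) (abs_nonneg _) hH
      _ = _ := by
          rw [integral_const_mul, integral_add (integrable_const η) (hi.const_mul C),
            integral_const_mul, S.setIntegral_rpow hsub, setIntegral_const, smul_eq_mul]
          ring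
  rw [Real.dist_eq]
  refine hbound.trans_lt ?_
  have h2 : (H + 1) * (η * (volume.real Ω + 1)) = ε / 2 := by
    have : 0 < volume.real Ω + 1 := by positivity
    rw [hη]; field_simp
  have h3 : H * (η * volume.real Ω) ≤ (H + 1) * (η * (volume.real Ω + 1)) := by
    gcongr <;> linarith
  have h4 : H * (C * ∫ x, |f n x - g x| ^ p) ≤
      (H + 1) * ((C + 1) * ∫ x, |f n x - g x| ^ p) := by
    gcongr <;> linarith
  nlinarith

/-- The energy attains its minimum on the cone of nonnegative functions. -/
lemma exists_kirchhoffEnergy_minimizer {a b μ : ℝ} (ha : 0 < a) (hb : 0 ≤ b) (hμ : 0 < μ)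
    (hh : IsWeight Ω H h) (hq : 0 < q) (hq1 : q ≤ 1) :
    ∃ u, MemX0 p K Ω u ∧ (∀ᵐ x, 0 ≤ u x) ∧ ∀ w, MemX0 p K Ω w → (∀ᵐ x, 0 ≤ w x) →
      kirchhoffEnergy p a b q μ K Ω h u ≤ kirchhoffEnergy p a b q μ K Ω h w := by
  have hp0 := S.pos
  have hqp : q < p := hq1.trans_lt S.one_lt
  -- After multiplication by μ/q, the potential absorbs exactly half of (a/p) E and leaves the other
  -- half for coercivity.
  obtain ⟨C, hC⟩ := S.exists_potential_le hh hq hqp (show 0 < a / (2 * p) * (q / μ) by positivity)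
  have hcoer : ∀ w, MemX0 p K Ω w →
      a / (2 * p) * normPow p K Ω w - μ / q * C ≤ kirchhoffEnergy p a b q μ K Ω h w := by
    intro w hw
    have h1 := mul_le_mul_of_nonneg_left (hC w hw) (show 0 ≤ μ / q by positivity)
    have h2 : μ / q * (a / (2 * p) * (q / μ) * normPow p K Ω w + C) =
        a / (2 * p) * normPow p K Ω w + μ / q * C := by field_simp
    have h3 : a / p * normPow p K Ω w = 2 * (a / (2 * p) * normPow p K Ω w) := by field_simp
    have h4 : 0 ≤ b / (2 * p) * normPow p K Ω w ^ 2 := by positivity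
    rw [kirchhoffEnergy]
    linarith
  set V : Set ℝ := {r | ∃ w, MemX0 p K Ω w ∧ (∀ᵐ x, 0 ≤ w x) ∧
    r = kirchhoffEnergy p a b q μ K Ω h w} with hV
  have hVne : V.Nonempty := ⟨_, _, S.memX0_infDist, ae_of_all _ fun x => Metric.infDist_nonneg, rfl⟩
  have hVb : BddBelow V := by
    refine ⟨-(μ / q * C), ?_⟩
    rintro r ⟨w, hw, -, rfl⟩
    have h1 := hcoer w hw
    have h2 := S.normPow_nonneg (u := w)
    have : 0 ≤ a / (2 * p) * normPow p K Ω w := by positivity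
    linarith
  obtain ⟨R, -, hRlim, hR⟩ := exists_seq_tendsto_sInf hVne hVb
  choose f hfX hf0 hfR using hR
  obtain ⟨M, hM⟩ := hRlim.bddAbove_range
  have hE : ∀ n, normPow p K Ω (f n) ≤ (M + μ / q * C) / (a / (2 * p)) := fun n => by
    rw [le_div_iff₀ (by positivity)]
    have h1 := hcoer _ (hfX n)
    have h2 : R n ≤ M := hM ⟨n, rfl⟩
    rw [← hfR] at h1
    linarith
  obtain ⟨ψ, hψ, g, L, hg, hae, hLp, hL, hgL⟩ := S.exists_subseq_tendsto hfX hE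
  refine ⟨g, hg, ?_, fun w hw hw0 => ?_⟩
  · filter_upwards [hae, ae_all_iff.2 hf0] with x hx hx0
    exact ge_of_tendsto' hx fun n => hx0 _
  · have hT := S.tendsto_potential hh hq hq1 (fun n => hfX (ψ n)) hg hLp
    have hlim : Tendsto (fun n => kirchhoffEnergy p a b q μ K Ω h (f (ψ n))) atTop
        (𝓝 (a / p * L + b / (2 * p) * L ^ 2 - μ / q * potential q Ω h g)) :=
      ((hL.const_mul _).add ((hL.pow 2).const_mul _)).sub (hT.const_mul _)
    have hlim' : Tendsto (fun n => kirchhoffEnergy p a b q μ K Ω h (f (ψ n))) atTop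
        (𝓝 (sInf V)) := (hRlim.comp hψ.tendsto_atTop).congr fun n => hfR (ψ n)
    have heq := tendsto_nhds_unique hlim hlim'
    have hinf : sInf V ≤ kirchhoffEnergy p a b q μ K Ω h w := csInf_le hVb ⟨w, hw, hw0, rfl⟩
    refine le_trans ?_ (heq.le.trans hinf)
    have := S.normPow_nonneg (u := g)
    rw [kirchhoffEnergy]
    gcongr

end Admissible

/-! ### From minimality to the singular equation. -/

/-- Fatou's lemma for Bochner integrals: an a.e. limit of nonnegative functions whose integrals
are bounded by a convergent sequence is integrable. -/
lemma integrable_and_integral_le_of_tendsto {α : Type*} [MeasurableSpace α] {ν : Measure α}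
    {f : ℕ → α → ℝ} {g : α → ℝ} {c : ℕ → ℝ} {c₀ : ℝ} (hf : ∀ n, Integrable (f n) ν)
    (hf0 : ∀ n, ∀ᵐ x ∂ν, 0 ≤ f n x)
    (hlim : ∀ᵐ x ∂ν, Tendsto (fun n => f n x) atTop (𝓝 (g x)))
    (hle : ∀ n, ∫ x, f n x ∂ν ≤ c n) (hc : Tendsto c atTop (𝓝 c₀)) :
    Integrable g ν ∧ ∫ x, g x ∂ν ≤ c₀ := by
  have hgm : AEStronglyMeasurable g ν := aestronglyMeasurable_of_tendsto_ae atTop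
    (fun n => (hf n).1) hlim
  have hg0 : 0 ≤ᵐ[ν] g := by
    filter_upwards [hlim, ae_all_iff.2 hf0] with x hx h0
    exact ge_of_tendsto' hx h0
  have hc0 : 0 ≤ c₀ := ge_of_tendsto' hc fun n => (integral_nonneg_of_ae (hf0 n)).trans (hle n)
  have hfatou : ∫⁻ x, ENNReal.ofReal (g x) ∂ν ≤ ENNReal.ofReal c₀ := by
    calc ∫⁻ x, ENNReal.ofReal (g x) ∂ν
        = ∫⁻ x, liminf (fun n => ENNReal.ofReal (f n x)) atTop ∂ν := by
          refine lintegral_congr_ae ?_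
          filter_upwards [hlim] with x hx
          exact ((ENNReal.continuous_ofReal.tendsto _).comp hx).liminf_eq.symm
      _ ≤ liminf (fun n => ∫⁻ x, ENNReal.ofReal (f n x) ∂ν) atTop :=
          lintegral_liminf_le' fun n => (hf n).1.aemeasurable.ennreal_ofReal
      _ ≤ liminf (fun n => ENNReal.ofReal (c n)) atTop := by
          refine liminf_le_liminf (Eventually.of_forall fun n => ?_)
          rw [← ofReal_integral_eq_lintegral_ofReal (hf n) (hf0 n)]
          exact ENNReal.ofReal_le_ofReal (hle n)
      _ = ENNReal.ofReal c₀ := ((ENNReal.continuous_ofReal.tendsto _).comp hc).liminf_eq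
  have hgi : Integrable g ν :=
    ⟨hgm, (hasFiniteIntegral_iff_ofReal hg0).2 (hfatou.trans_lt ENNReal.ofReal_lt_top)⟩
  refine ⟨hgi, ?_⟩
  rw [← ofReal_integral_eq_lintegral_ofReal hgi hg0] at hfatou
  exact (ENNReal.ofReal_le_ofReal_iff hc0).1 hfatou

/-- A minimizer of the Kirchhoff energy on the cone of nonnegative functions. -/
structure IsEnergyMinimizer {N : ℕ} (p a b q μ : ℝ) (K : EuclideanSpace ℝ (Fin N) → ℝ)
    (Ω : Set (EuclideanSpace ℝ (Fin N))) (h u : EuclideanSpace ℝ (Fin N) → ℝ) : Prop where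
  memX0 : MemX0 p K Ω u
  nonneg : ∀ᵐ x, 0 ≤ u x
  le : ∀ w, MemX0 p K Ω w → (∀ᵐ x, 0 ≤ w x) →
    kirchhoffEnergy p a b q μ K Ω h u ≤ kirchhoffEnergy p a b q μ K Ω h w

lemma potential_const_mul {N : ℕ} {Ω : Set (EuclideanSpace ℝ (Fin N))}
    {h u : EuclideanSpace ℝ (Fin N) → ℝ} {q t : ℝ} (ht : 0 ≤ t) :
    potential q Ω h (fun x => t * u x) = t ^ q * potential q Ω h u := by
  rw [potential, potential, ← integral_const_mul]
  refine integral_congr_ae (ae_of_all _ fun x => ?_)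
  simp only
  rw [abs_mul, abs_of_nonneg ht, Real.mul_rpow ht (abs_nonneg _)]
  ring

lemma tendsto_one_div_add_one_nhdsGT :
    Tendsto (fun n : ℕ => 1 / ((n : ℝ) + 1)) atTop (𝓝[>] 0) :=
  tendsto_nhdsWithin_iff.2 ⟨tendsto_one_div_add_atTop_nhds_zero_nat,
    Eventually.of_forall fun n => by simp only [Set.mem_Ioi]; positivity⟩

namespace Admissible

variable {N : ℕ} {p s : ℝ} {K : EuclideanSpace ℝ (Fin N) → ℝ}
  {Ω : Set (EuclideanSpace ℝ (Fin N))} {u v φ h : EuclideanSpace ℝ (Fin N) → ℝ}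
  {a b μ q H : ℝ}
  (S : Admissible N p s K Ω)
include S

/-- Ω is exhausted by the compact sets of points at distance at least 1/(n+1) from Ωᶜ. -/
lemma ae_pos_of_positiveIn (hu : PositiveIn Ω u) : ∀ᵐ x ∂(volume.restrict Ω), 0 < u x := by
  have hcover : Ω ⊆ ⋃ n : ℕ, {x | 1 / ((n : ℝ) + 1) ≤ Metric.infDist x Ωᶜ} ∩ closure Ω := by
    intro x hx
    obtain ⟨n, hn⟩ := exists_nat_one_div_lt (S.infDist_pos hx)
    exact Set.mem_iUnion.2 ⟨n, hn.le, subset_closure hx⟩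
  refine ae_restrict_of_ae_restrict_of_subset hcover ?_
  rw [ae_restrict_iUnion_iff]
  intro n
  obtain ⟨c, hc, hcu⟩ := hu ({x | 1 / ((n : ℝ) + 1) ≤ Metric.infDist x Ωᶜ} ∩ closure Ω)
    (S.isBounded.isCompact_closure.inter_left
      (isClosed_le continuous_const (Metric.continuous_infDist_pt _))) (by
      rintro x ⟨hx, -⟩
      by_contra hxΩ
      have h0 : Metric.infDist x Ωᶜ = 0 := Metric.infDist_zero_of_mem hxΩ
      have h1 : 1 / ((n : ℝ) + 1) ≤ Metric.infDist x Ωᶜ := hx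
      have h2 : 0 < 1 / ((n : ℝ) + 1) := by positivity
      linarith)
  filter_upwards [hcu] with x hx using hc.trans_le hx

lemma ae_nonneg_of_positiveIn (hu : MemX0 p K Ω u) (hpos : PositiveIn Ω u) :
    ∀ᵐ x, 0 ≤ u x := by
  filter_upwards [S.ae_eq_zero hu,
    (ae_restrict_iff' S.measurableSet).1 (S.ae_pos_of_positiveIn hpos)] with x h1 h2
  by_cases hx : x ∈ Ω
  · exact (h2 hx).le
  · exact (h1 hx).ge

lemma hasDerivAt_kirchhoff_normPow (hu : MemX0 p K Ω u) (hφ : MemX0 p K Ω φ) :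
    HasDerivAt (fun t => a / p * normPow p K Ω (fun x => u x + t * φ x) +
      b / (2 * p) * normPow p K Ω (fun x => u x + t * φ x) ^ 2)
      ((a + b * normPow p K Ω u) * pairing p K Ω u φ) 0 := by
  have hd := S.hasDerivAt_normPow hu hφ
  have hp := S.pos
  refine ((hd.const_mul (a / p)).add ((hd.pow 2).const_mul (b / (2 * p)))).congr_deriv ?_
  simp only [zero_mul, add_zero, Nat.cast_ofNat, Nat.add_one_sub_one, pow_one]
  field_simp

lemma potential_infDist_pos (hh : IsWeight Ω H h) (hq : 0 < q) (hqp : q < p)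
    (hne : ¬ h =ᵐ[volume.restrict Ω] 0) :
    0 < potential q Ω h (fun x => Metric.infDist x Ωᶜ) := by
  refine lt_of_le_of_ne (S.potential_nonneg hh) fun h0 => hne ?_
  have hnn : 0 ≤ᵐ[volume.restrict Ω] fun x => h x * |Metric.infDist x Ωᶜ| ^ q := by
    filter_upwards [ae_restrict_mem S.measurableSet] with x hx
    have := hh.nonneg x hx
    simp only [Pi.zero_apply]
    positivity
  have := (integral_eq_zero_iff_of_nonneg_ae hnn
    (S.integrable_potential hh hq hqp S.memX0_infDist)).1 h0.symm
  filter_upwards [this, ae_restrict_mem S.measurableSet] with x hx hxΩ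
  have hd := S.infDist_pos hxΩ
  have hd' : 0 < |Metric.infDist x Ωᶜ| ^ q := by positivity
  exact (mul_eq_zero.1 hx).resolve_right hd'.ne'

/-- Along td the potential is of order t^q and the kinetic part of order t^p, so q < p makes the
energy negative for small t. -/
lemma not_ae_eq_zero_of_isEnergyMinimizer (hh : IsWeight Ω H h)
    (hne : ¬ h =ᵐ[volume.restrict Ω] 0) (hμ : 0 < μ) (hq : 0 < q) (hqp : q < p)
    (hu : IsEnergyMinimizer p a b q μ K Ω h u) : ¬ u =ᵐ[volume] 0 := by
  intro hu0
  have hp := S.pos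
  set d : EuclideanSpace ℝ (Fin N) → ℝ := fun x => Metric.infDist x Ωᶜ with hd
  have hT := S.potential_infDist_pos hh hq hqp hne
  rw [← hd] at hT
  have hE0 : normPow p K Ω u = 0 := by
    rw [S.normPow_congr (v := fun x => 0 * u x) (by filter_upwards [hu0] with x hx; simp [hx]),
      S.normPow_const_mul, abs_zero, Real.zero_rpow hp.ne', zero_mul]
  have hT0 : potential q Ω h u = 0 := by
    refine (integral_congr_ae ?_).trans (integral_zero _ _)
    filter_upwards [ae_restrict_of_ae hu0] with x hx
    simp [hx, Real.zero_rpow hq.ne']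
  have hF0 : kirchhoffEnergy p a b q μ K Ω h u = 0 := by
    simp [kirchhoffEnergy, hE0, hT0]
  set E := normPow p K Ω d with hE
  have hineq : ∀ t : ℝ, 0 < t → μ / q * potential q Ω h d ≤
      a / p * E * t ^ (p - q) + b / (2 * p) * E ^ 2 * t ^ (2 * p - q) := by
    intro t ht
    have h1 := hu.le (fun x => t * d x) (S.memX0_const_mul t S.memX0_infDist)
      (ae_of_all _ fun x => mul_nonneg ht.le Metric.infDist_nonneg)
    rw [hF0, kirchhoffEnergy, S.normPow_const_mul, potential_const_mul ht.le, abs_of_pos ht,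
      ← hE] at h1
    have e1 : t ^ p = t ^ (p - q) * t ^ q := by rw [← Real.rpow_add ht]; ring_nf
    have e2 : (t ^ p) ^ 2 = t ^ (2 * p - q) * t ^ q := by
      rw [← Real.rpow_add ht, ← Real.rpow_natCast, ← Real.rpow_mul ht.le]; norm_num; ring_nf
    have h2 : 0 < t ^ q := Real.rpow_pos_of_pos ht q
    rw [mul_pow, e2, e1] at h1
    refine le_of_mul_le_mul_right ?_ h2
    linarith
  have hlim : Tendsto (fun t : ℝ => a / p * E * t ^ (p - q) +
      b / (2 * p) * E ^ 2 * t ^ (2 * p - q)) (𝓝[>] 0) (𝓝 0) := by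
    have key : ∀ r : ℝ, 0 < r → Tendsto (fun t : ℝ => t ^ r) (𝓝[>] 0) (𝓝 0) := fun r hr => by
      have := (Real.continuousAt_rpow_const (0 : ℝ) r (Or.inr hr.le)).tendsto
      rw [Real.zero_rpow hr.ne'] at this
      exact this.mono_left nhdsWithin_le_nhds
    simpa using ((key (p - q) (by linarith)).const_mul (a / p * E)).add
      ((key (2 * p - q) (by linarith)).const_mul (b / (2 * p) * E ^ 2))
  have := ge_of_tendsto hlim (eventually_mem_nhdsWithin.mono fun t ht => hineq t ht)
  have : 0 < μ / q * potential q Ω h d := by positivity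
  linarith

/-- The right difference quotients of the potential at a minimizer are controlled by those of
the kinetic part. -/
lemma slope_potential_le_of_isEnergyMinimizer
    (hu : IsEnergyMinimizer p a b q μ K Ω h u) (hφ : MemX0 p K Ω φ) {t : ℝ} (ht : 0 < t)
    (hnn : ∀ᵐ x, 0 ≤ u x + t * φ x) :
    μ / q * (t⁻¹ * (potential q Ω h (fun x => u x + t * φ x) - potential q Ω h u)) ≤
      slope (fun t => a / p * normPow p K Ω (fun x => u x + t * φ x) +
        b / (2 * p) * normPow p K Ω (fun x => u x + t * φ x) ^ 2) 0 t := by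
  have h1 := hu.le _ (S.memX0_add hu.memX0 (S.memX0_const_mul t hφ)) hnn
  rw [kirchhoffEnergy, kirchhoffEnergy] at h1
  rw [slope_def_field, sub_zero, le_div_iff₀ ht]
  simp only [zero_mul, add_zero]
  have e : ∀ r : ℝ, μ / q * (t⁻¹ * r) * t = μ / q * r := fun r => by field_simp
  rw [e]
  linarith

lemma potential_mono (hh : IsWeight Ω H h) (hq : 0 < q) (hqp : q < p) (hu : MemX0 p K Ω u)
    (hv : MemX0 p K Ω v) (huv : ∀ᵐ x, |u x| ≤ |v x|) :
    potential q Ω h u ≤ potential q Ω h v := by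
  refine integral_mono_ae (S.integrable_potential hh hq hqp hu)
    (S.integrable_potential hh hq hqp hv) ?_
  filter_upwards [ae_restrict_mem S.measurableSet, ae_restrict_of_ae huv] with x hx h1
  exact mul_le_mul_of_nonneg_left (Real.rpow_le_rpow (abs_nonneg _) h1 hq.le) (hh.nonneg x hx)

lemma tendsto_slope_kirchhoff (hu : MemX0 p K Ω u) (hφ : MemX0 p K Ω φ) :
    Tendsto (fun n : ℕ => slope (fun t => a / p * normPow p K Ω (fun x => u x + t * φ x) +
        b / (2 * p) * normPow p K Ω (fun x => u x + t * φ x) ^ 2) 0 (1 / ((n : ℝ) + 1))) atTop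
      (𝓝 ((a + b * normPow p K Ω u) * pairing p K Ω u φ)) :=
  (hasDerivAt_iff_tendsto_slope.1 (S.hasDerivAt_kirchhoff_normPow hu hφ)).comp
    (tendsto_one_div_add_one_nhdsGT.mono_right (nhdsWithin_mono _ fun _ ht => ne_of_gt ht))

/-- Only monotonicity of the potential is used, not its derivative; so u is known to be a
supersolution before the singular term is known to be integrable. -/
lemma pairing_nonneg_of_isEnergyMinimizer (hh : IsWeight Ω H h) (ha : 0 < a) (hb : 0 ≤ b)
    (hμ : 0 < μ) (hq : 0 < q) (hqp : q < p)
    (hu : IsEnergyMinimizer p a b q μ K Ω h u) (hφ : MemX0 p K Ω φ) (hφ0 : ∀ x, 0 ≤ φ x) :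
    0 ≤ pairing p K Ω u φ := by
  have hE := S.normPow_nonneg (u := u)
  have hA : 0 < a + b * normPow p K Ω u := by positivity
  refine nonneg_of_mul_nonneg_right (ge_of_tendsto' (S.tendsto_slope_kirchhoff hu.memX0 hφ)
    fun n => ?_) hA
  have ht : 0 < 1 / ((n : ℝ) + 1) := by positivity
  have hnn : ∀ᵐ x, 0 ≤ u x + 1 / ((n : ℝ) + 1) * φ x := by
    filter_upwards [hu.nonneg] with x hx
    have := mul_nonneg ht.le (hφ0 x)
    linarith
  refine le_trans ?_ (S.slope_potential_le_of_isEnergyMinimizer hu hφ ht hnn)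
  have hmono := S.potential_mono hh hq hqp hu.memX0
    (S.memX0_add hu.memX0 (S.memX0_const_mul (1 / ((n : ℝ) + 1)) hφ)) (by
      filter_upwards [hu.nonneg] with x hx
      have := mul_nonneg ht.le (hφ0 x)
      exact abs_le_abs_of_nonneg hx (by linarith))
  have : 0 ≤ (1 / ((n : ℝ) + 1))⁻¹ * (potential q Ω h
    (fun x => u x + 1 / ((n : ℝ) + 1) * φ x) - potential q Ω h u) :=
    mul_nonneg (inv_pos.2 ht).le (by linarith)
  positivity

lemma positiveIn_of_isEnergyMinimizer (hh : IsWeight Ω H h)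
    (hne : ¬ h =ᵐ[volume.restrict Ω] 0) (ha : 0 < a) (hb : 0 ≤ b)
    (hμ : 0 < μ) (hq : 0 < q) (hqp : q < p)
    (hu : IsEnergyMinimizer p a b q μ K Ω h u) : PositiveIn Ω u :=
  S.positiveIn_of_supersolution hu.memX0 hu.nonneg
    (S.not_ae_eq_zero_of_isEnergyMinimizer hh hne hμ hq hqp hu) fun _ hφ hφ0 =>
    S.pairing_nonneg_of_isEnergyMinimizer hh ha hb hμ hq hqp hu hφ hφ0

/-- The variational inequality for nonnegative test functions. -/
lemma integrable_and_le_of_isEnergyMinimizer (hh : IsWeight Ω H h)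
    (hμ : 0 < μ) (hq : 0 < q) (hqp : q < p)
    (hu : IsEnergyMinimizer p a b q μ K Ω h u) (hpos : PositiveIn Ω u)
    (hφ : MemX0 p K Ω φ) (hφ0 : ∀ᵐ x, 0 ≤ φ x) :
    Integrable (fun x => h x * u x ^ (q - 1) * φ x) (volume.restrict Ω) ∧
      μ * ∫ x in Ω, h x * u x ^ (q - 1) * φ x ≤
        (a + b * normPow p K Ω u) * pairing p K Ω u φ := by
  have hX : ∀ n : ℕ, MemX0 p K Ω (fun x => u x + 1 / ((n : ℝ) + 1) * φ x) := fun n =>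
    S.memX0_add hu.memX0 (S.memX0_const_mul _ hφ)
  have hnn : ∀ n : ℕ, ∀ᵐ x, 0 ≤ u x + 1 / ((n : ℝ) + 1) * φ x := fun n => by
    filter_upwards [hu.nonneg, hφ0] with x hx hx'
    positivity
  have hi := fun n => S.integrable_potential hh hq hqp (hX n)
  have hiu := S.integrable_potential hh hq hqp hu.memX0
  have key := integrable_and_integral_le_of_tendsto (ν := volume.restrict Ω)
    (f := fun n : ℕ => fun x => μ / q * ((1 / ((n : ℝ) + 1))⁻¹ *
      (h x * |u x + 1 / ((n : ℝ) + 1) * φ x| ^ q - h x * |u x| ^ q)))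
    (g := fun x => μ * (h x * u x ^ (q - 1) * φ x))
    (fun n => (((hi n).sub hiu).const_mul _).const_mul _)
    (fun n => by
      filter_upwards [ae_restrict_mem S.measurableSet, ae_restrict_of_ae hu.nonneg,
        ae_restrict_of_ae hφ0] with x hx h1 h2
      have h3 := hh.nonneg x hx
      have h4 : |u x| ^ q ≤ |u x + 1 / ((n : ℝ) + 1) * φ x| ^ q := by
        refine Real.rpow_le_rpow (abs_nonneg _) (abs_le_abs_of_nonneg h1 ?_) hq.le
        have : 0 ≤ 1 / ((n : ℝ) + 1) * φ x := by positivity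
        linarith
      have h5 := mul_le_mul_of_nonneg_left h4 h3
      have h6 := sub_nonneg.2 h5
      positivity)
    (by
      filter_upwards [S.ae_pos_of_positiveIn hpos, ae_restrict_of_ae hφ0] with x h1 h2
      -- Positivity of u at x is what makes this power differentiable. The difference quotients are
      -- nonnegative, so Fatou's lemma applies to their integrals.
      have hd : HasDerivAt (fun t : ℝ => (u x + t * φ x) ^ q) (φ x * q * u x ^ (q - 1)) 0 := by
        have h3 : HasDerivAt (fun t : ℝ => u x + t * φ x) (φ x) 0 := by
          simpa using ((hasDerivAt_id (0 : ℝ)).mul_const (φ x)).const_add (u x)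
        have := h3.rpow_const (p := q) (Or.inl (by simpa using h1.ne'))
        simpa using this
      have hs := ((hasDerivAt_iff_tendsto_slope.1 hd).comp
        (tendsto_one_div_add_one_nhdsGT.mono_right
          (nhdsWithin_mono _ fun _ ht => ne_of_gt ht))).const_mul (μ / q * h x)
      have e : μ / q * h x * (φ x * q * u x ^ (q - 1)) = μ * (h x * u x ^ (q - 1) * φ x) := by
        field_simp
      rw [e] at hs
      refine hs.congr fun n => ?_
      have h3 : 0 ≤ 1 / ((n : ℝ) + 1) * φ x := by positivity
      simp only [Function.comp_apply, slope_def_field, sub_zero, zero_mul, add_zero]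
      rw [abs_of_pos h1, abs_of_nonneg (by linarith), div_eq_inv_mul]
      ring)
    (fun n => by
      rw [integral_const_mul, integral_const_mul, integral_sub (hi n) hiu]
      exact S.slope_potential_le_of_isEnergyMinimizer hu hφ (by positivity) (hnn n))
    (S.tendsto_slope_kirchhoff hu.memX0 hφ)
  refine ⟨?_, by simpa only [integral_const_mul] using key.2⟩
  have := key.1.const_mul μ⁻¹
  refine this.congr (ae_of_all _ fun x => ?_)
  exact inv_mul_cancel_left₀ hμ.ne' _

lemma integrable_of_isEnergyMinimizer (hh : IsWeight Ω H h)
    (hμ : 0 < μ) (hq : 0 < q) (hqp : q < p)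
    (hu : IsEnergyMinimizer p a b q μ K Ω h u) (hpos : PositiveIn Ω u)
    (hφ : MemX0 p K Ω φ) :
    Integrable (fun x => h x * u x ^ (q - 1) * φ x) (volume.restrict Ω) := by
  have h1 := (S.integrable_and_le_of_isEnergyMinimizer hh hμ hq hqp hu hpos
    (S.memX0_posPart hφ) (ae_of_all _ fun x => le_max_right _ _)).1
  have h2 := (S.integrable_and_le_of_isEnergyMinimizer hh hμ hq hqp hu hpos
    (S.memX0_posPart (S.memX0_neg hφ)) (ae_of_all _ fun x => le_max_right _ _)).1
  refine (h1.sub h2).congr (ae_of_all _ fun x => ?_)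
  simp only [Pi.sub_apply]
  rw [← mul_sub]
  congr 1
  rcases le_total (φ x) 0 with h0 | h0
  · rw [max_eq_right h0, max_eq_left (by linarith)]; ring
  · rw [max_eq_left h0, max_eq_right (by linarith)]; ring

/-- Dilations (1 + t)u stay in the cone for both signs of t, so the derivative vanishes and an
equality results. -/
lemma eq_self_of_isEnergyMinimizer (hq : 0 < q)
    (hu : IsEnergyMinimizer p a b q μ K Ω h u) (hpos : PositiveIn Ω u) :
    (a + b * normPow p K Ω u) * normPow p K Ω u =
      μ * ∫ x in Ω, h x * u x ^ (q - 1) * u x := by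
  have hT : ∫ x in Ω, h x * u x ^ (q - 1) * u x = potential q Ω h u := by
    refine integral_congr_ae ?_
    filter_upwards [S.ae_pos_of_positiveIn hpos] with x hx
    rw [abs_of_pos hx, mul_assoc, Real.rpow_sub_one hx.ne', div_mul_cancel₀ _ hx.ne']
  rw [hT]
  have hd : HasDerivAt (fun t : ℝ => μ / q * ((1 + t) ^ q * potential q Ω h u))
      (μ * potential q Ω h u) 0 := by
    have h1 : HasDerivAt (fun t : ℝ => 1 + t) 1 0 := (hasDerivAt_id (0 : ℝ)).const_add 1
    have h2 := h1.rpow_const (p := q) (Or.inl (by norm_num))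
    refine ((h2.mul_const (potential q Ω h u)).const_mul (μ / q)).congr_deriv ?_
    simp only [add_zero, Real.one_rpow]
    field_simp
  have hd' := (S.hasDerivAt_kirchhoff_normPow (a := a) (b := b) hu.memX0 hu.memX0).sub hd
  have hmin : IsLocalMin (fun t : ℝ => a / p * normPow p K Ω (fun x => u x + t * u x) +
      b / (2 * p) * normPow p K Ω (fun x => u x + t * u x) ^ 2 -
      μ / q * ((1 + t) ^ q * potential q Ω h u)) 0 := by
    filter_upwards [Ioi_mem_nhds (show (-1 : ℝ) < 0 by norm_num)] with t ht
    have ht' : 0 ≤ 1 + t := by have : -1 < t := ht; linarith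
    have h1 := hu.le _ (S.memX0_const_mul (1 + t) hu.memX0) (by
      filter_upwards [hu.nonneg] with x hx
      positivity)
    rw [kirchhoffEnergy, kirchhoffEnergy, potential_const_mul ht'] at h1
    simp only [zero_mul, add_zero, Real.one_rpow, one_mul]
    have e : (fun x => u x + t * u x) = fun x => (1 + t) * u x := by ext x; ring
    rwa [e]
  have := hmin.hasDerivAt_eq_zero hd'
  rw [S.pairing_self] at this
  linarith

/-- The scalar Caccioppoli inequality with g = -tφ. The error made by truncating u + tφ is O(t^p),
hence o(t), without any estimate of the set where u + tφ < 0. -/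
lemma pairing_posPart_le (hu : MemX0 p K Ω u) (hφ : MemX0 p K Ω φ) {t : ℝ} (ht : 0 ≤ t) :
    pairing p K Ω u (fun x => max (-t * φ x - u x) 0) ≤
      (2 * 3 ^ (p - 1) + 2) * (t ^ p * normPow p K Ω φ) := by
  have hX := S.memX0_const_mul (-t) hφ
  have hn := S.memX0_posPart (S.memX0_sub hX hu)
  have e := S.normPow_const_mul (u := φ) (-t)
  rw [abs_neg, abs_of_nonneg ht] at e
  rw [← e, S.pairing_eq, S.normPow_eq, ← integral_const_mul]
  refine integral_mono (S.integrable_pairing hu hn) ((S.integrable_rpow_diff hX).const_mul _)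
    fun z => ?_
  refine (signedPow_mul_posPart_sub_le S.one_lt (u z.1) (u z.2) (-t * φ z.1)
    (-t * φ z.2)).trans (sub_le_self _ (by positivity))

/-- The variational inequality for arbitrary test functions. -/
lemma le_of_isEnergyMinimizer (hh : IsWeight Ω H h) (ha : 0 < a) (hb : 0 ≤ b)
    (hμ : 0 < μ) (hq : 0 < q) (hqp : q < p)
    (hu : IsEnergyMinimizer p a b q μ K Ω h u) (hpos : PositiveIn Ω u)
    (hφ : MemX0 p K Ω φ) :
    μ * ∫ x in Ω, h x * u x ^ (q - 1) * φ x ≤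
      (a + b * normPow p K Ω u) * pairing p K Ω u φ := by
  set A := a + b * normPow p K Ω u with hA
  have hE := S.normPow_nonneg (u := u)
  have hA0 : 0 < A := by positivity
  have hint := fun {ψ} (hψ : MemX0 p K Ω ψ) =>
    S.integrable_of_isEnergyMinimizer hh hμ hq hqp hu hpos hψ
  have hself := S.eq_self_of_isEnergyMinimizer hq hu hpos
  rw [← hA] at hself
  set c := A * ((2 * 3 ^ (p - 1) + 2) * normPow p K Ω φ) with hc
  have hineq : ∀ t : ℝ, 0 < t → μ * ∫ x in Ω, h x * u x ^ (q - 1) * φ x ≤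
      A * pairing p K Ω u φ + c * t ^ (p - 1) := by
    intro t ht
    have hX := S.memX0_add hu.memX0 (S.memX0_const_mul t hφ)
    have hn := S.memX0_posPart (S.memX0_sub (S.memX0_const_mul (-t) hφ) hu.memX0)
    have h1 := (S.integrable_and_le_of_isEnergyMinimizer hh hμ hq hqp hu hpos
      (S.memX0_posPart hX) (ae_of_all _ fun x => le_max_right _ _)).2
    rw [← hA] at h1
    -- In the inequality tested with (u + tφ)⁺, the terms of order 0 cancel by the equality for φ =
    -- u. Division by t leaves an error of order t^{p-1}.
    have e1 : (fun x => max (u x + t * φ x) 0) =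
        fun x => (u x + t * φ x) + max (-t * φ x - u x) 0 := by
      ext x
      rcases le_total (u x + t * φ x) 0 with h0 | h0
      · rw [max_eq_right h0, max_eq_left (by linarith)]; ring
      · rw [max_eq_left h0, max_eq_right (by linarith)]; ring
    have h2 : ∫ x in Ω, h x * u x ^ (q - 1) * u x +
        t * (h x * u x ^ (q - 1) * φ x) ≤
        ∫ x in Ω, h x * u x ^ (q - 1) * max (u x + t * φ x) 0 := by
      refine integral_mono_ae ((hint hu.memX0).add ((hint hφ).const_mul t))
        (hint (S.memX0_posPart hX)) ?_
      filter_upwards [ae_restrict_mem S.measurableSet, S.ae_pos_of_positiveIn hpos] with x hx h0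
      have h3 := hh.nonneg x hx
      calc h x * u x ^ (q - 1) * u x + t * (h x * u x ^ (q - 1) * φ x)
          = h x * u x ^ (q - 1) * (u x + t * φ x) := by ring
        _ ≤ _ := mul_le_mul_of_nonneg_left (le_max_left _ _) (by positivity)
    rw [integral_add (hint hu.memX0) ((hint hφ).const_mul t), integral_const_mul] at h2
    rw [S.pairing_congr_right (v := fun x => (u x + t * φ x) + max (-t * φ x - u x) 0)
      (ae_of_all _ fun x => congrFun e1 x), S.pairing_add hu.memX0 hX hn,
      S.pairing_add hu.memX0 hu.memX0 (S.memX0_const_mul t hφ), S.pairing_const_mul,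
      S.pairing_self] at h1
    have h4 := mul_le_mul_of_nonneg_left (S.pairing_posPart_le hu.memX0 hφ ht.le) hA0.le
    have h5 := mul_le_mul_of_nonneg_left h2 hμ.le
    have e2 : t ^ p = t * t ^ (p - 1) := by
      rw [Real.rpow_sub_one ht.ne']; field_simp
    rw [e2] at h4
    refine le_of_mul_le_mul_left ?_ ht
    rw [hc]
    linarith
  have hlim : Tendsto (fun t : ℝ => A * pairing p K Ω u φ + c * t ^ (p - 1)) (𝓝[>] 0)
      (𝓝 (A * pairing p K Ω u φ + c * 0)) := by
    have hr : 0 < p - 1 := by linarith [S.one_lt]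
    have := (Real.continuousAt_rpow_const (0 : ℝ) (p - 1) (Or.inr hr.le)).tendsto
    rw [Real.zero_rpow hr.ne'] at this
    exact ((this.mono_left nhdsWithin_le_nhds).const_mul c).const_add _
  rw [mul_zero, add_zero] at hlim
  exact ge_of_tendsto hlim (eventually_mem_nhdsWithin.mono fun t ht => hineq t ht)

lemma isPositiveWeakSolution_of_isEnergyMinimizer {γ : ℝ} (hh : IsWeight Ω H h)
    (hne : ¬ h =ᵐ[volume.restrict Ω] 0) (ha : 0 < a) (hb : 0 ≤ b)
    (hμ : 0 < μ) (hγ0 : 0 < γ) (hγ1 : γ < 1)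
    (hu : IsEnergyMinimizer p a b (1 - γ) μ K Ω h u) :
    IsPositiveWeakSolution p a b γ μ K Ω h u := by
  have hq : 0 < 1 - γ := by linarith
  have hqp : 1 - γ < p := by linarith [S.one_lt]
  have hpos := S.positiveIn_of_isEnergyMinimizer hh hne ha hb hμ hq hqp hu
  have e : 1 - γ - 1 = -γ := by ring
  refine ⟨hu.memX0, hpos, fun φ hφ => ?_, fun φ hφ => le_antisymm ?_ ?_⟩
  · have := S.integrable_of_isEnergyMinimizer hh hμ hq hqp hu hpos hφ
    rwa [e] at this
  · have := S.le_of_isEnergyMinimizer hh ha hb hμ hq hqp hu hpos (S.memX0_neg hφ)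
    rw [e, S.pairing_neg] at this
    simp only [mul_neg, integral_neg] at this
    linarith
  · have := S.le_of_isEnergyMinimizer hh ha hb hμ hq hqp hu hpos hφ
    rwa [e] at this

end Admissible

/-! ### Uniqueness and the lower bound by eigenfunctions. -/

namespace Admissible

variable {N : ℕ} {p s : ℝ} {K : EuclideanSpace ℝ (Fin N) → ℝ}
  {Ω : Set (EuclideanSpace ℝ (Fin N))} {u v w φ h : EuclideanSpace ℝ (Fin N) → ℝ}
  {a b γ μ H : ℝ}
  (S : Admissible N p s K Ω)
include S

/-- Strict monotonicity of the odd power forces equal increments almost everywhere, and a function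
of X₀ with zero increments is 0 by the Poincaré inequality. -/
lemma ae_eq_of_pairing_sub_le (hu : MemX0 p K Ω u) (hw : MemX0 p K Ω w)
    (hle : pairing p K Ω u (fun x => u x - w x) ≤ pairing p K Ω w (fun x => u x - w x)) :
    u =ᵐ[volume] w := by
  have hX := S.memX0_sub hu hw
  have hi : Integrable (fun z => (signedPow p (diff u z) - signedPow p (diff w z)) *
      (diff u z - diff w z)) (jumpMeasure K Ω) := by
    refine ((S.integrable_pairing hu hX).sub (S.integrable_pairing hw hX)).congr
      (ae_of_all _ fun z => ?_)
    simp only [Pi.sub_apply, diff]; ring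
  have h0 : 0 ≤ᵐ[jumpMeasure K Ω] fun z => (signedPow p (diff u z) - signedPow p (diff w z)) *
      (diff u z - diff w z) := ae_of_all _ fun z => signedPow_sub_mul_sub_nonneg S.one_lt _ _
  have hI : ∫ z, (signedPow p (diff u z) - signedPow p (diff w z)) *
      (diff u z - diff w z) ∂(jumpMeasure K Ω) =
      pairing p K Ω u (fun x => u x - w x) - pairing p K Ω w (fun x => u x - w x) := by
    rw [S.pairing_eq, S.pairing_eq,
      ← integral_sub (S.integrable_pairing hu hX) (S.integrable_pairing hw hX)]
    congr 1; ext z; simp only [diff]; ring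
  have hz := (integral_eq_zero_iff_of_nonneg_ae h0 hi).1
    (le_antisymm (by linarith) (integral_nonneg_of_ae h0))
  have hd : (fun x => u x - w x) =ᵐ[volume] 0 := by
    refine S.ae_eq_zero_of_diff_ae_eq_zero hX ?_
    filter_upwards [hz] with z hz
    have e := eq_of_signedPow_sub_mul_sub_eq_zero S.one_lt hz
    simp only [diff] at e ⊢
    linarith
  filter_upwards [hd] with x hx
  exact sub_eq_zero.1 hx

/-- Weak solutions of the singular Kirchhoff problem are unique. -/
lemma ae_eq_of_isPositiveWeakSolution (hh : IsWeight Ω H h) (ha : 0 < a) (hb : 0 ≤ b)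
    (hμ : 0 < μ) (hγ : 0 < γ) (hu : IsPositiveWeakSolution p a b γ μ K Ω h u)
    (hw : IsPositiveWeakSolution p a b γ μ K Ω h w) : u =ᵐ[volume] w := by
  have hp := S.pos
  have hX := S.memX0_sub hu.memX0 hw.memX0
  have hEu := S.normPow_nonneg (u := u)
  have hEw := S.normPow_nonneg (u := w)
  have e1 := hu.weak_eq _ hX
  have e2 := hw.weak_eq _ hX
  have hR : ∫ x in Ω, h x * u x ^ (-γ) * (u x - w x) ≤
      ∫ x in Ω, h x * w x ^ (-γ) * (u x - w x) := by
    refine integral_mono_ae (hu.integrableOn _ hX) (hw.integrableOn _ hX) ?_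
    filter_upwards [ae_restrict_mem S.measurableSet, S.ae_pos_of_positiveIn hu.positive,
      S.ae_pos_of_positiveIn hw.positive] with x hx h1 h2
    have h0 := hh.nonneg x hx
    rw [mul_assoc, mul_assoc]
    refine mul_le_mul_of_nonneg_left ?_ h0
    rcases le_total (u x) (w x) with h3 | h3
    · have := Real.rpow_le_rpow_of_nonpos h1 h3 (neg_nonpos.2 hγ.le)
      exact mul_le_mul_of_nonpos_right this (by linarith)
    · have := Real.rpow_le_rpow_of_nonpos h2 h3 (neg_nonpos.2 hγ.le)
      exact mul_le_mul_of_nonneg_right this (by linarith)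
  have hle : (a + b * normPow p K Ω u) * pairing p K Ω u (fun x => u x - w x) ≤
      (a + b * normPow p K Ω w) * pairing p K Ω w (fun x => u x - w x) := by
    rw [e1, e2]; exact mul_le_mul_of_nonneg_left hR hμ.le
  have hA : a + b * normPow p K Ω u = a + b * normPow p K Ω w := by
    have hle' := hle
    rw [S.pairing_sub hu.memX0 hu.memX0 hw.memX0, S.pairing_sub hw.memX0 hu.memX0 hw.memX0,
      S.pairing_self, S.pairing_self] at hle'
    have y1 := mul_le_mul_of_nonneg_left (S.pairing_le_young hu.memX0 hw.memX0)
      (show 0 ≤ a + b * normPow p K Ω u by positivity)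
    have y2 := mul_le_mul_of_nonneg_left (S.pairing_le_young hw.memX0 hu.memX0)
      (show 0 ≤ a + b * normPow p K Ω w by positivity)
    set X := normPow p K Ω u
    set Y := normPow p K Ω w
    -- Young's inequality gives X - ⟨u,w⟩ ≥ (X - Y)/p and ⟨w,u⟩ - Y ≤ (X - Y)/p. Inserting both in
    -- the inequality above leaves this square: either b = 0 or the norms agree, and in both cases
    -- the Kirchhoff coefficients coincide.
    have h3 : 1 / p * (b * (X - Y) ^ 2) ≤ 0 := by linarith
    have h4 : b * (X - Y) ^ 2 = 0 :=
      le_antisymm (nonpos_of_mul_nonpos_right h3 (by positivity)) (by positivity)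
    rcases mul_eq_zero.1 h4 with h5 | h5
    · simp [h5]
    · rw [sub_eq_zero.1 (pow_eq_zero_iff two_ne_zero |>.1 h5)]
  rw [hA] at hle
  exact S.ae_eq_of_pairing_sub_le hu.memX0 hw.memX0
    (le_of_mul_le_mul_left hle (by positivity))

/-- A weak solution dominates a multiple of every positive first eigenfunction. -/
lemma exists_mul_eigenfunction_le (hh : IsWeight Ω H h) (ha : 0 < a) (hb : 0 ≤ b)
    (hμ : 0 < μ) (hu : IsPositiveWeakSolution p a b γ μ K Ω h u)
    (hv : IsPositiveFirstEigenfunction p K Ω v) :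
    ∃ ε : ℝ, 0 < ε ∧ ∀ᵐ x, ε * v x ≤ u x := by
  have hE := S.normPow_nonneg (u := u)
  have hv0 := S.ae_nonneg_of_positiveIn hv.memX0 hv.positive
  have hsub : ∀ φ, MemX0 p K Ω φ → (∀ x, 0 ≤ φ x) → pairing p K Ω v φ ≤
      firstEigenvalue p K Ω * ∫ x in Ω, |v x| ^ (p - 2) * v x * φ x :=
    fun φ hφ _ => (hv.weak_eq φ hφ).le
  obtain ⟨M, hM, hvM⟩ := S.exists_ae_le_of_subsolution S.firstEigenvalue_nonneg hv.memX0 hv0 hsub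
  refine S.exists_mul_le_supersolution hu.memX0 hu.positive (fun φ hφ hφ0 => ?_)
    S.firstEigenvalue_nonneg hv.memX0 hv0 hvM hM hsub
  have hA : 0 < a + b * normPow p K Ω u := by positivity
  refine nonneg_of_mul_nonneg_right ?_ hA
  rw [hu.weak_eq φ hφ]
  refine mul_nonneg hμ.le (integral_nonneg_of_ae ?_)
  filter_upwards [ae_restrict_mem S.measurableSet, S.ae_pos_of_positiveIn hu.positive] with x hx h1
  have h0 := hh.nonneg x hx
  have h2 := hφ0 x
  simp only [Pi.zero_apply]
  positivity

end Admissible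

end FracKirchhoff

theorem mainTheorem6 (N : ℕ) (hN : 2 ≤ N) (p s a b γ : ℝ)
    (hp : 1 < p) (hs0 : 0 < s) (hs1 : s < 1) (hsp : s * p < N)
    (ha : 0 < a) (hb : 0 ≤ b) (hγ0 : 0 < γ) (hγ1 : γ < 1)
    (Ω : Set (EuclideanSpace ℝ (Fin N)))
    (hΩo : IsOpen Ω) (hΩc : IsConnected Ω) (hΩb : Bornology.IsBounded Ω)
    (K : EuclideanSpace ℝ (Fin N) → ℝ) (hK : FracKirchhoff.IsAdmissibleKernel p s K)
    (h : EuclideanSpace ℝ (Fin N) → ℝ)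
    (hhm : AEStronglyMeasurable h (volume.restrict Ω))
    (hh0 : ∀ x ∈ Ω, 0 ≤ h x) (hhb : ∃ C : ℝ, ∀ x ∈ Ω, h x ≤ C)
    (hhne : ¬ (h =ᵐ[volume.restrict Ω] 0)) :
    (∃ v₀ : EuclideanSpace ℝ (Fin N) → ℝ,
      FracKirchhoff.IsPositiveFirstEigenfunction p K Ω v₀) ∧
    ∀ μ : ℝ, 0 < μ →
      ∃ u : EuclideanSpace ℝ (Fin N) → ℝ,
        FracKirchhoff.IsPositiveWeakSolution p a b γ μ K Ω h u ∧
        (∀ w : EuclideanSpace ℝ (Fin N) → ℝ,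
          FracKirchhoff.IsPositiveWeakSolution p a b γ μ K Ω h w → w =ᵐ[volume] u) ∧
        (∀ v₀ : EuclideanSpace ℝ (Fin N) → ℝ,
          FracKirchhoff.IsPositiveFirstEigenfunction p K Ω v₀ →
            ∃ ε : ℝ, 0 < ε ∧ ∀ᵐ x ∂(volume.restrict Ω), ε * v₀ x ≤ u x) := by
  have S : FracKirchhoff.Admissible N p s K Ω :=
    ⟨by omega, hp, hs0, hΩo, hΩc.nonempty, hΩb, hK⟩
  obtain ⟨H, hH⟩ := hhb
  have hh : FracKirchhoff.IsWeight Ω H h := ⟨hhm, hh0, hH⟩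
  refine ⟨S.exists_isPositiveFirstEigenfunction, fun μ hμ => ?_⟩
  obtain ⟨u, hu, hu0, hmin⟩ := S.exists_kirchhoffEnergy_minimizer ha hb hμ hh
    (show 0 < 1 - γ by linarith) (by linarith)
  have hsol := S.isPositiveWeakSolution_of_isEnergyMinimizer hh hhne ha hb hμ hγ0 hγ1
    ⟨hu, hu0, hmin⟩
  refine ⟨u, hsol, fun w hw => S.ae_eq_of_isPositiveWeakSolution hh ha hb hμ hγ0 hw hsol,
    fun v₀ hv₀ => ?_⟩
  obtain ⟨ε, hε, hle⟩ := S.exists_mul_eigenfunction_le hh ha hb hμ hsol hv₀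
  exact ⟨ε, hε, ae_restrict_of_ae hle⟩
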